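/- Let $m>3$ be an integer, $\gamma>1/2$, $\sigma>0$, $\mathbb T=\mathbb R/2\pi\mathbb Z$, $\Pi=[0,1]\times\mathbb T\ni(\psi,\theta)$. All functions are complex valued. Spaces. $X^m_\sigma(\mathbb T)$ is the space of functions $v$ on $\mathbb T$ with $\|v\|^2=\sum_k(1+k^2)^m e^{2\sigma|k|}|\hat v_k|^2<\infty$. $K^m_\gamma(\Pi)$ is the space of functions $u$ with $\|u\|^2=\sum_{p+q\le m}\|\psi^{p-\gamma}\partial_\psi^p\partial_\theta^q u\|^2_{L^2(\Pi)}<\infty$ (weak derivatives). $K^{m,\sigma}_\gamma(\Pi)$ is the space of $u=\sum_k\hat u_k(\psi)e^{ik\theta}\in K^m_\gamma(\Pi)$ such that $\sum_k e^{\sigma|k|}\hat u_k(\psi)e^{ik\theta}$ also lies in $K^m_\gamma(\Pi)$, normed by the $K^m_\gamma(\Pi)$-norm of the latter. For real $\lambda$, $$J^{m,\sigma}_{\lambda,\gamma}(\Pi)=\{v(\theta)\psi^\lambda+w(\psi,\theta): v\in X^m_\sigma(\mathbb T),\ w\in K^{m,\sigma}_{\lambda+\gamma}(\Pi)\}$$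 with the norm of the direct sum, and $$\widetilde J^{m,\sigma}_{0,\gamma}(\Pi)=\Big\{v(\theta)+w(\psi,\theta)\in J^{m,\sigma}_{0,\gamma}(\Pi):\int_{\mathbb T}v(\theta)e^{\pm2i\theta}\,d\theta=0\Big\}.$$ Let $\Xi$ be the vorticity operator $$\Xi(a)=-\frac1{a_\psi^3}\Big(1+\frac{a_\theta^2}{a^2}\Big)a_{\psi\psi}+\frac{2a_\theta}{a^2a_\psi^2}a_{\psi\theta}-\frac1{a^2a_\psi}a_{\theta\theta}+\frac1{aa_\psi}.$$ Theorem. For every $a\in J^{m,\sigma}_{1/2,\gamma}(\Pi)$ the rescaled derivatives $[\psi^{-1/2}a]$, $[\psi^{1/2}a_\psi]$, $[\psi^{-1/2}a_\theta]$, $[\psi^{3/2}a_{\psi\psi}]$, $[\psi^{1/2}a_{\psi\theta}]$, $[\psi^{-1/2}a_{\theta\theta}]$ belong to $J^{m-2,\sigma}_{0,\gamma}(\Pi)$. There is an open neighbourhood $U$ of $\psi^{1/2}$ in $J^{m,\sigma}_{1/2,\gamma}(\Pi)$ such that for all $a\in U$ the functions $a$ and $a_\psi$ are nonzero at almost every point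 of $\Pi$, $\Xi(a)$ belongs to $\widetilde J^{m-2,\sigma}_{0,\gamma}(\Pi)$ (in particular the $\pm2$ Fourier modes of its leading term vanish) and equals the same rational expression with $a,a_\psi,a_\theta,a_{\psi\psi},a_{\psi\theta},a_{\theta\theta}$ replaced by their rescaled versions $[\,\cdot\,]$; and the map $\Xi:U\to\widetilde J^{m-2,\sigma}_{0,\gamma}(\Pi)$ is complex analytic. -/

import Mathlib

open MeasureTheory Set
open scoped ContDiff

noncomputable section

/-- Lebesgue measure on the circle `𝕋 = ℝ / 2πℤ`, seen on the fundamental domain `(0, 2π)`. -/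
def muT : Measure ℝ := volume.restrict (Ioo 0 (2 * Real.pi))

/-- Lebesgue measure on the unit interval of values of the stream function. -/
def muI : Measure ℝ := volume.restrict (Ioo 0 1)

/-- Lebesgue measure `dψ dθ` on `Π = [0, 1] × 𝕋`. Points are pairs `x = (ψ, θ)`. -/
def muPi : Measure (ℝ × ℝ) := muI.prod muT

instance : IsFiniteMeasure muT := by unfold muT; infer_instance
instance : IsFiniteMeasure muI := by unfold muI; infer_instance
instance : IsFiniteMeasure muPi := by unfold muPi; infer_instance

/-! ### Fourier coefficients in the angle -/

/-- The Fourier coefficient `(1 / 2π) ∫_𝕋 f(θ) e^{-ikθ} dθ`. -/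
def fcoef (f : ℝ → ℂ) (k : ℤ) : ℂ :=
  (1 / (2 * (Real.pi : ℂ))) * ∫ θ, Complex.exp (-(Complex.I * k * θ)) * f θ ∂muT

lemma norm_exp_neg_I_mul (k : ℤ) (θ : ℝ) : ‖Complex.exp (-(Complex.I * k * θ))‖ = 1 := by
  have : -(Complex.I * k * θ) = ((-(k * θ) : ℝ) : ℂ) * Complex.I := by push_cast; ring
  rw [this, Complex.norm_exp_ofReal_mul_I]

lemma integrable_exp_mul {f : ℝ → ℂ} (hf : Integrable f muT) (k : ℤ) :
    Integrable (fun θ : ℝ => Complex.exp (-(Complex.I * k * θ)) * f θ) muT := by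
  refine hf.bdd_mul (c := 1) ?_ ?_
  · exact (by fun_prop : Continuous fun θ : ℝ =>
      Complex.exp (-(Complex.I * k * θ))).aestronglyMeasurable
  · exact Filter.Eventually.of_forall fun θ => (norm_exp_neg_I_mul k θ).le

lemma fcoef_congr {f g : ℝ → ℂ} (h : f =ᵐ[muT] g) (k : ℤ) : fcoef f k = fcoef g k := by
  unfold fcoef
  congr 1
  refine integral_congr_ae ?_
  filter_upwards [h] with θ hθ
  rw [hθ]

lemma fcoef_add {f g : ℝ → ℂ} (hf : Integrable f muT) (hg : Integrable g muT) (k : ℤ) :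
    fcoef (fun θ => f θ + g θ) k = fcoef f k + fcoef g k := by
  unfold fcoef
  rw [← mul_add, ← integral_add (integrable_exp_mul hf k) (integrable_exp_mul hg k)]
  simp only [mul_add]

lemma fcoef_smul (c : ℂ) (f : ℝ → ℂ) (k : ℤ) :
    fcoef (fun θ => c * f θ) k = c * fcoef f k := by
  unfold fcoef
  rw [mul_left_comm c, ← integral_const_mul c]
  congr 2
  funext θ
  ring

lemma ae_eq_zero_of_fcoef {f : ℝ → ℂ} (hf : MemLp f 2 muT) (h : ∀ k, fcoef f k = 0) :
    f =ᵐ[muT] 0 := by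
  have hab : (0 : ℝ) < 2 * Real.pi := by positivity
  have hmu : muT = volume.restrict (Ioc 0 (2 * Real.pi)) := restrict_Ioo_eq_restrict_Ioc
  rw [hmu] at hf ⊢
  have hs := hasSum_sq_fourierCoeffOn hab hf
  have h0 : ∀ k, fourierCoeffOn hab f k = 0 := by
    intro k
    rw [fourierCoeffOn_eq_integral, intervalIntegral.integral_of_le hab.le]
    have hk := h k
    unfold fcoef at hk
    rw [hmu] at hk
    have hne : (1 / (2 * (Real.pi : ℂ))) ≠ 0 := by
      have : (Real.pi : ℂ) ≠ 0 := by exact_mod_cast Real.pi_ne_zero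
      simp [this]
    have hk' := (mul_eq_zero.mp hk).resolve_left hne
    have hpi : (Real.pi : ℂ) ≠ 0 := by exact_mod_cast Real.pi_ne_zero
    have : (∫ x in Ioc 0 (2 * Real.pi), (fourier (-k)) (x : AddCircle (2 * Real.pi - 0)) • f x)
        = ∫ θ in Ioc 0 (2 * Real.pi), Complex.exp (-(Complex.I * k * θ)) * f θ := by
      congr 1
      funext x
      rw [fourier_coe_apply, smul_eq_mul]
      congr 2
      push_cast
      field_simp
      ring
    rw [this, hk', smul_zero]
  have h1 : ((2 * Real.pi - 0)⁻¹ • ∫ x in (0 : ℝ)..(2 * Real.pi), ‖f x‖ ^ 2) = 0 := by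
    refine hs.unique ?_
    simp [h0]
  have h2 : ∫ x in Ioc 0 (2 * Real.pi), ‖f x‖ ^ 2 = 0 := by
    rw [intervalIntegral.integral_of_le hab.le] at h1
    rcases smul_eq_zero.mp h1 with h1 | h1
    · exact absurd h1 (by rw [sub_zero]; positivity)
    · exact h1
  have hi : Integrable (fun x => ‖f x‖ ^ 2) (volume.restrict (Ioc 0 (2 * Real.pi))) :=
    (memLp_two_iff_integrable_sq_norm hf.1).mp hf
  rw [integral_eq_zero_iff_of_nonneg (fun x => by positivity) hi] at h2
  filter_upwards [h2] with x hx
  simpa using hx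

lemma Lp_integrable_muT (v : Lp ℂ 2 muT) : Integrable v muT :=
  (Lp.memLp v).integrable (by norm_num)

lemma Lp_integrable_muPi (v : Lp ℂ 2 muPi) : Integrable v muPi :=
  (Lp.memLp v).integrable (by norm_num)

/-! ### The space `X_σ^m(𝕋)` -/

/-- The square root `(1 + k²)^{m/2} e^{σ|k|}` of the weight in the norm of `X_σ^m(𝕋)`. -/
def xWeight (m : ℕ) (σ : ℝ) (k : ℤ) : ℝ :=
  Real.sqrt ((1 + (k : ℝ) ^ 2) ^ m) * Real.exp (σ * |(k : ℝ)|)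

lemma xWeight_pos (m : ℕ) (σ : ℝ) (k : ℤ) : 0 < xWeight m σ k := by
  unfold xWeight; positivity

/-- The functions `v` on the circle with `∑ₖ (1 + k²)^m e^{2σ|k|} |v̂ₖ|² < ∞`. -/
def XSub (m : ℕ) (σ : ℝ) : Submodule ℂ (Lp ℂ 2 muT) where
  carrier := {v | Memℓp (fun k : ℤ => (xWeight m σ k : ℂ) * fcoef v k) 2}
  zero_mem' := by
    have : (fun k : ℤ => (xWeight m σ k : ℂ) * fcoef (0 : Lp ℂ 2 muT) k) = 0 := by
      funext k
      rw [fcoef_congr (Lp.coeFn_zero ℂ 2 muT) k]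
      simp [fcoef]
    rw [Set.mem_ofPred_eq, this]
    exact zero_memℓp
  add_mem' := by
    intro a b ha hb
    have : (fun k : ℤ => (xWeight m σ k : ℂ) * fcoef (a + b : Lp ℂ 2 muT) k) =
        (fun k : ℤ => (xWeight m σ k : ℂ) * fcoef a k) +
          fun k : ℤ => (xWeight m σ k : ℂ) * fcoef b k := by
      funext k
      rw [fcoef_congr (Lp.coeFn_add a b) k, Pi.add_apply, ← mul_add,
        ← fcoef_add (Lp_integrable_muT a) (Lp_integrable_muT b)]
      rfl
    rw [Set.mem_ofPred_eq, this]
    exact ha.add hb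
  smul_mem' := by
    intro c a ha
    have : (fun k : ℤ => (xWeight m σ k : ℂ) * fcoef (c • a : Lp ℂ 2 muT) k) =
        c • fun k : ℤ => (xWeight m σ k : ℂ) * fcoef a k := by
      funext k
      rw [fcoef_congr (Lp.coeFn_smul c a) k, Pi.smul_apply, smul_eq_mul, mul_left_comm,
        ← fcoef_smul c]
      rfl
    rw [Set.mem_ofPred_eq, this]
    exact ha.const_smul c

/-- The space `X_σ^m(𝕋)`; for `σ = 0` it is `H^m(𝕋)`. -/
def XSpace (m : ℕ) (σ : ℝ) : Type := XSub m σ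

namespace XSpace

variable {m : ℕ} {σ : ℝ}

instance : AddCommGroup (XSpace m σ) := inferInstanceAs (AddCommGroup (XSub m σ))
instance : Module ℂ (XSpace m σ) := inferInstanceAs (Module ℂ (XSub m σ))

/-- The underlying `L²` class on the circle. -/
def toL2 : XSpace m σ →ₗ[ℂ] Lp ℂ 2 muT := (XSub m σ).subtype

/-- The underlying function on the circle. -/
def toFun (v : XSpace m σ) : ℝ → ℂ := (toL2 v : Lp ℂ 2 muT)

/-- The weighted Fourier coefficients. -/
def toSeq : XSpace m σ →ₗ[ℂ] lp (fun _ : ℤ => ℂ) 2 where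
  toFun v := ⟨fun k : ℤ => (xWeight m σ k : ℂ) * fcoef (toL2 v) k, Subtype.property v⟩
  map_add' a b := by
    ext k
    change (xWeight m σ k : ℂ) * fcoef (toL2 a + toL2 b : Lp ℂ 2 muT) k =
      (xWeight m σ k : ℂ) * fcoef (toL2 a) k + (xWeight m σ k : ℂ) * fcoef (toL2 b) k
    rw [fcoef_congr (Lp.coeFn_add _ _) k, ← mul_add,
      ← fcoef_add (Lp_integrable_muT _) (Lp_integrable_muT _)]
    rfl
  map_smul' c a := by
    ext k
    change (xWeight m σ k : ℂ) * fcoef (c • toL2 a : Lp ℂ 2 muT) k =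
      c * ((xWeight m σ k : ℂ) * fcoef (toL2 a) k)
    rw [fcoef_congr (Lp.coeFn_smul _ _) k, mul_left_comm, ← fcoef_smul c]
    rfl

lemma toSeq_injective : Function.Injective (toSeq : XSpace m σ →ₗ[ℂ] lp (fun _ : ℤ => ℂ) 2) := by
  rw [injective_iff_map_eq_zero]
  intro v hv
  have h : ∀ k, fcoef (toL2 v) k = 0 := by
    intro k
    have hk : (xWeight m σ k : ℂ) * fcoef (toL2 v) k = 0 := congrFun (congrArg Subtype.val hv) k
    refine (mul_eq_zero.mp hk).resolve_left ?_
    exact_mod_cast (xWeight_pos m σ k).ne'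
  have h0 : toL2 v = 0 := (Lp.eq_zero_iff_ae_eq_zero).mpr
    (ae_eq_zero_of_fcoef (Lp.memLp (toL2 v)) h)
  exact Subtype.ext h0

/-- The norm `‖v‖² = ∑ₖ (1 + k²)^m e^{2σ|k|} |v̂ₖ|²`. -/
instance : NormedAddCommGroup (XSpace m σ) :=
  NormedAddCommGroup.induced (XSpace m σ) (lp (fun _ : ℤ => ℂ) 2) toSeq toSeq_injective

instance : NormedSpace ℂ (XSpace m σ) :=
  NormedSpace.induced ℂ (XSpace m σ) (lp (fun _ : ℤ => ℂ) 2) toSeq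

lemma fcoef_one {k : ℤ} (hk : k ≠ 0) : fcoef (fun _ => 1) k = 0 := by
  have hab : (0 : ℝ) ≤ 2 * Real.pi := by positivity
  unfold fcoef muT
  rw [restrict_Ioo_eq_restrict_Ioc, ← intervalIntegral.integral_of_le hab]
  have hc : (-(Complex.I * k)) ≠ 0 := by simp [hk]
  have h := integral_exp_mul_complex (a := 0) (b := 2 * Real.pi) hc
  have e : (fun θ : ℝ => Complex.exp (-(Complex.I * k * θ)) * (1 : ℂ)) =
      fun θ : ℝ => Complex.exp (-(Complex.I * k) * θ) := by
    funext θ; rw [mul_one, neg_mul]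
  rw [e, h]
  have h1 : Complex.exp (-(Complex.I * k) * ((2 * Real.pi : ℝ) : ℂ)) = 1 := by
    rw [Complex.exp_eq_one_iff]
    exact ⟨-k, by push_cast; ring⟩
  rw [h1]
  simp

/-- The constant function `1`. -/
def one (m : ℕ) (σ : ℝ) : XSpace m σ :=
  ⟨MemLp.toLp (fun _ : ℝ => (1 : ℂ)) (memLp_const 1), by
    change Memℓp (fun k : ℤ => (xWeight m σ k : ℂ) * fcoef _ k) 2
    refine memℓp_gen (summable_of_ne_finset_zero (s := {0}) ?_)
    intro k hk
    have hk0 : k ≠ 0 := by simpa using hk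
    rw [fcoef_congr (MemLp.coeFn_toLp _) k, fcoef_one hk0]
    simp⟩

end XSpace

/-! ### Weak derivatives on `Π` -/

/-- The partial derivative in `ψ`. -/
def dPsi (φ : ℝ × ℝ → ℂ) (x : ℝ × ℝ) : ℂ := deriv (fun s => φ (s, x.2)) x.1

/-- The partial derivative in `θ`. -/
def dTheta (φ : ℝ × ℝ → ℂ) (x : ℝ × ℝ) : ℂ := deriv (fun t => φ (x.1, t)) x.2

/-- Test functions on `(0, 1) × 𝕋`: smooth, `2π`-periodic in `θ`, and compactly supported
in `0 < ψ < 1`. -/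
structure IsTest (φ : ℝ × ℝ → ℂ) : Prop where
  smooth : ContDiff ℝ ∞ φ
  periodic : ∀ s t, φ (s, t + 2 * Real.pi) = φ (s, t)
  support : ∃ δ > 0, ∀ s t, φ (s, t) ≠ 0 → s ∈ Icc δ (1 - δ)

/-- Local integrability on `(0, 1) × 𝕋`. -/
def LocInt (f : ℝ × ℝ → ℂ) : Prop :=
  ∀ δ > 0, IntegrableOn f (Icc δ (1 - δ) ×ˢ univ) muPi

/-- `g` is the weak derivative `∂_ψ^p ∂_θ^q u` on `(0, 1) × 𝕋`. -/
def IsWeakDeriv (p q : ℕ) (u g : ℝ × ℝ → ℂ) : Prop :=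
  LocInt u ∧ LocInt g ∧ ∀ φ, IsTest φ →
    ∫ x, u x * (dPsi^[p] (dTheta^[q] φ)) x ∂muPi = (-1) ^ (p + q) * ∫ x, g x * φ x ∂muPi

lemma dPsi_eq {φ : ℝ × ℝ → ℂ} (h : ContDiff ℝ ∞ φ) :
    dPsi φ = fun x => fderiv ℝ φ x (1, 0) := by
  funext x
  have h1 : HasFDerivAt φ (fderiv ℝ φ x) (x.1, x.2) :=
    (h.differentiable (by simp)).differentiableAt.hasFDerivAt
  have h2 : HasDerivAt (fun s : ℝ => (s, x.2)) ((1 : ℝ), (0 : ℝ)) x.1 :=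
    (hasDerivAt_id x.1).prodMk (hasDerivAt_const x.1 x.2)
  exact (h1.comp_hasDerivAt x.1 h2).deriv

lemma dTheta_eq {φ : ℝ × ℝ → ℂ} (h : ContDiff ℝ ∞ φ) :
    dTheta φ = fun x => fderiv ℝ φ x (0, 1) := by
  funext x
  have h1 : HasFDerivAt φ (fderiv ℝ φ x) (x.1, x.2) :=
    (h.differentiable (by simp)).differentiableAt.hasFDerivAt
  have h2 : HasDerivAt (fun t : ℝ => (x.1, t)) ((0 : ℝ), (1 : ℝ)) x.2 :=
    (hasDerivAt_const x.2 x.1).prodMk (hasDerivAt_id x.2)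
  exact (h1.comp_hasDerivAt x.2 h2).deriv

lemma IsTest.dPsi {φ : ℝ × ℝ → ℂ} (h : IsTest φ) : IsTest (dPsi φ) := by
  refine ⟨?_, ?_, ?_⟩
  · rw [dPsi_eq h.smooth]
    exact (h.smooth.fderiv_right (m := ∞) (by simp)).clm_apply contDiff_const
  · intro s t
    simp only [_root_.dPsi, h.periodic]
  · obtain ⟨δ, hδ, hs⟩ := h.support
    refine ⟨δ, hδ, fun s t hst => ?_⟩
    by_contra hn
    refine hst ?_
    have : (fun s' => φ (s', t)) =ᶠ[nhds s] fun _ => 0 := by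
      filter_upwards [isClosed_Icc.isOpen_compl.mem_nhds hn] with s' hs'
      by_contra h0
      exact hs' (hs _ _ h0)
    change deriv (fun s' => φ (s', t)) s = 0
    rw [this.deriv_eq, deriv_const]

lemma IsTest.dTheta {φ : ℝ × ℝ → ℂ} (h : IsTest φ) : IsTest (dTheta φ) := by
  refine ⟨?_, ?_, ?_⟩
  · rw [dTheta_eq h.smooth]
    exact (h.smooth.fderiv_right (m := ∞) (by simp)).clm_apply contDiff_const
  · intro s t
    change deriv (fun t' => φ (s, t')) (t + 2 * Real.pi) = deriv (fun t' => φ (s, t')) t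
    rw [← deriv_comp_add_const]
    simp only [h.periodic]
  · obtain ⟨δ, hδ, hs⟩ := h.support
    refine ⟨δ, hδ, fun s t hst => ?_⟩
    by_contra hn
    refine hst ?_
    have : (fun t' => φ (s, t')) = fun _ => 0 := by
      funext t'
      by_contra h0
      exact hn (hs _ _ h0)
    change deriv (fun t' => φ (s, t')) t = 0
    rw [this, deriv_const]

lemma IsTest.iterate {φ : ℝ × ℝ → ℂ} (h : IsTest φ) (p q : ℕ) :
    IsTest (_root_.dPsi^[p] (_root_.dTheta^[q] φ)) := by
  have hq : IsTest (_root_.dTheta^[q] φ) := by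
    induction q with
    | zero => exact h
    | succ n ih => rw [Function.iterate_succ_apply']; exact ih.dTheta
  induction p with
  | zero => exact hq
  | succ n ih => rw [Function.iterate_succ_apply']; exact ih.dPsi

lemma ae_mem_muPi : ∀ᵐ x ∂muPi, x ∈ Ioo (0 : ℝ) 1 ×ˢ Ioo (0 : ℝ) (2 * Real.pi) := by
  unfold muPi muI muT
  rw [Measure.prod_restrict]
  exact ae_restrict_mem (measurableSet_Ioo.prod measurableSet_Ioo)

lemma LocInt.integrable_mul {f φ : ℝ × ℝ → ℂ} (hf : LocInt f) (h : IsTest φ) :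
    Integrable (fun x => f x * φ x) muPi := by
  obtain ⟨δ, hδ, hs⟩ := h.support
  have hc : Continuous φ := h.smooth.continuous
  obtain ⟨C, hC⟩ := (isCompact_Icc.prod isCompact_Icc :
    IsCompact (Icc (0 : ℝ) 1 ×ˢ Icc (0 : ℝ) (2 * Real.pi))).exists_bound_of_continuousOn
      hc.continuousOn
  have h1 : IntegrableOn (fun x => f x * φ x) (Icc δ (1 - δ) ×ˢ univ) muPi := by
    refine (hf δ hδ).mul_bdd (c := C) hc.aestronglyMeasurable ?_
    refine ae_restrict_of_ae ?_
    filter_upwards [ae_mem_muPi] with x hx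
    exact hC x ⟨Ioo_subset_Icc_self hx.1, Ioo_subset_Icc_self hx.2⟩
  refine (integrableOn_iff_integrable_of_support_subset ?_).mp h1
  intro x hx
  have : φ x ≠ 0 := fun h0 => hx (by simp [h0])
  exact ⟨hs x.1 x.2 this, mem_univ _⟩

lemma LocInt.add {f g : ℝ × ℝ → ℂ} (hf : LocInt f) (hg : LocInt g) :
    LocInt (fun x => f x + g x) := fun δ hδ => (hf δ hδ).add (hg δ hδ)

lemma LocInt.const_mul {f : ℝ × ℝ → ℂ} (hf : LocInt f) (c : ℂ) :
    LocInt (fun x => c * f x) := fun δ hδ => (hf δ hδ).const_mul c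

lemma LocInt.congr {f g : ℝ × ℝ → ℂ} (hf : LocInt f) (h : f =ᵐ[muPi] g) : LocInt g :=
  fun δ hδ => (hf δ hδ).congr (ae_restrict_of_ae h)

lemma IsWeakDeriv.congr {p q : ℕ} {u g u' g' : ℝ × ℝ → ℂ} (h : IsWeakDeriv p q u g)
    (hu : u =ᵐ[muPi] u') (hg : g =ᵐ[muPi] g') : IsWeakDeriv p q u' g' := by
  refine ⟨h.1.congr hu, h.2.1.congr hg, fun φ hφ => ?_⟩
  have e1 : ∫ x, u' x * (dPsi^[p] (dTheta^[q] φ)) x ∂muPi =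
      ∫ x, u x * (dPsi^[p] (dTheta^[q] φ)) x ∂muPi := by
    refine integral_congr_ae ?_
    filter_upwards [hu] with x hx
    rw [hx]
  have e2 : ∫ x, g' x * φ x ∂muPi = ∫ x, g x * φ x ∂muPi := by
    refine integral_congr_ae ?_
    filter_upwards [hg] with x hx
    rw [hx]
  rw [e1, e2, h.2.2 φ hφ]

lemma IsWeakDeriv.zero (p q : ℕ) : IsWeakDeriv p q (fun _ => 0) (fun _ => 0) := by
  refine ⟨fun _ _ => integrableOn_zero, fun _ _ => integrableOn_zero, fun φ _ => by simp⟩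

lemma IsWeakDeriv.add {p q : ℕ} {u g u' g' : ℝ × ℝ → ℂ} (h : IsWeakDeriv p q u g)
    (h' : IsWeakDeriv p q u' g') :
    IsWeakDeriv p q (fun x => u x + u' x) (fun x => g x + g' x) := by
  refine ⟨h.1.add h'.1, h.2.1.add h'.2.1, fun φ hφ => ?_⟩
  simp only [add_mul]
  rw [integral_add (h.1.integrable_mul (hφ.iterate p q)) (h'.1.integrable_mul (hφ.iterate p q)),
    integral_add (h.2.1.integrable_mul hφ) (h'.2.1.integrable_mul hφ), h.2.2 φ hφ, h'.2.2 φ hφ,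
    mul_add]

lemma IsWeakDeriv.const_mul {p q : ℕ} {u g : ℝ × ℝ → ℂ} (h : IsWeakDeriv p q u g) (c : ℂ) :
    IsWeakDeriv p q (fun x => c * u x) (fun x => c * g x) := by
  refine ⟨h.1.const_mul c, h.2.1.const_mul c, fun φ hφ => ?_⟩
  simp only [mul_assoc]
  rw [integral_const_mul, integral_const_mul, h.2.2 φ hφ]
  ring

/-! ### The Kondratev space `K_γ^m(Π)` -/

/-- The multi-indices `(p, q)` with `p + q ≤ m`. -/
abbrev DIdx (m : ℕ) : Type :=
  ↥((Finset.range (m + 1) ×ˢ Finset.range (m + 1)).filter fun i => i.1 + i.2 ≤ m)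

/-- The multi-index `(0, 0)`. -/
def DIdx.zero (m : ℕ) : DIdx m := ⟨(0, 0), by simp⟩

/-- The function `ψ^c U(ψ, θ)`. -/
def wmul (c : ℝ) (U : ℝ × ℝ → ℂ) (x : ℝ × ℝ) : ℂ := ((x.1 ^ c : ℝ) : ℂ) * U x

/-- `K_γ^m(Π)`. An element is a function `u` recorded with its weighted weak derivatives
`U_{p,q} = ψ^{p - γ} ∂_ψ^p ∂_θ^q u ∈ L²(Π)`, `p + q ≤ m` (so `u = ψ^γ U_{0,0}`); the norm is
`‖u‖² = ∑_{p + q ≤ m} ‖ψ^{p - γ} ∂_ψ^p ∂_θ^q u‖²_{L²(Π)}`. -/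
def KSpace (m : ℕ) (γ : ℝ) : Submodule ℂ (PiLp 2 fun _ : DIdx m => Lp ℂ 2 muPi) where
  carrier := {U | ∀ i : DIdx m, IsWeakDeriv i.1.1 i.1.2
    (wmul γ (U (DIdx.zero m))) (wmul (γ - i.1.1) (U i))}
  zero_mem' := by
    intro i
    refine (IsWeakDeriv.zero i.1.1 i.1.2).congr ?_ ?_ <;>
    · filter_upwards [Lp.coeFn_zero ℂ 2 muPi] with x hx
      simp only [wmul, PiLp.zero_apply, hx]
      simp
  add_mem' := by
    intro U V hU hV i
    refine ((hU i).add (hV i)).congr ?_ ?_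
    · filter_upwards [Lp.coeFn_add (U (DIdx.zero m)) (V (DIdx.zero m))] with x hx
      simp only [wmul, PiLp.add_apply, hx, Pi.add_apply, mul_add]
    · filter_upwards [Lp.coeFn_add (U i) (V i)] with x hx
      simp only [wmul, PiLp.add_apply, hx, Pi.add_apply, mul_add]
  smul_mem' := by
    intro c U hU i
    refine ((hU i).const_mul c).congr ?_ ?_
    · filter_upwards [Lp.coeFn_smul c (U (DIdx.zero m))] with x hx
      simp only [wmul, PiLp.smul_apply, hx, Pi.smul_apply, smul_eq_mul, mul_left_comm]
    · filter_upwards [Lp.coeFn_smul c (U i)] with x hx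
      simp only [wmul, PiLp.smul_apply, hx, Pi.smul_apply, smul_eq_mul, mul_left_comm]

/-- The function `u` underlying an element of `K_γ^m(Π)`. -/
def kFun {m : ℕ} {γ : ℝ} (u : KSpace m γ) : ℝ × ℝ → ℂ :=
  wmul γ (u.1 (DIdx.zero m))

lemma wmul_slice (c : ℝ) (U : ℝ × ℝ → ℂ) (k : ℤ) (s : ℝ) :
    fcoef (fun t => wmul c U (s, t)) k = ((s ^ c : ℝ) : ℂ) * fcoef (fun t => U (s, t)) k := by
  rw [← fcoef_smul ((s ^ c : ℝ) : ℂ) (fun t => U (s, t)) k]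
  rfl

lemma ae_ae_slice {f g : ℝ × ℝ → ℂ} (h : f =ᵐ[muPi] g) :
    ∀ᵐ s ∂muI, (fun t => f (s, t)) =ᵐ[muT] fun t => g (s, t) :=
  Measure.ae_ae_of_ae_prod h

lemma KSpace.fcoef_add {m : ℕ} {γ : ℝ} (u w : KSpace m γ) (k : ℤ) : ∀ᵐ s ∂muI,
    fcoef (fun t => kFun (u + w) (s, t)) k =
      fcoef (fun t => kFun u (s, t)) k + fcoef (fun t => kFun w (s, t)) k := by
  have h := ae_ae_slice (Lp.coeFn_add (u.1 (DIdx.zero m)) (w.1 (DIdx.zero m)))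
  filter_upwards [h, (Lp_integrable_muPi (u.1 (DIdx.zero m))).prod_right_ae,
    (Lp_integrable_muPi (w.1 (DIdx.zero m))).prod_right_ae] with s hs hu hw
  unfold kFun
  rw [wmul_slice, wmul_slice, wmul_slice, ← mul_add, ← _root_.fcoef_add hu hw]
  congr 1
  exact fcoef_congr hs k

lemma KSpace.fcoef_smul {m : ℕ} {γ : ℝ} (c : ℂ) (u : KSpace m γ) (k : ℤ) : ∀ᵐ s ∂muI,
    fcoef (fun t => kFun (c • u) (s, t)) k = c * fcoef (fun t => kFun u (s, t)) k := by
  have h := ae_ae_slice (Lp.coeFn_smul c (u.1 (DIdx.zero m)))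
  filter_upwards [h] with s hs
  unfold kFun
  rw [wmul_slice, wmul_slice, mul_left_comm, ← _root_.fcoef_smul c]
  congr 1
  exact fcoef_congr hs k

lemma KSpace.fcoef_zero {m : ℕ} {γ : ℝ} (k : ℤ) : ∀ᵐ s ∂muI,
    fcoef (fun t => kFun (0 : KSpace m γ) (s, t)) k = 0 := by
  filter_upwards [KSpace.fcoef_smul 0 (0 : KSpace m γ) k] with s hs
  rw [zero_smul, zero_mul] at hs
  exact hs

/-- A function on `Π` whose angular Fourier coefficients vanish is zero. -/
lemma ae_eq_zero_of_slices {U : ℝ × ℝ → ℂ} (hU : MemLp U 2 muPi)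
    (h : ∀ k : ℤ, ∀ᵐ s ∂muI, fcoef (fun t => U (s, t)) k = 0) : U =ᵐ[muPi] 0 := by
  have h1 : ∀ᵐ s ∂muI, ∀ k : ℤ, fcoef (fun t => U (s, t)) k = 0 := ae_all_iff.mpr h
  have h2 : ∀ᵐ s ∂muI, MemLp (fun t => U (s, t)) 2 muT := by
    have hi := (memLp_two_iff_integrable_sq_norm hU.1).mp hU
    have hm : ∀ᵐ s ∂muI, AEStronglyMeasurable (fun t => U (s, t)) muT := hU.1.prodMk_left
    filter_upwards [hi.prod_right_ae, hm] with s hs hms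
    exact (memLp_two_iff_integrable_sq_norm hms).mpr hs
  have h3 : ∀ᵐ s ∂muI, ∀ᵐ t ∂muT, U (s, t) = 0 := by
    filter_upwards [h1, h2] with s hs hs2
    exact ae_eq_zero_of_fcoef hs2 hs
  have hV : hU.1.mk U =ᵐ[muPi] 0 := by
    have hmeas : MeasurableSet {x | hU.1.mk U x = 0} :=
      hU.1.stronglyMeasurable_mk.measurable (measurableSet_singleton 0)
    refine (Measure.ae_prod_mem_iff_ae_ae_mem hmeas).mpr ?_
    filter_upwards [h3, ae_ae_slice hU.1.ae_eq_mk] with s hs hs'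
    filter_upwards [hs, hs'] with t ht ht'
    rw [← ht', ht]
  exact hU.1.ae_eq_mk.trans hV

lemma isTest_prod {g : ℝ → ℝ} (hg : ContDiff ℝ ∞ g) (hc : HasCompactSupport g)
    (hs : tsupport g ⊆ Ioo 0 1) (k : ℤ) :
    IsTest fun x => (g x.1 : ℂ) * Complex.exp (-(Complex.I * k * x.2)) := by
  refine ⟨?_, ?_, ?_⟩
  · have h1 : ContDiff ℝ ∞ fun x : ℝ × ℝ => (g x.1 : ℂ) :=
      Complex.ofRealCLM.contDiff.comp (hg.comp contDiff_fst)
    have h2 : ContDiff ℝ ∞ fun x : ℝ × ℝ => (x.2 : ℂ) :=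
      Complex.ofRealCLM.contDiff.comp contDiff_snd
    exact h1.mul ((contDiff_const.mul h2).neg.cexp)
  · intro s t
    dsimp only
    congr 1
    rw [Complex.exp_eq_exp_iff_exists_int]
    exact ⟨-k, by push_cast; ring⟩
  · rcases (tsupport g).eq_empty_or_nonempty with he | hne
    · refine ⟨1, one_pos, fun s t hst => ?_⟩
      have : s ∈ tsupport g := subset_tsupport g (fun h0 => hst (by simp [h0]))
      rw [he] at this
      exact this.elim
    · have hK : IsCompact (tsupport g) := hc
      obtain ⟨a, ha, hal⟩ := hK.exists_isLeast hne
      obtain ⟨b, hb, hbg⟩ := hK.exists_isGreatest hne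
      refine ⟨min a (1 - b), lt_min (hs ha).1 (by linarith [(hs hb).2]), fun s t hst => ?_⟩
      have hm : s ∈ tsupport g := subset_tsupport g (fun h0 => hst (by simp [h0]))
      exact ⟨(min_le_left _ _).trans (hal hm),
        by linarith [min_le_right a (1 - b), hbg hm]⟩

/-- Weak derivatives of zero vanish. -/
lemma ae_eq_zero_of_weakDeriv {p q : ℕ} {c : ℝ} {u U : ℝ × ℝ → ℂ} (hU : MemLp U 2 muPi)
    (hu : u =ᵐ[muPi] 0) (h : IsWeakDeriv p q u (wmul c U)) : U =ᵐ[muPi] 0 := by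
  refine ae_eq_zero_of_slices hU fun k => ?_
  have hint : ∀ φ, IsTest φ → ∫ x, wmul c U x * φ x ∂muPi = 0 := by
    intro φ hφ
    have h1 := h.2.2 φ hφ
    have h0 : ∫ x, u x * (dPsi^[p] (dTheta^[q] φ)) x ∂muPi = 0 := by
      rw [integral_eq_zero_of_ae]
      filter_upwards [hu] with x hx
      simp [hx]
    rw [h0] at h1
    exact (mul_eq_zero.mp h1.symm).resolve_left (by simp)
  set F : ℝ → ℂ := fun s => ∫ t, Complex.exp (-(Complex.I * k * t)) * U (s, t) ∂muT with hF
  have hprod : Integrable (fun x : ℝ × ℝ => Complex.exp (-(Complex.I * k * x.2)) * U x) muPi := by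
    refine (hU.integrable (by norm_num)).bdd_mul (c := 1) ?_ ?_
    · exact (by fun_prop : Continuous fun x : ℝ × ℝ =>
        Complex.exp (-(Complex.I * k * x.2))).aestronglyMeasurable
    · exact Filter.Eventually.of_forall fun x => (norm_exp_neg_I_mul k x.2).le
  have hFi : Integrable F muI := hprod.integral_prod_left
  have hloc : LocallyIntegrableOn (fun s => ((s ^ c : ℝ) : ℂ) * F s) (Ioo 0 1) volume := by
    have hFl : LocallyIntegrableOn F (Ioo 0 1) volume :=
      IntegrableOn.locallyIntegrableOn hFi
    refine hFl.continuousOn_mul ?_ isOpen_Ioo.isLocallyClosed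
    refine Complex.continuous_ofReal.comp_continuousOn ?_
    exact fun s hs => (Real.continuousAt_rpow_const s c (Or.inl hs.1.ne')).continuousWithinAt
  have key := isOpen_Ioo.ae_eq_zero_of_integral_contDiff_smul_eq_zero hloc ?_
  · have : ∀ᵐ s ∂muI, s ∈ Ioo (0 : ℝ) 1 := ae_restrict_mem measurableSet_Ioo
    filter_upwards [ae_restrict_of_ae key, this] with s hs hm
    have h1 := (mul_eq_zero.mp (hs hm)).resolve_left
      (by exact_mod_cast (Real.rpow_pos_of_pos hm.1 c).ne')
    unfold fcoef
    rw [show (∫ θ, Complex.exp (-(Complex.I * k * θ)) * U (s, θ) ∂muT) = 0 from h1, mul_zero]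
  · intro g hg hgc hgs
    have hT := isTest_prod hg hgc hgs k
    have h1 := hint _ hT
    have h2 := h.2.1.integrable_mul hT
    unfold muPi at h1 h2
    rw [integral_prod _ h2] at h1
    have h3 : ∫ s, g s • (((s ^ c : ℝ) : ℂ) * F s) ∂muI = 0 := by
      rw [← h1]
      congr 1
      funext s
      rw [hF, Complex.real_smul, ← integral_const_mul, ← integral_const_mul]
      congr 1
      funext t
      simp only [wmul]
      ring
    unfold muI at h3
    rw [setIntegral_eq_integral_of_forall_compl_eq_zero] at h3
    · exact h3
    · intro s hs
      have : g s = 0 := by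
        by_contra h0
        exact hs (hgs (subset_tsupport g h0))
      rw [this, zero_smul]

/-! ### The space `K_γ^{m,σ}(Π)` -/

/-- The pairs `(u, w)` in `K_γ^m(Π)` with `w = 𝓕⁻¹ {û_k(ψ) e^{σ|k|}}`. -/
def KSigSub (m : ℕ) (γ σ : ℝ) : Submodule ℂ (KSpace m γ × KSpace m γ) where
  carrier := {P | ∀ k : ℤ, ∀ᵐ s ∂muI, fcoef (fun t => kFun P.2 (s, t)) k =
    (Real.exp (σ * |(k : ℝ)|) : ℂ) * fcoef (fun t => kFun P.1 (s, t)) k}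
  zero_mem' := by
    intro k
    filter_upwards [KSpace.fcoef_zero (m := m) (γ := γ) k] with s hs
    rw [Prod.fst_zero, Prod.snd_zero, hs, mul_zero]
  add_mem' := by
    intro P Q hP hQ k
    filter_upwards [hP k, hQ k, KSpace.fcoef_add P.1 Q.1 k, KSpace.fcoef_add P.2 Q.2 k]
      with s h1 h2 h3 h4
    rw [Prod.fst_add, Prod.snd_add, h3, h4, h1, h2, mul_add]
  smul_mem' := by
    intro c P hP k
    filter_upwards [hP k, KSpace.fcoef_smul c P.1 k, KSpace.fcoef_smul c P.2 k] with s h1 h2 h3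
    rw [Prod.smul_fst, Prod.smul_snd, h2, h3, h1, mul_left_comm]

/-- `K_γ^{m,σ}(Π)`: the `u ∈ K_γ^m(Π)` with `𝓕⁻¹ {û_k(ψ) e^{σ|k|}} ∈ K_γ^m(Π)`. -/
def KSig (m : ℕ) (γ σ : ℝ) : Type := KSigSub m γ σ

namespace KSig

variable {m : ℕ} {γ σ : ℝ}

instance : AddCommGroup (KSig m γ σ) := inferInstanceAs (AddCommGroup (KSigSub m γ σ))
instance : Module ℂ (KSig m γ σ) := inferInstanceAs (Module ℂ (KSigSub m γ σ))

/-- The element `u` of `K_γ^m(Π)`. -/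
def base : KSig m γ σ →ₗ[ℂ] KSpace m γ :=
  LinearMap.fst ℂ (KSpace m γ) (KSpace m γ) ∘ₗ (KSigSub m γ σ).subtype

/-- The element `𝓕⁻¹ {û_k(ψ) e^{σ|k|}}` of `K_γ^m(Π)`. -/
def lift : KSig m γ σ →ₗ[ℂ] KSpace m γ :=
  LinearMap.snd ℂ (KSpace m γ) (KSpace m γ) ∘ₗ (KSigSub m γ σ).subtype

lemma lift_injective : Function.Injective (lift : KSig m γ σ →ₗ[ℂ] KSpace m γ) := by
  rw [injective_iff_map_eq_zero]
  intro P hP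
  have hrel : ∀ k : ℤ, ∀ᵐ s ∂muI, fcoef (fun t => kFun (lift P) (s, t)) k =
      (Real.exp (σ * |(k : ℝ)|) : ℂ) * fcoef (fun t => kFun (base P) (s, t)) k :=
    Subtype.property P
  have h0 : (base P).1 (DIdx.zero m) =ᵐ[muPi] (0 : ℝ × ℝ → ℂ) := by
    refine ae_eq_zero_of_slices (Lp.memLp _) fun k => ?_
    have hm : ∀ᵐ s ∂muI, s ∈ Ioo (0 : ℝ) 1 := ae_restrict_mem measurableSet_Ioo
    filter_upwards [hrel k, KSpace.fcoef_zero (m := m) (γ := γ) k, hm] with s h1 h2 hs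
    rw [hP, h2] at h1
    have h3 := (mul_eq_zero.mp h1.symm).resolve_left
      (by exact_mod_cast (Real.exp_pos _).ne')
    unfold kFun at h3
    rw [wmul_slice] at h3
    exact (mul_eq_zero.mp h3).resolve_left
      (by exact_mod_cast (Real.rpow_pos_of_pos hs.1 γ).ne')
  have hu : kFun (base P) =ᵐ[muPi] 0 := by
    filter_upwards [h0] with x hx
    simp only [kFun, wmul, hx]
    simp
  have hbase : base P = 0 := by
    refine Subtype.ext (PiLp.ext fun i => ?_)
    exact (Lp.eq_zero_iff_ae_eq_zero).mpr
      (ae_eq_zero_of_weakDeriv (Lp.memLp _) hu ((base P).2 i))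
  exact Subtype.ext (Prod.ext hbase hP)

/-- The norm `‖u‖ = ‖𝓕⁻¹ {û_k(ψ) e^{σ|k|}}‖_{K_γ^m(Π)}`. -/
instance : NormedAddCommGroup (KSig m γ σ) :=
  NormedAddCommGroup.induced (KSig m γ σ) (KSpace m γ) lift lift_injective

instance : NormedSpace ℂ (KSig m γ σ) :=
  NormedSpace.induced ℂ (KSig m γ σ) (KSpace m γ) lift

end KSig

/-! ### The spaces `J_{lam,γ}^{m,σ}(Π)` -/

/-- `J_{lam,γ}^{m,σ}(Π)`, the functions `a = v(θ) ψ^lam + w(ψ, θ)` with `v ∈ X_σ^m(𝕋)` and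
`w ∈ K_{lam+γ}^{m,σ}(Π)`, with a direct sum norm. -/
def JSpace (lam γ : ℝ) (m : ℕ) (σ : ℝ) : Type := XSpace m σ × KSig m (lam + γ) σ

namespace JSpace

variable {lam γ : ℝ} {m : ℕ} {σ : ℝ}

instance : NormedAddCommGroup (JSpace lam γ m σ) :=
  inferInstanceAs (NormedAddCommGroup (XSpace m σ × KSig m (lam + γ) σ))

instance : NormedSpace ℂ (JSpace lam γ m σ) :=
  inferInstanceAs (NormedSpace ℂ (XSpace m σ × KSig m (lam + γ) σ))

/-- The leading coefficient `v`. -/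
def lead : JSpace lam γ m σ →ₗ[ℂ] XSpace m σ :=
  LinearMap.fst ℂ (XSpace m σ) (KSig m (lam + γ) σ)

/-- The remainder `w`. -/
def rem : JSpace lam γ m σ →ₗ[ℂ] KSig m (lam + γ) σ :=
  LinearMap.snd ℂ (XSpace m σ) (KSig m (lam + γ) σ)

/-- The function `a(ψ, θ) = v(θ) ψ^lam + w(ψ, θ)`. -/
def toFun (a : JSpace lam γ m σ) (x : ℝ × ℝ) : ℂ :=
  (lead a).toFun x.2 * ((x.1 ^ lam : ℝ) : ℂ) + kFun (KSig.base (rem a)) x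

end JSpace

/-- The function `ψ^lam` as an element of `J_{lam,γ}^{m,σ}(Π)`. -/
def psiPow (lam γ : ℝ) (m : ℕ) (σ : ℝ) : JSpace lam γ m σ := (XSpace.one m σ, (0 : KSig m (lam + γ) σ))

lemma integrable_cexp_mul_Lp (c : ℂ) (v : Lp ℂ 2 muT) :
    Integrable (fun θ : ℝ => v θ * Complex.exp (c * Complex.I * θ)) muT := by
  have hc : Continuous fun θ : ℝ => Complex.exp (c * Complex.I * θ) := by fun_prop
  obtain ⟨C, hC⟩ := (isCompact_Icc :
    IsCompact (Icc (0 : ℝ) (2 * Real.pi))).exists_bound_of_continuousOn hc.continuousOn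
  refine (Lp_integrable_muT v).mul_bdd (c := C) hc.aestronglyMeasurable ?_
  filter_upwards [ae_restrict_mem measurableSet_Ioo] with θ hθ
  exact hC θ (Ioo_subset_Icc_self hθ)

/-- The subspace `J̃_{0,γ}^{m,σ}(Π)` of the `u = v(θ) + w(ψ, θ)` in `J_{0,γ}^{m,σ}(Π)` with
`∫_𝕋 v(θ) e^{± 2iθ} dθ = 0`. -/
def JTilde (γ : ℝ) (m : ℕ) (σ : ℝ) : Submodule ℂ (JSpace 0 γ m σ) where
  carrier := {u | ∀ ε : ℂ, ε = 1 ∨ ε = -1 →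
    ∫ θ, (JSpace.lead u).toFun θ * Complex.exp (ε * 2 * Complex.I * θ) ∂muT = 0}
  zero_mem' := by
    intro ε _
    rw [integral_eq_zero_of_ae]
    rw [map_zero]
    filter_upwards [Lp.coeFn_zero ℂ 2 muT] with θ hθ
    rw [XSpace.toFun, map_zero, hθ]
    simp
  add_mem' := by
    intro a b ha hb ε hε
    have h1 := integral_add (integrable_cexp_mul_Lp (ε * 2) (XSpace.toL2 (JSpace.lead a)))
      (integrable_cexp_mul_Lp (ε * 2) (XSpace.toL2 (JSpace.lead b)))
    have h2 := ha ε hε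
    have h3 := hb ε hε
    unfold XSpace.toFun at h2 h3
    rw [h2, h3, add_zero] at h1
    rw [← h1]
    refine integral_congr_ae ?_
    filter_upwards [Lp.coeFn_add (XSpace.toL2 (JSpace.lead a)) (XSpace.toL2 (JSpace.lead b))]
      with θ hθ
    rw [XSpace.toFun, map_add, map_add, hθ, Pi.add_apply, add_mul]
  smul_mem' := by
    intro c a ha ε hε
    have h2 := ha ε hε
    unfold XSpace.toFun at h2
    rw [← mul_zero c, ← h2, ← integral_const_mul]
    refine integral_congr_ae ?_
    filter_upwards [Lp.coeFn_smul c (XSpace.toL2 (JSpace.lead a))] with θ hθ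
    rw [XSpace.toFun, map_smul, map_smul, hθ, Pi.smul_apply, smul_eq_mul, mul_assoc]

/-! ### The vorticity operator -/

/-- The expression `Ξ` in terms of the values of `a, a_ψ, a_θ, a_ψψ, a_ψθ, a_θθ`. -/
def xiExpr (a aψ aθ aψψ aψθ aθθ : ℂ) : ℂ :=
  -(1 / aψ ^ 3) * (1 + aθ ^ 2 / a ^ 2) * aψψ + 2 * (aθ / (a ^ 2 * aψ ^ 2)) * aψθ
    - 1 / (a ^ 2 * aψ) * aθθ + 1 / (a * aψ)

/-- `f = Ξ(a)` on `Π`: the function `a` has weak derivatives up to order two, `a` and `a_ψ` do not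
vanish, and `f` is given by the expression `Ξ` almost everywhere. -/
def IsVorticity (a f : ℝ × ℝ → ℂ) : Prop :=
  ∃ aψ aθ aψψ aψθ aθθ : ℝ × ℝ → ℂ,
    IsWeakDeriv 1 0 a aψ ∧ IsWeakDeriv 0 1 a aθ ∧ IsWeakDeriv 2 0 a aψψ ∧
    IsWeakDeriv 1 1 a aψθ ∧ IsWeakDeriv 0 2 a aθθ ∧
    ∀ᵐ x ∂muPi, a x ≠ 0 ∧ aψ x ≠ 0 ∧
      f x = xiExpr (a x) (aψ x) (aθ x) (aψψ x) (aψθ x) (aθθ x)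

end

noncomputable section

/-! ### Fourier series on the circle -/

/-! The operator `Ξ` is homogeneous: if `a, a_θ, a_θθ` scale like `r`, `a_ψ, a_ψθ` like `r⁻¹` and
`a_ψψ` like `r⁻³`, every term has degree zero (`xiExpr_scale`). With `r = ψ^{1/2}` all singular
powers cancel, so `Ξ(a)` is a rational expression in the rescaled derivatives. These depend on `a`
through bounded linear maps into `J_{0,γ}^{m-2,σ}` (`JSpace.exists_deriv`). That space is a unital
Banach algebra up to a constant (`JSpace.exists_mul`), and at `ψ^{1/2}` the two denominators are the
nonzero constants `1` and `1/2`. Inversion is analytic on units, which gives an open neighbourhood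
and the analyticity of `Ξ`.

The modes `±2` of the leading term vanish for an algebraic reason. If `v` is the leading coefficient
of `a`, then that of `Ξ(a)` is `g'' + 4 g` with `g = v⁻²` (`xiExpr_lead`), and `d²/dθ² + 4`
annihilates `e^{±2iθ}`. The subspace with vanishing modes is the kernel of two bounded functionals,
so a bounded projection makes it the codomain (`JTilde_closedComplemented`).

The analytic substance is the algebra property. Expanding in `θ`, weak differentiability on `Π`
decouples: an angular derivative multiplies the `k`-th mode by `ik`, and radial derivatives of that
mode form a chain of relations `s f' = (p - γ) f + f_next` in `L²(0,1)`, the relation `EulerRel`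
(`mem_KSpace_iff`). This relation is closed, determines the next member of the chain, and obeys a
product rule with the weight `s^γ` (`EulerRel.mul`). A one-dimensional Sobolev bound `√s |f(s)| ≤ C`
(`EulerRel.ae_bound`) and `s^γ ≤ √s` for `γ ≥ 1/2` make the products square integrable.

Products of functions are convolutions of angular coefficients. One spare power of `1 + |k|` on
either factor turns an `ℓ²` sequence into an `ℓ¹` sequence, and Young's inequality closes the
estimate (`tsum_conv_hwt_sq_le`, `conv_bound`). The distribution of derivatives and weights in
`leibniz_bound` requires order at least two, which is `m - 2 ≥ 2`. The weight `e^{σ|k|}` is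
submultiplicative and causes no loss. -/

lemma fcoef_one_zero : fcoef (fun _ => 1) 0 = 1 := by
  have hpi : (Real.pi : ℂ) ≠ 0 := by exact_mod_cast Real.pi_ne_zero
  have h2 : (0 : ℝ) ≤ 2 * Real.pi := by positivity
  unfold fcoef muT
  simp only [Int.cast_zero, mul_zero, zero_mul, neg_zero, Complex.exp_zero, mul_one,
    integral_const, Measure.restrict_apply_univ, measureReal_def]
  simp only [Real.volume_Ioo, sub_zero, ENNReal.toReal_ofReal h2, Complex.real_smul, mul_one]
  push_cast
  field_simp

lemma fcoef_exp_mul (f : ℝ → ℂ) (j k : ℤ) :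
    fcoef (fun θ : ℝ => Complex.exp (Complex.I * j * θ) * f θ) k = fcoef f (k - j) := by
  unfold fcoef
  congr 2
  funext θ
  rw [← mul_assoc, ← Complex.exp_add]
  congr 2
  push_cast
  ring

lemma fcoef_exp (j k : ℤ) :
    fcoef (fun θ : ℝ => Complex.exp (Complex.I * j * θ)) k = if k = j then 1 else 0 := by
  have h := fcoef_exp_mul (fun _ => 1) j k
  simp only [mul_one] at h
  rw [h]
  split_ifs with hk
  · rw [hk, sub_self, fcoef_one_zero]
  · exact XSpace.fcoef_one (sub_ne_zero.mpr hk)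

lemma norm_exp_I_mul (k : ℤ) (θ : ℝ) : ‖Complex.exp (Complex.I * k * θ)‖ = 1 := by
  have := norm_exp_neg_I_mul (-k) θ
  push_cast at this
  rwa [show -(Complex.I * -(k : ℂ) * θ) = Complex.I * k * θ by ring] at this

/-- The sum of the Fourier series with coefficients `x`. -/
def fsum (x : ℤ → ℂ) (θ : ℝ) : ℂ := ∑' k : ℤ, x k * Complex.exp (Complex.I * k * θ)

lemma norm_fterm (x : ℤ → ℂ) (k : ℤ) (θ : ℝ) :
    ‖x k * Complex.exp (Complex.I * k * θ)‖ = ‖x k‖ := by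
  rw [norm_mul, norm_exp_I_mul, mul_one]

lemma summable_fterm {x : ℤ → ℂ} (hx : Summable fun k => ‖x k‖) (θ : ℝ) :
    Summable fun k : ℤ => x k * Complex.exp (Complex.I * k * θ) :=
  Summable.of_norm (by simpa only [norm_fterm] using hx)

lemma continuous_fsum {x : ℤ → ℂ} (hx : Summable fun k => ‖x k‖) : Continuous (fsum x) :=
  continuous_tsum (fun k => by fun_prop) hx fun k θ => (norm_fterm x k θ).le

lemma norm_fsum_le {x : ℤ → ℂ} (hx : Summable fun k => ‖x k‖) (θ : ℝ) :
    ‖fsum x θ‖ ≤ ∑' k, ‖x k‖ := by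
  refine (norm_tsum_le_tsum_norm (by simpa only [norm_fterm] using hx)).trans_eq ?_
  simp only [norm_fterm]

lemma memLp_fsum {x : ℤ → ℂ} (hx : Summable fun k => ‖x k‖) : MemLp (fsum x) 2 muT :=
  MemLp.of_bound (continuous_fsum hx).aestronglyMeasurable _
    (Filter.Eventually.of_forall (norm_fsum_le hx))

/-- Absolute summability allows sum and integral to be interchanged, and orthogonality of the
exponentials leaves a single term. -/
lemma fcoef_fsum {x : ℤ → ℂ} (hx : Summable fun k => ‖x k‖) (k : ℤ) : fcoef (fsum x) k = x k := by
  have hterm : ∀ j : ℤ, (1 / (2 * (Real.pi : ℂ))) *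
      ∫ θ : ℝ, Complex.exp (-(Complex.I * k * θ)) * (x j * Complex.exp (Complex.I * j * θ)) ∂muT =
      if j = k then x k else 0 := by
    intro j
    have h := fcoef_smul (x j) (fun θ : ℝ => Complex.exp (Complex.I * j * θ)) k
    unfold fcoef at h
    rw [h]
    have h2 := fcoef_exp j k
    unfold fcoef at h2
    rw [h2]
    by_cases hjk : j = k
    · simp [hjk]
    · simp [hjk, Ne.symm hjk]
  have hi : ∀ j : ℤ, Integrable (fun θ : ℝ => Complex.exp (-(Complex.I * k * θ)) *
      (x j * Complex.exp (Complex.I * j * θ))) muT := by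
    intro j
    refine integrable_exp_mul ?_ k
    refine Integrable.const_mul ?_ _
    refine Integrable.of_bound (by fun_prop) 1
      (Filter.Eventually.of_forall fun θ => (norm_exp_I_mul j θ).le)
  have hs : HasSum (fun j : ℤ => ∫ θ : ℝ, Complex.exp (-(Complex.I * k * θ)) *
      (x j * Complex.exp (Complex.I * j * θ)) ∂muT)
      (∫ θ : ℝ, ∑' j : ℤ, Complex.exp (-(Complex.I * k * θ)) *
      (x j * Complex.exp (Complex.I * j * θ)) ∂muT) := by
    refine hasSum_integral_of_summable_integral_norm hi ?_
    have : ∀ j : ℤ, ∫ θ : ℝ, ‖Complex.exp (-(Complex.I * k * θ)) *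
      (x j * Complex.exp (Complex.I * j * θ))‖ ∂muT = (muT.real univ) * ‖x j‖ := by
      intro j
      simp only [norm_mul, norm_exp_neg_I_mul, norm_exp_I_mul, one_mul, mul_one, integral_const,
        smul_eq_mul]
    simp only [this]
    exact hx.mul_left _
  have hs2 := hs.mul_left (1 / (2 * (Real.pi : ℂ)))
  simp only [hterm] at hs2
  have h3 := hs2.unique (hasSum_ite_eq k (x k))
  rw [← h3]
  unfold fcoef fsum
  simp only [tsum_mul_left]

lemma fcoef_sub {f g : ℝ → ℂ} (hf : Integrable f muT) (hg : Integrable g muT) (k : ℤ) :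
    fcoef (fun θ => f θ - g θ) k = fcoef f k - fcoef g k := by
  unfold fcoef
  rw [← mul_sub, ← integral_sub (integrable_exp_mul hf k) (integrable_exp_mul hg k)]
  simp only [mul_sub]

lemma ae_eq_of_fcoef {f g : ℝ → ℂ} (hf : MemLp f 2 muT) (hg : MemLp g 2 muT)
    (h : ∀ k, fcoef f k = fcoef g k) : f =ᵐ[muT] g := by
  have h0 := ae_eq_zero_of_fcoef (hf.sub hg) (fun k => by
    have := fcoef_sub (hf.integrable (by norm_num)) (hg.integrable (by norm_num)) k
    rw [h k, sub_self] at this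
    exact this)
  filter_upwards [h0] with θ hθ
  exact sub_eq_zero.mp hθ

/-- A function with absolutely summable Fourier coefficients is the sum of its Fourier series. -/
lemma ae_eq_fsum {f : ℝ → ℂ} (hf : MemLp f 2 muT) (hs : Summable fun k => ‖fcoef f k‖) :
    f =ᵐ[muT] fsum (fcoef f) :=
  ae_eq_of_fcoef hf (memLp_fsum hs) fun k => (fcoef_fsum hs k).symm

/-- The bijection `(j, k) ↦ (j, k - j)` of `ℤ × ℤ`. -/
def convEquiv : ℤ × ℤ ≃ ℤ × ℤ where
  toFun p := (p.2, p.1 - p.2)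
  invFun p := (p.1 + p.2, p.1)
  left_inv p := by ext <;> simp
  right_inv p := by ext <;> simp

/-- The convolution of sequences. -/
def sconv (x y : ℤ → ℂ) (k : ℤ) : ℂ := ∑' j, x j * y (k - j)

/-- The Cauchy product converges absolutely, so it may be regrouped along the diagonals `j + l = k`
by means of `convEquiv`. -/
lemma fsum_mul {x y : ℤ → ℂ} (hx : Summable fun k => ‖x k‖) (hy : Summable fun k => ‖y k‖)
    (θ : ℝ) : fsum (sconv x y) θ = fsum x θ * fsum y θ := by
  have hx' : Summable fun k : ℤ => ‖x k * Complex.exp (Complex.I * k * θ)‖ := by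
    simpa only [norm_fterm] using hx
  have hy' : Summable fun k : ℤ => ‖y k * Complex.exp (Complex.I * k * θ)‖ := by
    simpa only [norm_fterm] using hy
  have hs := summable_mul_of_summable_norm hx' hy'
  have hs2 := convEquiv.summable_iff.mpr hs
  simp only [Function.comp_def] at hs2
  unfold fsum
  rw [tsum_mul_tsum_of_summable_norm hx' hy', ← convEquiv.tsum_eq, hs2.tsum_prod]
  refine tsum_congr fun k => ?_
  unfold sconv
  rw [← tsum_mul_right]
  refine tsum_congr fun j => ?_
  simp only [convEquiv, Equiv.coe_fn_mk]
  rw [mul_mul_mul_comm, ← Complex.exp_add]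
  congr 2
  push_cast
  ring

lemma summable_norm_mul_conv {x y : ℤ → ℂ} (hx : Summable fun k => ‖x k‖)
    (hy : Summable fun k => ‖y k‖) :
    Summable fun p : ℤ × ℤ => ‖x p.2 * y (p.1 - p.2)‖ := by
  exact convEquiv.summable_iff.mpr (hx.mul_norm hy)

lemma summable_norm_sconv {x y : ℤ → ℂ} (hx : Summable fun k => ‖x k‖)
    (hy : Summable fun k => ‖y k‖) : Summable fun k => ‖sconv x y k‖ := by
  have h := summable_norm_mul_conv hx hy
  refine Summable.of_nonneg_of_le (fun _ => norm_nonneg _) (fun k => ?_) h.prod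
  exact norm_tsum_le_tsum_norm (h.prod_factor k)

/-! ### Sequences -/

open scoped ENNReal

/-- Cauchy–Schwarz. -/
lemma ENNReal.tsum_mul_sq_le {ι : Type*} (a b : ι → ℝ≥0∞) :
    (∑' i, a i * b i) ^ 2 ≤ (∑' i, a i ^ 2) * ∑' i, b i ^ 2 := by
  let _ : MeasurableSpace ι := ⊤
  have h := ENNReal.lintegral_mul_le_Lp_mul_Lq (Measure.count : Measure ι)
    (p := 2) (q := 2) ⟨by norm_num, by norm_num, by norm_num⟩
    (f := a) (g := b) measurable_from_top.aemeasurable measurable_from_top.aemeasurable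
  have hm : MeasurableSingletonClass ι := ⟨fun _ => trivial⟩
  rw [lintegral_count, lintegral_count, lintegral_count] at h
  have h2 := pow_le_pow_left₀ (by positivity) h 2
  rw [mul_pow, ← ENNReal.rpow_natCast, ← ENNReal.rpow_natCast (_ ^ _),
    ← ENNReal.rpow_natCast (_ ^ _), ← ENNReal.rpow_mul, ← ENNReal.rpow_mul] at h2
  norm_num at h2
  exact h2

/-- Young's inequality `‖a * b‖₂ ≤ ‖a‖₁ ‖b‖₂` for convolutions of sequences. -/
lemma ENNReal.tsum_conv_sq_le (a b : ℤ → ℝ≥0∞) :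
    ∑' k, (∑' j, a j * b (k - j)) ^ 2 ≤ (∑' j, a j) ^ 2 * ∑' j, b j ^ 2 := by
  have h1 : ∀ k, (∑' j, a j * b (k - j)) ^ 2 ≤ (∑' j, a j) * ∑' j, a j * b (k - j) ^ 2 := by
    intro k
    have hs : ∀ t : ℝ≥0∞, (t ^ (1 / 2 : ℝ)) ^ 2 = t := fun t => by
      rw [← ENNReal.rpow_natCast, ← ENNReal.rpow_mul]; norm_num
    -- Cauchy–Schwarz after splitting `a = a^{1/2} · a^{1/2}`: one half stays with `b`, the other
    -- produces the `ℓ¹` norm of `a`.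
    have h := ENNReal.tsum_mul_sq_le (fun j => a j ^ (1 / 2 : ℝ))
      (fun j => a j ^ (1 / 2 : ℝ) * b (k - j))
    simp only [← mul_assoc, ← sq, mul_pow, hs] at h
    exact h
  refine (ENNReal.tsum_le_tsum h1).trans_eq ?_
  rw [ENNReal.tsum_mul_left, ENNReal.tsum_comm, sq, mul_assoc]
  congr 1
  rw [← ENNReal.tsum_mul_right]
  refine tsum_congr fun j => ?_
  rw [ENNReal.tsum_mul_left]
  congr 1
  exact (Equiv.subRight j).tsum_eq (fun l => b l ^ 2)

/-- Replacing the smaller summand by the larger one costs the factor 4 instead of the sharp 2, but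
avoids subtraction. -/
lemma ENNReal.add_sq_le (a b : ℝ≥0∞) : (a + b) ^ 2 ≤ 4 * a ^ 2 + 4 * b ^ 2 := by
  have key : ∀ a b : ℝ≥0∞, a ≤ b → (a + b) ^ 2 ≤ 4 * a ^ 2 + 4 * b ^ 2 := fun a b hab =>
    calc (a + b) ^ 2 ≤ (b + b) ^ 2 := by gcongr
      _ = 4 * b ^ 2 := by ring
      _ ≤ _ := le_add_self
  rcases le_total a b with h | h
  · exact key a b h
  · rw [add_comm a, add_comm (4 * a ^ 2)]
    exact key b a h

/-- The square summable weight `1 / (1 + |k|)`. -/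
def hwt (k : ℤ) : ℝ≥0∞ := ENNReal.ofReal ((1 + |(k : ℝ)|)⁻¹)

lemma tsum_hwt_sq_ne_top : ∑' k, hwt k ^ 2 ≠ ⊤ := by
  have h : Summable fun k : ℤ => ((1 + |(k : ℝ)|)⁻¹) ^ 2 := by
    have h1 : Summable fun k : ℤ => (1 : ℝ) / (k : ℝ) ^ 2 :=
      Real.summable_one_div_int_pow.mpr (by norm_num)
    have h2 : Summable fun k : ℤ => (if k = 0 then (1 : ℝ) else 0) :=
      (hasSum_ite_eq 0 (1 : ℝ)).summable
    refine Summable.of_nonneg_of_le (fun k => by positivity) (fun k => ?_) (h1.add h2)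
    by_cases hk : k = 0
    · simp [hk]
    · simp only [hk, if_false, add_zero, one_div]
      rw [← inv_pow, ← sq_abs ((k : ℝ)⁻¹), abs_inv]
      have : 0 < |(k : ℝ)| := by positivity
      gcongr
      linarith
  have e : ∀ k, hwt k ^ 2 = ENNReal.ofReal (((1 + |(k : ℝ)|)⁻¹) ^ 2) := fun k => by
    unfold hwt; rw [ENNReal.ofReal_pow (by positivity)]
  simp only [e]
  rw [← ENNReal.ofReal_tsum_of_nonneg (fun _ => by positivity) h]
  exact ENNReal.ofReal_ne_top

/-- The constant in `tsum_conv_hwt_sq_le`. -/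
def hconst : ℝ≥0∞ := 8 * ∑' k, hwt k ^ 2

lemma hconst_ne_top : hconst ≠ ⊤ := ENNReal.mul_ne_top (by norm_num) tsum_hwt_sq_ne_top

/-- Multiplication by `hwt` takes `ℓ²` into `ℓ¹` by Cauchy–Schwarz, so Young's inequality applies
whichever factor carries `hwt`. In the product estimates this is how one spare power of `1 + |k|` on
just one of the factors is spent. -/
lemma tsum_conv_hwt_sq_le (x y : ℤ → ℝ≥0∞) :
    ∑' k, (∑' j, (hwt j + hwt (k - j)) * (x j * y (k - j))) ^ 2 ≤
      hconst * ((∑' j, x j ^ 2) * ∑' j, y j ^ 2) := by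
  have h1 : ∀ k, (∑' j, (hwt j + hwt (k - j)) * (x j * y (k - j))) ^ 2 ≤
      4 * (∑' j, (hwt j * x j) * y (k - j)) ^ 2 +
        4 * (∑' j, (hwt j * y j) * x (k - j)) ^ 2 := by
    intro k
    have e : ∑' j, (hwt j + hwt (k - j)) * (x j * y (k - j)) =
        (∑' j, (hwt j * x j) * y (k - j)) + ∑' j, (hwt j * y j) * x (k - j) := by
      -- The reflection `j ↦ k - j` exchanges the two factors, so that in both sums `hwt` sits on
      -- the factor evaluated at `j`.
      rw [← (Equiv.subLeft k).tsum_eq (fun j => (hwt j * y j) * x (k - j)), ← ENNReal.tsum_add]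
      refine tsum_congr fun j => ?_
      simp only [Equiv.subLeft_apply, sub_sub_cancel]
      ring
    rw [e]
    exact ENNReal.add_sq_le _ _
  refine (ENNReal.tsum_le_tsum h1).trans ?_
  rw [ENNReal.tsum_add, ENNReal.tsum_mul_left, ENNReal.tsum_mul_left]
  have h2 : ∀ a b : ℤ → ℝ≥0∞, ∑' k, (∑' j, (hwt j * a j) * b (k - j)) ^ 2 ≤
      (∑' k, hwt k ^ 2) * ((∑' j, a j ^ 2) * ∑' j, b j ^ 2) := by
    intro a b
    refine (ENNReal.tsum_conv_sq_le _ _).trans ?_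
    rw [← mul_assoc]
    gcongr
    exact ENNReal.tsum_mul_sq_le _ _
  refine (add_le_add (mul_le_mul_right (h2 x y) 4) (mul_le_mul_right (h2 y x) 4)).trans_eq ?_
  unfold hconst
  ring

end

noncomputable section

/-! ### Primitives on the unit interval -/

/-- On `(0, 1)` the function `f` is a primitive of the locally integrable function `g`. -/
def IsPrim (f g : ℝ → ℂ) : Prop :=
  ∀ a ∈ Ioo (0 : ℝ) 1, ∀ b ∈ Ioo (0 : ℝ) 1,
    IntervalIntegrable g volume a b ∧ f b - f a = ∫ x in a..b, g x

lemma uIcc_subset_Ioo {a b : ℝ} (ha : a ∈ Ioo (0 : ℝ) 1) (hb : b ∈ Ioo (0 : ℝ) 1) :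
    uIcc a b ⊆ Ioo 0 1 := ordConnected_Ioo.uIcc_subset ha hb

lemma IsPrim.of_hasDerivAt {f g : ℝ → ℂ} (h : ∀ x ∈ Ioo (0 : ℝ) 1, HasDerivAt f (g x) x)
    (hg : ContinuousOn g (Ioo 0 1)) : IsPrim f g := by
  intro a ha b hb
  have hi : IntervalIntegrable g volume a b :=
    (hg.mono (uIcc_subset_Ioo ha hb)).intervalIntegrable
  refine ⟨hi, ?_⟩
  rw [intervalIntegral.integral_eq_sub_of_hasDerivAt
    (fun x hx => h x (uIcc_subset_Ioo ha hb hx)) hi]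

lemma IsPrim.continuousOn {f g : ℝ → ℂ} (h : IsPrim f g) : ContinuousOn f (Ioo 0 1) := by
  have h2 : (1 / 2 : ℝ) ∈ Ioo (0 : ℝ) 1 := by constructor <;> norm_num
  intro x hx
  obtain ⟨a, ha0, hax⟩ := exists_between hx.1
  obtain ⟨b, hxb, hb1⟩ := exists_between hx.2
  have ha : a ∈ Ioo (0 : ℝ) 1 := ⟨ha0, hax.trans hx.2⟩
  have hb : b ∈ Ioo (0 : ℝ) 1 := ⟨hx.1.trans hxb, hb1⟩
  have hi := (h a ha b hb).1
  have hab : a ≤ b := (hax.trans hxb).le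
  have hc : ContinuousOn (fun y => f a + ∫ t in a..y, g t) (Icc a b) := by
    refine continuousOn_const.add ?_
    have := intervalIntegral.continuousOn_primitive_interval (f := g) (μ := volume) (a := a) (b := b)
      (by rw [uIcc_of_le hab, integrableOn_Icc_iff_integrableOn_Ioc]
          exact (intervalIntegrable_iff_integrableOn_Ioc_of_le hab).mp hi)
    rwa [uIcc_of_le hab] at this
  have he : ∀ y ∈ Icc a b, f y = f a + ∫ t in a..y, g t := fun y hy => by
    rw [← (h a ha y ⟨ha0.trans_le hy.1, hy.2.trans_lt hb1⟩).2]; ring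
  have hcf : ContinuousOn f (Icc a b) := hc.congr he
  exact (hcf.continuousAt (Icc_mem_nhds hax hxb)).continuousWithinAt

lemma IsPrim.congr {f g f' g' : ℝ → ℂ} (h : IsPrim f g) (hf : ∀ x ∈ Ioo (0 : ℝ) 1, f x = f' x)
    (hg : g =ᵐ[muI] g') : IsPrim f' g' := by
  intro a ha b hb
  have hs : uIoc a b ⊆ Ioo 0 1 := uIoc_subset_uIcc.trans (uIcc_subset_Ioo ha hb)
  have he : g =ᵐ[volume.restrict (uIoc a b)] g' := ae_restrict_of_ae_restrict_of_subset hs hg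
  refine ⟨(h a ha b hb).1.congr_ae he, ?_⟩
  rw [← hf a ha, ← hf b hb, (h a ha b hb).2]
  exact intervalIntegral.integral_congr_ae_restrict he

/-- The two summands are the integrals of `f x * g y` over the triangles into which the diagonal
cuts the square. The diagonal is null, so Fubini gives the product. This is integration by parts for
functions that are merely integrable. -/
lemma integral_mul_add_mul_primitive {a b : ℝ} {f g : ℝ → ℂ}
    (hf : IntegrableOn f (Ioc a b)) (hg : IntegrableOn g (Ioc a b)) :
    ∫ x in Ioc a b, (f x * (∫ y in Ioc a x, g y) + (∫ y in Ioc a x, f y) * g x) =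
      (∫ x in Ioc a b, f x) * ∫ x in Ioc a b, g x := by
  set μ : Measure ℝ := volume.restrict (Ioc a b) with hμ
  have hP : ∀ k : ℝ → ℂ, ∀ x ∈ Ioc a b,
      ∫ y in Ioc a x, k y = ∫ y, (Iic x).indicator k y ∂μ := by
    intro k x hx
    rw [integral_indicator measurableSet_Iic, hμ, Measure.restrict_restrict measurableSet_Iic]
    congr 2
    ext y
    simp only [mem_inter_iff, mem_Iic, mem_Ioc]
    constructor
    · rintro ⟨h1, h2⟩; exact ⟨h2, h1, h2.trans hx.2⟩
    · rintro ⟨h1, h2, _⟩; exact ⟨h2, h1⟩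
  have hfg : Integrable (fun z : ℝ × ℝ => f z.1 * g z.2) (μ.prod μ) := hf.mul_prod hg
  have hm1 : MeasurableSet {z : ℝ × ℝ | z.2 ≤ z.1} := measurableSet_le measurable_snd measurable_fst
  have hm2 : MeasurableSet {z : ℝ × ℝ | z.1 ≤ z.2} := measurableSet_le measurable_fst measurable_snd
  have hi1 := hfg.indicator hm1
  have hi2 := hfg.indicator hm2
  have e1 : ∀ x ∈ Ioc a b, f x * (∫ y in Ioc a x, g y) =
      ∫ y, {z : ℝ × ℝ | z.2 ≤ z.1}.indicator (fun z : ℝ × ℝ => f z.1 * g z.2) (x, y) ∂μ := by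
    intro x hx
    rw [hP g x hx, ← integral_const_mul]
    congr 1
    funext y
    by_cases hy : y ≤ x <;> simp [indicator, hy]
  have e2 : ∀ y ∈ Ioc a b, (∫ x in Ioc a y, f x) * g y =
      ∫ x, {z : ℝ × ℝ | z.1 ≤ z.2}.indicator (fun z : ℝ × ℝ => f z.1 * g z.2) (x, y) ∂μ := by
    intro y hy
    rw [hP f y hy, ← integral_mul_const]
    congr 1
    funext x
    by_cases hx : x ≤ y <;> simp [indicator, hx]
  have hae : ∀ᵐ x ∂μ, x ∈ Ioc a b := ae_restrict_mem measurableSet_Ioc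
  have hI1 : Integrable (fun x => f x * (∫ y in Ioc a x, g y)) μ :=
    hi1.integral_prod_left.congr (by filter_upwards [hae] with x hx using (e1 x hx).symm)
  have hI2 : Integrable (fun x => (∫ y in Ioc a x, f y) * g x) μ :=
    hi2.integral_prod_right.congr (by filter_upwards [hae] with x hx using (e2 x hx).symm)
  rw [integral_add hI1 hI2, setIntegral_congr_fun measurableSet_Ioc e1,
    setIntegral_congr_fun measurableSet_Ioc e2, ← integral_prod _ hi1, ← integral_prod_symm _ hi2, ← integral_add hi1 hi2,
    ← integral_prod_mul]
  refine integral_congr_ae ?_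
  have hd : ∀ᵐ z ∂(μ.prod μ), z.1 ≠ z.2 := by
    refine (Measure.ae_prod_mem_iff_ae_ae_mem (s := {z : ℝ × ℝ | z.1 ≠ z.2}) ?_).mpr ?_
    · exact (measurableSet_eq_fun measurable_fst measurable_snd).compl
    · refine Filter.Eventually.of_forall fun x => ?_
      have h0 : ∀ᵐ y ∂(volume : Measure ℝ), y ≠ x := by
        simp [ae_iff]
      filter_upwards [ae_restrict_of_ae h0] with y hy
      exact fun h => hy h.symm
  filter_upwards [hd] with z hz
  rcases lt_or_gt_of_ne hz with h | h
  · simp [indicator, h.le, not_le.mpr h]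
  · simp [indicator, h.le, not_le.mpr h]

/-- Since `g` and `g'` are only locally integrable, the product rule rests on the Fubini identity
`integral_mul_add_mul_primitive` and not on pointwise differentiation. -/
lemma IsPrim.mul {f g f' g' : ℝ → ℂ} (h : IsPrim f g) (h' : IsPrim f' g') :
    IsPrim (fun x => f x * f' x) (fun x => g x * f' x + f x * g' x) := by
  have key : ∀ a ∈ Ioo (0 : ℝ) 1, ∀ b ∈ Ioo (0 : ℝ) 1, a ≤ b →
      IntervalIntegrable (fun x => g x * f' x + f x * g' x) volume a b ∧
      f b * f' b - f a * f' a = ∫ x in a..b, (g x * f' x + f x * g' x) := by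
    intro a ha b hb hab
    have hs := uIcc_subset_Ioo ha hb
    have hi : IntervalIntegrable (fun x => g x * f' x) volume a b :=
      (h a ha b hb).1.mul_continuousOn (h'.continuousOn.mono hs)
    have hi' : IntervalIntegrable (fun x => f x * g' x) volume a b :=
      (h' a ha b hb).1.continuousOn_mul (h.continuousOn.mono hs)
    refine ⟨hi.add hi', ?_⟩
    have e := integral_mul_add_mul_primitive
      ((intervalIntegrable_iff_integrableOn_Ioc_of_le hab).mp (h a ha b hb).1)
      ((intervalIntegrable_iff_integrableOn_Ioc_of_le hab).mp (h' a ha b hb).1)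
    rw [← intervalIntegral.integral_of_le hab, ← intervalIntegral.integral_of_le hab,
      ← intervalIntegral.integral_of_le hab, ← (h a ha b hb).2, ← (h' a ha b hb).2] at e
    -- The primitives based at `a` are `f - f a` and `f' - f' a`; their constant parts are split off
    -- here and integrate explicitly.
    have e2 : ∫ x in a..b, (g x * (∫ y in Ioc a x, g' y) + (∫ y in Ioc a x, g y) * g' x) =
        ∫ x in a..b, ((g x * f' x + f x * g' x) - (g x * f' a + f a * g' x)) := by
      refine intervalIntegral.integral_congr fun x hx => ?_
      rw [uIcc_of_le hab] at hx
      have hx' : x ∈ Ioo (0 : ℝ) 1 := ⟨ha.1.trans_le hx.1, hx.2.trans_lt hb.2⟩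
      rw [← intervalIntegral.integral_of_le hx.1, ← intervalIntegral.integral_of_le hx.1,
        ← (h a ha x hx').2, ← (h' a ha x hx').2]
      ring
    have j1 := (h a ha b hb).1.mul_const (f' a)
    have j2 := (h' a ha b hb).1.const_mul (f a)
    rw [e2, intervalIntegral.integral_sub (hi.add hi') (j1.add j2),
      intervalIntegral.integral_add j1 j2, intervalIntegral.integral_mul_const,
      intervalIntegral.integral_const_mul, ← (h a ha b hb).2, ← (h' a ha b hb).2] at e
    linear_combination -e
  intro a ha b hb
  rcases le_total a b with hab | hab
  · exact key a ha b hb hab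
  · obtain ⟨h1, h2⟩ := key b hb a ha hab
    refine ⟨h1.symm, ?_⟩
    rw [intervalIntegral.integral_symm, ← h2]
    ring

lemma IsPrim.rpow (c : ℝ) :
    IsPrim (fun s => ((s ^ c : ℝ) : ℂ)) (fun s => ((c * s ^ (c - 1) : ℝ) : ℂ)) := by
  refine IsPrim.of_hasDerivAt (fun x hx => ?_) ?_
  · exact (Real.hasDerivAt_rpow_const (Or.inl hx.1.ne')).ofReal_comp
  · refine Complex.continuous_ofReal.comp_continuousOn ?_
    exact fun s hs => (continuousAt_const.mul
      (Real.continuousAt_rpow_const s _ (Or.inl hs.1.ne'))).continuousWithinAt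

/-! ### Test functions on the unit interval -/

/-- Smooth functions with compact support in `(0, 1)`. -/
structure IsTest1 (η : ℝ → ℂ) : Prop where
  smooth : ContDiff ℝ ∞ η
  compact : HasCompactSupport η
  support : tsupport η ⊆ Ioo 0 1

lemma IsTest1.deriv {η : ℝ → ℂ} (h : IsTest1 η) : IsTest1 (deriv η) where
  smooth := (contDiff_infty_iff_deriv.mp h.smooth).2
  compact := h.compact.deriv
  support := tsupport_deriv_subset.trans h.support

lemma exists_Icc_of_compact {η : ℝ → ℂ} (hc : HasCompactSupport η) (hs : tsupport η ⊆ Ioo 0 1) :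
    ∃ δ ∈ Ioo (0 : ℝ) (1 / 2), ∀ s, s ∉ Icc δ (1 - δ) → η s = 0 := by
  rcases (tsupport η).eq_empty_or_nonempty with he | hne
  · refine ⟨1 / 4, by constructor <;> norm_num, fun s _ => ?_⟩
    by_contra h0
    have : s ∈ tsupport η := subset_tsupport η h0
    rw [he] at this
    exact this.elim
  · have hK : IsCompact (tsupport η) := hc
    obtain ⟨a, ha, hal⟩ := hK.exists_isLeast hne
    obtain ⟨b, hb, hbg⟩ := hK.exists_isGreatest hne
    have h1 := hs ha
    have h2 := hs hb
    refine ⟨min (min a (1 - b)) (1 / 4), ⟨?_, ?_⟩, fun s hst => ?_⟩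
    · exact lt_min (lt_min h1.1 (by linarith [h2.2])) (by norm_num)
    · exact (min_le_right _ _).trans_lt (by norm_num)
    · by_contra h0
      have hm : s ∈ tsupport η := subset_tsupport η h0
      have h3 := min_le_left (min a (1 - b)) (1 / 4)
      exact hst ⟨h3.trans ((min_le_left _ _).trans (hal hm)),
        by linarith [min_le_right a (1 - b), hbg hm]⟩

lemma IsTest1.exists_Icc {η : ℝ → ℂ} (h : IsTest1 η) :
    ∃ δ ∈ Ioo (0 : ℝ) (1 / 2), ∀ s, s ∉ Icc δ (1 - δ) → η s = 0 :=
  exists_Icc_of_compact h.compact h.support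

lemma IsTest1.of_Icc {η : ℝ → ℂ} (h : ContDiff ℝ ∞ η) {δ : ℝ} (hδ : 0 < δ)
    (h0 : ∀ s, s ∉ Icc δ (1 - δ) → η s = 0) : IsTest1 η := by
  have hs : tsupport η ⊆ Icc δ (1 - δ) := by
    refine closure_minimal (fun s hs => ?_) isClosed_Icc
    by_contra hn
    exact hs (h0 s hn)
  exact ⟨h, isCompact_Icc.of_isClosed_subset (isClosed_tsupport η) hs,
    hs.trans fun s hs => ⟨hδ.trans_le hs.1, hs.2.trans_lt (by linarith)⟩⟩

lemma integral_muI_eq {u : ℝ → ℂ} {δ : ℝ} (hδ : δ ∈ Ioo (0 : ℝ) (1 / 2))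
    (h0 : ∀ s, s ∉ Icc δ (1 - δ) → u s = 0) :
    ∫ s, u s ∂muI = ∫ s in δ..(1 - δ), u s := by
  rw [intervalIntegral.integral_of_le (by linarith [hδ.2]), ← integral_Icc_eq_integral_Ioc]
  refine setIntegral_eq_of_subset_of_forall_sdiff_eq_zero measurableSet_Ioo ?_ ?_
  · exact fun s hs => ⟨hδ.1.trans_le hs.1, hs.2.trans_lt (by linarith [hδ.1])⟩
  · exact fun s hs => h0 s hs.2

lemma IsTest1.isPrim {η : ℝ → ℂ} (h : IsTest1 η) : IsPrim η (_root_.deriv η) :=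
  IsPrim.of_hasDerivAt
    (fun _ _ => (h.smooth.differentiable (by simp)).differentiableAt.hasDerivAt)
    h.deriv.smooth.continuous.continuousOn

lemma IsPrim.integral_test {f g η : ℝ → ℂ} (h : IsPrim f g) (hη : IsTest1 η) :
    ∫ s, f s * deriv η s ∂muI = -∫ s, g s * η s ∂muI := by
  obtain ⟨δ, hδ, h0⟩ := hη.exists_Icc
  obtain ⟨δ', hδ', h0'⟩ := hη.deriv.exists_Icc
  -- Half the smaller margin: `η` vanishes at `ε` and `1 - ε`, which removes the boundary terms, and
  -- both integrands vanish outside the interval between them.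
  set ε := min δ δ' / 2 with hε
  have hm := lt_min hδ.1 hδ'.1
  have hεm : ε < min δ δ' := by linarith
  have hε' : ε ∈ Ioo (0 : ℝ) (1 / 2) :=
    ⟨by linarith, hεm.trans_le ((min_le_left _ _).trans hδ.2.le)⟩
  have e0 : ∀ s, s ∉ Ioo ε (1 - ε) → η s = 0 := fun s hs => h0 s fun hs' =>
    hs ⟨by linarith [hs'.1, min_le_left δ δ'], by linarith [hs'.2, min_le_left δ δ']⟩
  have e0' : ∀ s, s ∉ Ioo ε (1 - ε) → deriv η s = 0 := fun s hs => h0' s fun hs' =>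
    hs ⟨by linarith [hs'.1, min_le_right δ δ'], by linarith [hs'.2, min_le_right δ δ']⟩
  have ha : ε ∈ Ioo (0 : ℝ) 1 := ⟨hε'.1, by linarith [hε'.2]⟩
  have hb : 1 - ε ∈ Ioo (0 : ℝ) 1 := ⟨by linarith [hε'.2], by linarith [hε'.1]⟩
  have hp := ((h.mul hη.isPrim) ε ha (1 - ε) hb).2
  have hs := uIcc_subset_Ioo ha hb
  have i1 : IntervalIntegrable (fun s => g s * η s) volume ε (1 - ε) :=
    (h ε ha _ hb).1.mul_continuousOn hη.smooth.continuous.continuousOn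
  have i2 : IntervalIntegrable (fun s => f s * deriv η s) volume ε (1 - ε) :=
    (hη.isPrim ε ha _ hb).1.continuousOn_mul (h.continuousOn.mono hs)
  dsimp only at hp
  rw [intervalIntegral.integral_add i1 i2, e0 ε (by simp), e0 (1 - ε) (by simp)] at hp
  rw [integral_muI_eq hε' fun s hs => by rw [e0' s fun h => hs (Ioo_subset_Icc_self h), mul_zero],
    integral_muI_eq hε' fun s hs => by rw [e0 s fun h => hs (Ioo_subset_Icc_self h), mul_zero]]
  linear_combination -hp

lemma exists_test_integral_one : ∃ ρ : ℝ → ℝ, ContDiff ℝ ∞ ρ ∧ HasCompactSupport ρ ∧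
    tsupport ρ ⊆ Ioo 0 1 ∧ ∫ s, ρ s = 1 := by
  let b : ContDiffBump (1 / 2 : ℝ) := ⟨1 / 8, 1 / 4, by norm_num, by norm_num⟩
  refine ⟨b.normed volume, b.contDiff_normed, b.hasCompactSupport_normed, ?_, b.integral_normed⟩
  rw [b.tsupport_normed_eq]
  intro x hx
  rw [Metric.mem_closedBall, Real.dist_eq, abs_le] at hx
  constructor
  · have := hx.1; simp only [b] at this; linarith
  · have := hx.2; simp only [b] at this; linarith

/-- The primitive based at `0` vanishes to the left of the support, and to its right because the
total integral is zero. -/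
lemma isTest1_primitive {ψ : ℝ → ℂ} (h : IsTest1 ψ) (h0 : ∫ s, ψ s ∂muI = 0) :
    ∃ η, IsTest1 η ∧ deriv η = ψ := by
  have hc := h.smooth.continuous
  have hd : ∀ x, HasDerivAt (fun x => ∫ t in (0 : ℝ)..x, ψ t) (ψ x) x := fun x =>
    intervalIntegral.integral_hasDerivAt_right (hc.intervalIntegrable _ _)
      (hc.stronglyMeasurableAtFilter _ _) hc.continuousAt
  have hd' : deriv (fun x => ∫ t in (0 : ℝ)..x, ψ t) = ψ := funext fun x => (hd x).deriv
  obtain ⟨δ, hδ, hz⟩ := h.exists_Icc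
  refine ⟨fun x => ∫ t in (0 : ℝ)..x, ψ t, IsTest1.of_Icc ?_ hδ.1 fun s hs => ?_, hd'⟩
  · rw [contDiff_infty_iff_deriv, hd']
    exact ⟨fun x => (hd x).differentiableAt, h.smooth⟩
  · have hzero : ∀ a b : ℝ, (∀ t ∈ uIoo a b, ψ t = 0) → ∫ t in a..b, ψ t = 0 := by
      intro a b hab
      refine intervalIntegral.integral_zero_ae ?_
      have : ∀ᵐ t : ℝ, t ≠ a ∧ t ≠ b := by
        have h1 : ∀ c : ℝ, ∀ᵐ t : ℝ, t ≠ c := fun c => by simp [ae_iff]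
        filter_upwards [h1 a, h1 b] with t ht ht' using ⟨ht, ht'⟩
      filter_upwards [this] with t ht hm
      refine hab t ?_
      rcases le_total a b with hle | hle
      · rw [uIoc_of_le hle] at hm
        rw [uIoo_of_le hle]
        exact ⟨hm.1, lt_of_le_of_ne hm.2 ht.2⟩
      · rw [uIoc_of_ge hle] at hm
        rw [uIoo_of_ge hle]
        exact ⟨hm.1, lt_of_le_of_ne hm.2 ht.1⟩
    have hout : s < δ ∨ 1 - δ < s := by
      by_contra hcon
      push Not at hcon
      exact hs hcon
    rcases hout with hlt | hlt
    · refine hzero 0 s fun t ht => hz t fun hm => ?_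
      have : t < max 0 s := ht.2
      rcases le_total 0 s with h2 | h2
      · rw [max_eq_right h2] at this; linarith [hm.1]
      · rw [max_eq_left h2] at this; linarith [hm.1, hδ.1]
    · have e1 : ∫ t in (0 : ℝ)..s, ψ t = (∫ t in (0 : ℝ)..δ, ψ t) +
          (∫ t in δ..(1 - δ), ψ t) + ∫ t in (1 - δ)..s, ψ t := by
        rw [intervalIntegral.integral_add_adjacent_intervals,
          intervalIntegral.integral_add_adjacent_intervals] <;> exact hc.intervalIntegrable _ _
      rw [e1, ← integral_muI_eq hδ hz, h0, hzero 0 δ, hzero (1 - δ) s, add_zero, add_zero]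
      · intro t ht
        rw [uIoo_of_le hlt.le] at ht
        exact hz t fun hm => by linarith [hm.2, ht.1]
      · intro t ht
        rw [uIoo_of_le hδ.1.le] at ht
        exact hz t fun hm => by linarith [hm.1, ht.2]

/-- The lemma of du Bois-Reymond. -/
lemma ae_const_of_integral_deriv {h : ℝ → ℂ} (hi : Integrable h muI)
    (h0 : ∀ η, IsTest1 η → ∫ s, h s * deriv η s ∂muI = 0) : ∃ c : ℂ, h =ᵐ[muI] fun _ => c := by
  obtain ⟨ρ, hρ, hρc, hρs, hρ1⟩ := exists_test_integral_one
  have hmul : ∀ g : ℝ → ℝ, Continuous g → HasCompactSupport g → ∀ k : ℝ → ℂ, Integrable k muI →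
      Integrable (fun s => k s * (g s : ℂ)) muI := by
    intro g hg hgc k hk
    obtain ⟨C, hC⟩ := hgc.exists_bound_of_continuous hg
    exact hk.mul_bdd (c := C) (Complex.continuous_ofReal.comp hg).aestronglyMeasurable
      (Filter.Eventually.of_forall fun s => by simpa using hC s)
  have hset : ∀ g : ℝ → ℝ, tsupport g ⊆ Ioo 0 1 → ∫ s, g s ∂muI = ∫ s, g s := by
    intro g hgs
    unfold muI
    refine setIntegral_eq_integral_of_forall_compl_eq_zero fun s hs => ?_
    by_contra hne
    exact hs (hgs (subset_tsupport g hne))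
  have htest : ∀ g : ℝ → ℝ, ContDiff ℝ ∞ g → HasCompactSupport g → tsupport g ⊆ Ioo 0 1 →
      IsTest1 fun s => (g s : ℂ) := by
    intro g hg hgc hgs
    refine ⟨Complex.ofRealCLM.contDiff.comp hg, hgc.comp_left (g := fun x : ℝ => (x : ℂ)) (by simp),
      (closure_mono ?_).trans hgs⟩
    intro s hs hn
    exact hs (by simp [hn])
  -- The constant can only be the average of `h` against a bump of integral one.
  set c : ℂ := ∫ s, h s * (ρ s : ℂ) ∂muI with hcdef
  refine ⟨c, ?_⟩
  have hloc : LocallyIntegrableOn (fun s => h s - c) (Ioo 0 1) volume :=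
    IntegrableOn.locallyIntegrableOn (hi.sub (integrable_const c))
  have key := isOpen_Ioo.ae_eq_zero_of_integral_contDiff_smul_eq_zero hloc ?_
  · have hm : ∀ᵐ s ∂muI, s ∈ Ioo (0 : ℝ) 1 := ae_restrict_mem measurableSet_Ioo
    filter_upwards [ae_restrict_of_ae key, hm] with s hs hm
    exact sub_eq_zero.mp (hs hm)
  · intro g hg hgc hgs
    set A : ℝ := ∫ s, g s with hA
    have hgt := htest g hg hgc hgs
    have hrt := htest ρ hρ hρc hρs
    -- Subtracting `A ρ` from `g` gives a test function of mean zero, hence the derivative of a test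
    -- function, to which the hypothesis `h0` applies.
    have hψs : ContDiff ℝ ∞ (fun s => (g s : ℂ) - A * (ρ s : ℂ)) :=
      hgt.smooth.sub (contDiff_const.mul hrt.smooth)
    obtain ⟨δ, hδ, hz⟩ := hgt.exists_Icc
    obtain ⟨δ', hδ', hz'⟩ := hrt.exists_Icc
    have hψ : IsTest1 (fun s => (g s : ℂ) - A * (ρ s : ℂ)) := by
      refine IsTest1.of_Icc hψs (lt_min hδ.1 hδ'.1) fun s hs => ?_
      rw [hz s fun hm => hs ⟨(min_le_left _ _).trans hm.1,
          hm.2.trans (by linarith [min_le_left δ δ'])⟩,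
        hz' s fun hm => hs ⟨(min_le_right _ _).trans hm.1,
          hm.2.trans (by linarith [min_le_right δ δ'])⟩]
      simp
    have hcast : ∀ k : ℝ → ℝ, ∫ s, (k s : ℂ) ∂muI = ((∫ s, k s ∂muI : ℝ) : ℂ) := fun k =>
      integral_ofReal
    have hgi : Integrable (fun s => (g s : ℂ)) muI := by
      simpa using hmul g hg.continuous hgc _ (integrable_const (1 : ℂ))
    have hri : Integrable (fun s => (ρ s : ℂ)) muI := by
      simpa using hmul ρ hρ.continuous hρc _ (integrable_const (1 : ℂ))
    have hψ0 : ∫ s, ((g s : ℂ) - A * (ρ s : ℂ)) ∂muI = 0 := by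
      rw [integral_sub hgi (hri.const_mul _), integral_const_mul, hcast, hcast, hset g hgs,
        hset ρ hρs, hρ1]
      simp [hA]
    obtain ⟨η, hη, hd⟩ := isTest1_primitive hψ hψ0
    have h1 := h0 η hη
    rw [hd] at h1
    have i1 := hmul g hg.continuous hgc h hi
    have i2 := hmul ρ hρ.continuous hρc h hi
    have h2 : ∫ s, h s * ((g s : ℂ) - A * (ρ s : ℂ)) ∂muI =
        (∫ s, h s * (g s : ℂ) ∂muI) - A * c := by
      rw [hcdef, ← integral_const_mul, ← integral_sub i1 (i2.const_mul _)]
      congr 1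
      funext s
      ring
    rw [h2] at h1
    have h3 : ∫ s, g s • (h s - c) = ∫ s, g s • (h s - c) ∂muI := by
      unfold muI
      refine (setIntegral_eq_integral_of_forall_compl_eq_zero fun s hs => ?_).symm
      have : g s = 0 := by
        by_contra hne
        exact hs (hgs (subset_tsupport g hne))
      rw [this, zero_smul]
    rw [h3]
    have h4 : ∫ s, g s • (h s - c) ∂muI = (∫ s, h s * (g s : ℂ) ∂muI) - A * c := by
      have : ∀ s, g s • (h s - c) = h s * (g s : ℂ) - c * (g s : ℂ) := fun s => by
        rw [Complex.real_smul]; ring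
      simp only [this]
      rw [integral_sub i1 (hgi.const_mul _), integral_const_mul, hcast, hset g hgs]
      ring
    rw [h4, h1]

end

noncomputable section

/-! ### The bilinear pairing on `L²` -/

section Pairing

variable {α : Type*} [MeasurableSpace α] {μ : Measure α}

/-- The bilinear pairing `f ↦ ∫ f K`. -/
def pairL (K : Lp ℂ 2 μ) : Lp ℂ 2 μ →L[ℂ] ℂ := innerSL ℂ (star K)

lemma pairL_apply (K f : Lp ℂ 2 μ) : pairL K f = ∫ x, f x * K x ∂μ := by
  unfold pairL
  rw [innerSL_apply_apply, L2.inner_def]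
  refine integral_congr_ae ?_
  filter_upwards [Lp.coeFn_star K] with x hx
  rw [hx]
  simp

lemma pairL_toLp {K : α → ℂ} (hK : MemLp K 2 μ) (f : Lp ℂ 2 μ) :
    pairL (hK.toLp K) f = ∫ x, f x * K x ∂μ := by
  rw [pairL_apply]
  refine integral_congr_ae ?_
  filter_upwards [hK.coeFn_toLp] with x hx
  rw [hx]

lemma norm_pairL_le (K f : Lp ℂ 2 μ) : ‖pairL K f‖ ≤ ‖K‖ * ‖f‖ := by
  rw [pairL, innerSL_apply_apply]
  refine (norm_inner_le_norm (𝕜 := ℂ) (star K) f).trans ?_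
  refine mul_le_mul_of_nonneg_right (Lp.norm_le_norm_of_ae_le ?_) (norm_nonneg f)
  filter_upwards [Lp.coeFn_star K] with x hx
  rw [hx, Pi.star_apply, norm_star]

end Pairing

/-! ### The Euler operator on the unit interval -/

/-- Square integrable functions on the unit interval. -/
abbrev HI : Type := Lp ℂ 2 muI

lemma HI.integrable (f : HI) : Integrable f muI := (Lp.memLp f).integrable (by norm_num)

lemma ae_mem_muI : ∀ᵐ s ∂muI, s ∈ Ioo (0 : ℝ) 1 := ae_restrict_mem measurableSet_Ioo

/-- The equation `s f' = a f + g` holds weakly on `(0, 1)`. -/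
def EulerRel (a : ℝ) (f g : HI) : Prop :=
  ∀ η, IsTest1 η → ∫ s, f s * (s * deriv η s) ∂muI = -∫ s, ((1 + a) * f s + g s) * η s ∂muI

lemma IsTest1.memLp {η : ℝ → ℂ} (h : IsTest1 η) : MemLp η 2 muI := by
  obtain ⟨C, hC⟩ := h.compact.exists_bound_of_continuous h.smooth.continuous
  exact MemLp.of_bound h.smooth.continuous.aestronglyMeasurable C
    (Filter.Eventually.of_forall hC)

lemma IsTest1.mul_left {η k : ℝ → ℂ} (h : IsTest1 η) (hk : ContDiff ℝ ∞ k) :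
    IsTest1 fun s => k s * η s :=
  ⟨hk.mul h.smooth, h.compact.mul_left, (tsupport_mul_subset_right (f := k) (g := η)).trans h.support⟩

lemma IsTest1.id_mul_deriv {η : ℝ → ℂ} (h : IsTest1 η) : IsTest1 fun s : ℝ => (s : ℂ) * _root_.deriv η s :=
  h.deriv.mul_left Complex.ofRealCLM.contDiff

/-- In this form the relation is the vanishing of a family of continuous linear functionals on
pairs, from which linearity and closedness are immediate. -/
lemma eulerRel_iff (a : ℝ) (f g : HI) : EulerRel a f g ↔ ∀ η, ∀ h : IsTest1 η,
    pairL (h.id_mul_deriv.memLp.toLp _) f + (1 + a) * pairL (h.memLp.toLp η) f +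
      pairL (h.memLp.toLp η) g = 0 := by
  refine forall₂_congr fun η h => ?_
  have i1 : Integrable (fun s => f s * η s) muI := (Lp.memLp f).integrable_mul h.memLp
  have i2 : Integrable (fun s => g s * η s) muI := (Lp.memLp g).integrable_mul h.memLp
  have e : ∫ s, ((1 + a) * f s + g s) * η s ∂muI =
      (1 + a) * (∫ s, f s * η s ∂muI) + ∫ s, g s * η s ∂muI := by
    rw [← integral_const_mul, ← integral_add (i1.const_mul _) i2]
    congr 1
    funext s
    ring
  rw [e, pairL_toLp, pairL_toLp, pairL_toLp, eq_neg_iff_add_eq_zero, add_assoc]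

lemma EulerRel.zero (a : ℝ) : EulerRel a 0 0 := by
  rw [eulerRel_iff]; intro η h; simp

lemma EulerRel.add {a : ℝ} {f g f' g' : HI} (h : EulerRel a f g) (h' : EulerRel a f' g') :
    EulerRel a (f + f') (g + g') := by
  rw [eulerRel_iff] at *
  intro η hη
  rw [map_add, map_add, map_add]
  linear_combination h η hη + h' η hη

lemma EulerRel.smul {a : ℝ} {f g : HI} (h : EulerRel a f g) (c : ℂ) :
    EulerRel a (c • f) (c • g) := by
  rw [eulerRel_iff] at *
  intro η hη
  rw [map_smul, map_smul, map_smul]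
  simp only [smul_eq_mul]
  linear_combination c * h η hη

lemma EulerRel.nsmul {a : ℝ} {f g : HI} (h : EulerRel a f g) (c : ℕ) :
    EulerRel a (c • f) (c • g) := by
  simpa only [Nat.cast_smul_eq_nsmul] using h.smul (c : ℂ)

lemma EulerRel.sum {ι : Type*} {a : ℝ} (s : Finset ι) {f g : ι → HI}
    (h : ∀ i ∈ s, EulerRel a (f i) (g i)) : EulerRel a (∑ i ∈ s, f i) (∑ i ∈ s, g i) := by
  classical
  induction s using Finset.induction_on with
  | empty => simpa using EulerRel.zero a
  | insert i s his ih =>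
    rw [Finset.sum_insert his, Finset.sum_insert his]
    exact (h i (Finset.mem_insert_self _ _)).add
      (ih fun j hj => h j (Finset.mem_insert_of_mem hj))

/-- In `s f' = a f + g` a multiple of `f` may be moved between the two terms on the right. This is
how a profile is read with respect to a different power of `s`. -/
lemma EulerRel.shift {a b : ℝ} {f g : HI} (h : EulerRel a f g) :
    EulerRel (a - b) f (g + (b : ℂ) • f) := by
  rw [eulerRel_iff] at *
  intro η hη
  rw [map_add, map_smul, smul_eq_mul]
  push_cast
  linear_combination h η hη

/-- Closedness lets the relation pass from single terms to convergent series, in particular to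
convolutions; it also yields completeness of the Kondratev spaces. -/
lemma isClosed_eulerRel (a : ℝ) : IsClosed {P : HI × HI | EulerRel a P.1 P.2} := by
  simp only [eulerRel_iff, Set.ofPred_forall]
  refine isClosed_iInter fun η => isClosed_iInter fun h => ?_
  exact isClosed_eq (by fun_prop) continuous_const

lemma EulerRel.hasSum {ι : Type*} {a : ℝ} {f g : ι → HI} {F G : HI} (hf : HasSum f F)
    (hg : HasSum g G) (h : ∀ i, EulerRel a (f i) (g i)) : EulerRel a F G :=
  (isClosed_eulerRel a).mem_of_tendsto (hf.prodMk hg)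
    (Filter.Eventually.of_forall fun s => by
      have := EulerRel.sum s fun i _ => h i
      change EulerRel a (∑ i ∈ s, (f i, g i)).1 (∑ i ∈ s, (f i, g i)).2
      rwa [Prod.fst_sum, Prod.snd_sum])

lemma ae_eq_zero_of_test {g : ℝ → ℂ} (hg : LocallyIntegrableOn g (Ioo 0 1))
    (h : ∀ η, IsTest1 η → ∫ s, g s * η s ∂muI = 0) : g =ᵐ[muI] 0 := by
  have key := isOpen_Ioo.ae_eq_zero_of_integral_contDiff_smul_eq_zero hg ?_
  · filter_upwards [ae_restrict_of_ae key, ae_mem_muI] with s hs hm using hs hm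
  · intro k hk hkc hks
    have ht : IsTest1 fun s => (k s : ℂ) := by
      refine ⟨Complex.ofRealCLM.contDiff.comp hk,
        hkc.comp_left (g := fun x : ℝ => (x : ℂ)) (by simp), (closure_mono ?_).trans hks⟩
      intro s hs hn
      exact hs (by simp [hn])
    rw [← h _ ht]
    unfold muI
    rw [setIntegral_eq_integral_of_forall_compl_eq_zero]
    · congr 1
      funext s
      rw [Complex.real_smul, mul_comm]
    · intro s hs
      have : k s = 0 := by
        by_contra hne
        exact hs (hks (subset_tsupport k hne))
      simp [this]

/-- The difference of the right sides annihilates every test function. Consequently a chain of Euler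
relations is determined by its first member. -/
lemma EulerRel.unique {a : ℝ} {f g g' : HI} (h : EulerRel a f g) (h' : EulerRel a f g') :
    g = g' := by
  rw [← sub_eq_zero, Lp.eq_zero_iff_ae_eq_zero]
  refine ae_eq_zero_of_test (IntegrableOn.locallyIntegrableOn (HI.integrable _)) fun η hη => ?_
  rw [← pairL_toLp hη.memLp, map_sub]
  rw [eulerRel_iff] at *
  linear_combination h η hη - h' η hη

lemma isPrim_integral {E : ℝ → ℂ} (hE : Integrable E muI) :
    IsPrim (fun s => ∫ t in (1 / 2 : ℝ)..s, E t) E := by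
  have hi : ∀ a ∈ Ioo (0 : ℝ) 1, ∀ b ∈ Ioo (0 : ℝ) 1, IntervalIntegrable E volume a b := by
    intro a ha b hb
    rw [intervalIntegrable_iff]
    exact IntegrableOn.mono_set hE (uIoc_subset_uIcc.trans (uIcc_subset_Ioo ha hb))
  have h2 : (1 / 2 : ℝ) ∈ Ioo (0 : ℝ) 1 := by constructor <;> norm_num
  intro a ha b hb
  exact ⟨hi a ha b hb, intervalIntegral.integral_interval_sub_left (hi _ h2 b hb) (hi _ h2 a ha)⟩

lemma IsPrim.add_const {f g : ℝ → ℂ} (h : IsPrim f g) (c : ℂ) : IsPrim (fun s => f s + c) g := by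
  intro a ha b hb
  refine ⟨(h a ha b hb).1, ?_⟩
  rw [← (h a ha b hb).2]
  ring

/-- The function `s f` has the integrable weak derivative `(1 + a) f + g`. By du Bois-Reymond it
equals a primitive up to a constant, and division by `s` gives a representative continuous on `(0,
1)`. -/
lemma EulerRel.exists_rep {a : ℝ} {f g : HI} (h : EulerRel a f g) : ∃ r : ℝ → ℂ,
    f =ᵐ[muI] r ∧ IsPrim (fun s => s * r s) (fun s => (1 + a) * f s + g s) := by
  set E : ℝ → ℂ := fun s => (1 + a) * f s + g s with hEdef
  have hE : Integrable E muI := ((HI.integrable f).const_mul _).add (HI.integrable g)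
  set G : ℝ → ℂ := fun s => ∫ t in (1 / 2 : ℝ)..s, E t with hG
  have hGp : IsPrim G E := isPrim_integral hE
  have hGm : AEStronglyMeasurable G muI := hGp.continuousOn.aestronglyMeasurable measurableSet_Ioo
  have hGi : Integrable G muI := by
    refine Integrable.of_bound hGm (∫ s, ‖E s‖ ∂muI) ?_
    filter_upwards [ae_mem_muI] with s hs
    refine (intervalIntegral.norm_integral_le_integral_norm_uIoc).trans ?_
    refine setIntegral_mono_set hE.norm (Filter.Eventually.of_forall fun _ => norm_nonneg _) ?_
    have h2 : (1 / 2 : ℝ) ∈ Ioo (0 : ℝ) 1 := by constructor <;> norm_num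
    exact (uIoc_subset_uIcc.trans (uIcc_subset_Ioo h2 hs)).eventuallyLE
  have hsf : Integrable (fun s : ℝ => (s : ℂ) * f s) muI := by
    refine (HI.integrable f).bdd_mul (c := 1)
      Complex.continuous_ofReal.aestronglyMeasurable ?_
    filter_upwards [ae_mem_muI] with s hs
    rw [Complex.norm_real, Real.norm_eq_abs, abs_of_pos hs.1]
    exact hs.2.le
  obtain ⟨c, hc⟩ := ae_const_of_integral_deriv (hsf.sub hGi) fun η hη => by
    have h1 := h η hη
    have h2 := hGp.integral_test hη
    have i1 : Integrable (fun s : ℝ => (s : ℂ) * f s * deriv η s) muI := by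
      obtain ⟨C, hC⟩ := hη.deriv.compact.exists_bound_of_continuous hη.deriv.smooth.continuous
      exact hsf.mul_bdd (c := C) hη.deriv.smooth.continuous.aestronglyMeasurable
        (Filter.Eventually.of_forall hC)
    have i2 : Integrable (fun s => G s * deriv η s) muI := by
      obtain ⟨C, hC⟩ := hη.deriv.compact.exists_bound_of_continuous hη.deriv.smooth.continuous
      exact hGi.mul_bdd (c := C) hη.deriv.smooth.continuous.aestronglyMeasurable
        (Filter.Eventually.of_forall hC)
    have e : ∫ s, ((fun s : ℝ => (s : ℂ) * f s) - G) s * deriv η s ∂muI =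
        (∫ s, f s * (s * deriv η s) ∂muI) - ∫ s, G s * deriv η s ∂muI := by
      rw [show (∫ s, f s * (s * deriv η s) ∂muI) = ∫ s : ℝ, (s : ℂ) * f s * deriv η s ∂muI by
        congr 1; funext s; ring, ← integral_sub i1 i2]
      congr 1
      funext s
      rw [Pi.sub_apply]
      ring
    rw [e, h1, h2, sub_self]
  refine ⟨fun s => (G s + c) / s, ?_, (hGp.add_const c).congr (fun s hs => ?_) (by rfl)⟩
  · filter_upwards [hc, ae_mem_muI] with s hs hm
    have h0 : (s : ℂ) ≠ 0 := by exact_mod_cast hm.1.ne'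
    rw [← hs, Pi.sub_apply]
    field_simp
    ring
  · have h0 : (s : ℂ) ≠ 0 := by exact_mod_cast hs.1.ne'
    dsimp only
    field_simp

lemma EulerRel.of_isPrim {a : ℝ} {f g : HI} {r E : ℝ → ℂ} (hf : f =ᵐ[muI] r)
    (h : IsPrim (fun s => s * r s) E) (hE : E =ᵐ[muI] fun s => (1 + a) * f s + g s) :
    EulerRel a f g := by
  intro η hη
  have h1 := h.integral_test hη
  have e1 : ∫ s, f s * (s * deriv η s) ∂muI = ∫ s, (s : ℂ) * r s * deriv η s ∂muI := by
    refine integral_congr_ae ?_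
    filter_upwards [hf] with s hs
    rw [hs]
    ring
  rw [e1, h1]
  congr 1
  refine integral_congr_ae ?_
  filter_upwards [hE] with s hs
  rw [hs]

/-- Cauchy–Schwarz against the indicator of `(y, s]`, whose length is at most `s`. -/
lemma norm_intervalIntegral_le (k : HI) {y s : ℝ} (hy : 0 < y) (hys : y ≤ s) (hs : s < 1) :
    ‖∫ t in y..s, k t‖ ≤ √s * ‖k‖ := by
  have hmeas : muI (Ioc y s) ≠ ⊤ := measure_ne_top _ _
  have hsub : Ioc y s ⊆ Ioo (0 : ℝ) 1 := fun t ht => ⟨hy.trans ht.1, ht.2.trans_lt hs⟩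
  have e : ∫ t in y..s, k t = pairL (indicatorConstLp 2 measurableSet_Ioc hmeas (1 : ℂ)) k := by
    rw [pairL_apply, intervalIntegral.integral_of_le hys]
    have h1 : ∫ x, k x * (indicatorConstLp 2 measurableSet_Ioc hmeas (1 : ℂ)) x ∂muI =
        ∫ x, (Ioc y s).indicator k x ∂muI := by
      refine integral_congr_ae ?_
      filter_upwards [indicatorConstLp_coeFn (μ := muI) (p := 2) (hs := measurableSet_Ioc)
        (hμs := hmeas) (c := (1 : ℂ))] with x hx
      rw [hx]
      by_cases hm : x ∈ Ioc y s <;> simp [hm]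
    have h2 : muI.restrict (Ioc y s) = volume.restrict (Ioc y s) := by
      rw [muI, Measure.restrict_restrict measurableSet_Ioc, inter_eq_left.mpr hsub]
    rw [h1, integral_indicator measurableSet_Ioc, h2]
  rw [e]
  refine (norm_pairL_le _ _).trans ?_
  gcongr
  rw [norm_indicatorConstLp (by norm_num) (by norm_num), norm_one, one_mul, measureReal_def, muI,
    Measure.restrict_apply measurableSet_Ioc, inter_eq_left.mpr hsub, Real.volume_Ioc,
    ENNReal.toReal_ofReal (by linarith), Real.sqrt_eq_rpow]
  norm_num
  exact Real.rpow_le_rpow (by linarith) (by linarith) (by norm_num)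

lemma norm_mul_sqrt_le_of_ae_le {f : HI} {s c : ℝ} (hs : s ∈ Ioo (0 : ℝ) 1) (hc : 0 ≤ c)
    (h : ∀ᵐ y ∂muI, y < s → c ≤ ‖f y‖) : √s * c ≤ ‖f‖ := by
  have hmeas : muI (Ioo 0 s) ≠ ⊤ := measure_ne_top _ _
  have h1 : ‖indicatorConstLp 2 measurableSet_Ioo hmeas (c : ℂ)‖ ≤ ‖f‖ := by
    refine Lp.norm_le_norm_of_ae_le ?_
    filter_upwards [h, indicatorConstLp_coeFn (μ := muI) (p := 2) (hs := measurableSet_Ioo)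
        (hμs := hmeas) (c := (c : ℂ))] with y hy hi
    rw [hi]
    by_cases hm : y ∈ Ioo 0 s
    · simpa [hm, abs_of_nonneg hc] using hy hm.2
    · simp [hm]
  refine le_trans (le_of_eq ?_) h1
  have hsub : Ioo 0 s ⊆ Ioo (0 : ℝ) 1 := fun t ht => ⟨ht.1, ht.2.trans hs.2⟩
  rw [norm_indicatorConstLp (by norm_num) (by norm_num), measureReal_def, muI,
    Measure.restrict_apply measurableSet_Ioo, inter_eq_left.mpr hsub, Real.volume_Ioo,
    ENNReal.toReal_ofReal (by linarith [hs.1]), Real.sqrt_eq_rpow]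
  simp [abs_of_nonneg hc, mul_comm]

/-- The one dimensional Sobolev embedding. -/
lemma EulerRel.ae_bound {a : ℝ} {f g : HI} (h : EulerRel a f g) :
    ∀ᵐ s ∂muI, √s * ‖f s‖ ≤ (2 + |a|) * ‖f‖ + ‖g‖ := by
  obtain ⟨r, hr, hp⟩ := h.exists_rep
  set E : HI := ((1 + a : ℝ) : ℂ) • f + g with hE
  have hEe : (fun s => (1 + a) * f s + g s) =ᵐ[muI] E := by
    filter_upwards [Lp.coeFn_add (((1 + a : ℝ) : ℂ) • f) g,
      Lp.coeFn_smul ((1 + a : ℝ) : ℂ) f] with s h1 h2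
    rw [hE, h1, Pi.add_apply, h2, Pi.smul_apply, smul_eq_mul]
    push_cast
    ring
  have hp' := hp.congr (fun _ _ => rfl) hEe
  have hEn : ‖E‖ ≤ (1 + |a|) * ‖f‖ + ‖g‖ := by
    refine (norm_add_le _ _).trans ?_
    rw [norm_smul]
    gcongr
    rw [Complex.norm_real, Real.norm_eq_abs]
    simpa using abs_add_le 1 a
  filter_upwards [hr, ae_mem_muI] with s hs hm
  rw [hs]
  have hsq : 0 < √s := Real.sqrt_pos.mpr hm.1
  have hss : √s * √s = s := Real.mul_self_sqrt hm.1.le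
  -- The increment of `s r(s)` over `(y, s)` is at most `√s ‖E‖`. Bounding `y` by `s` and dividing
  -- by `s` shows that `r` is not much smaller at any `y < s` than it is at `s`.
  have hbd : ∀ y ∈ Ioo (0 : ℝ) 1, y < s → ‖r s‖ - ‖E‖ / √s ≤ ‖r y‖ := by
    intro y hy hys
    have h1 := (hp' y hy s hm).2
    have h2 := norm_intervalIntegral_le E hy.1 hys.le hm.2
    rw [← h1] at h2
    have h3 := norm_sub_norm_le ((s : ℂ) * r s) (y * r y)
    rw [norm_mul, norm_mul, Complex.norm_real, Complex.norm_real, Real.norm_of_nonneg hm.1.le,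
      Real.norm_of_nonneg hy.1.le] at h3
    have h4 : y * ‖r y‖ ≤ s * ‖r y‖ := by gcongr
    have h5 : s * ‖r s‖ ≤ s * ‖r y‖ + √s * ‖E‖ := by linarith
    rw [sub_le_iff_le_add]
    have h6 : s * (‖r y‖ + ‖E‖ / √s) = s * ‖r y‖ + √s * ‖E‖ := by
      rw [mul_add, add_right_inj, mul_div_assoc', div_eq_iff hsq.ne']
      linear_combination -‖E‖ * hss
    exact le_of_mul_le_mul_left (by rw [h6]; exact h5) hm.1
  -- The lower bound holds on all of `(0, s)`, so its product with the square root of the length is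
  -- controlled by the `L²` norm; a negative bound is trivial.
  have hfin : √s * (‖r s‖ - ‖E‖ / √s) ≤ ‖f‖ := by
    rcases le_total (‖r s‖ - ‖E‖ / √s) 0 with hneg | hpos
    · exact (mul_nonpos_of_nonneg_of_nonpos hsq.le hneg).trans (norm_nonneg _)
    · refine norm_mul_sqrt_le_of_ae_le hm hpos ?_
      filter_upwards [hr, ae_mem_muI] with y hy hym hys
      rw [hy]
      exact hbd y hym hys
  rw [mul_sub, mul_div_cancel₀ _ hsq.ne'] at hfin
  linarith

/-! ### Products on the unit interval -/

open Classical in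
/-- The product `s^γ f g`, if it is square integrable. -/
def mulW (γ : ℝ) (f g : HI) : HI :=
  if h : MemLp (fun s => ((s ^ γ : ℝ) : ℂ) * (f s * g s)) 2 muI then h.toLp _ else 0

lemma mulW_comm (γ : ℝ) (f g : HI) : mulW γ f g = mulW γ g f := by
  have e : (fun s => ((s ^ γ : ℝ) : ℂ) * (f s * g s)) =
      fun s => ((s ^ γ : ℝ) : ℂ) * (g s * f s) := by
    funext s
    rw [mul_comm (f s)]
  unfold mulW
  by_cases h : MemLp (fun s => ((s ^ γ : ℝ) : ℂ) * (f s * g s)) 2 muI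
  · rw [dif_pos h, dif_pos (e ▸ h)]
    exact MemLp.toLp_congr _ _ (by rw [e])
  · rw [dif_neg h, dif_neg (e ▸ h)]

/-- On `(0, 1)` one has `s^γ ≤ √s`, so the weight absorbs the singularity `s^{-1/2}` that the
Sobolev bound permits in one factor. This is what the lower bound on `γ` is for. -/
lemma memLp_mulW {γ : ℝ} (hγ : 1 / 2 ≤ γ) {f g : HI} {S : ℝ}
    (hf : ∀ᵐ s ∂muI, √s * ‖f s‖ ≤ S) :
    MemLp (fun s => ((s ^ γ : ℝ) : ℂ) * (f s * g s)) 2 muI ∧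
    ∀ᵐ s ∂muI, ‖((s ^ γ : ℝ) : ℂ) * (f s * g s)‖ ≤ S * ‖g s‖ := by
  have hb : ∀ᵐ s ∂muI, ‖((s ^ γ : ℝ) : ℂ) * (f s * g s)‖ ≤ S * ‖g s‖ := by
    filter_upwards [hf, ae_mem_muI] with s hs hm
    rw [norm_mul, norm_mul, Complex.norm_real, Real.norm_of_nonneg (Real.rpow_nonneg hm.1.le _),
      ← mul_assoc]
    gcongr
    refine le_trans ?_ hs
    gcongr
    rw [Real.sqrt_eq_rpow]
    exact Real.rpow_le_rpow_of_exponent_ge hm.1 hm.2.le hγ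
  refine ⟨(Lp.memLp g).of_le_mul (c := S) ?_ hb, hb⟩
  have hc : AEStronglyMeasurable (fun s : ℝ => ((s ^ γ : ℝ) : ℂ)) muI :=
    (Complex.measurable_ofReal.comp
      (measurable_id.pow_const γ)).aestronglyMeasurable
  exact hc.mul ((Lp.aestronglyMeasurable f).mul (Lp.aestronglyMeasurable g))

lemma coeFn_mulW {γ : ℝ} (hγ : 1 / 2 ≤ γ) {f g : HI} {S : ℝ}
    (hf : ∀ᵐ s ∂muI, √s * ‖f s‖ ≤ S) :
    mulW γ f g =ᵐ[muI] fun s => ((s ^ γ : ℝ) : ℂ) * (f s * g s) := by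
  have h := (memLp_mulW hγ (g := g) hf).1
  unfold mulW
  rw [dif_pos h]
  exact h.coeFn_toLp

lemma norm_mulW_le {γ : ℝ} (hγ : 1 / 2 ≤ γ) {f g : HI} {S : ℝ}
    (hf : ∀ᵐ s ∂muI, √s * ‖f s‖ ≤ S) : ‖mulW γ f g‖ ≤ S * ‖g‖ := by
  refine Lp.norm_le_mul_norm_of_ae_le_mul (c := S) ?_
  filter_upwards [coeFn_mulW hγ (g := g) hf, (memLp_mulW hγ (g := g) hf).2] with s h1 h2
  rw [h1]
  exact h2

lemma coeFn_mulW' {γ : ℝ} (hγ : 1 / 2 ≤ γ) {f g : HI} {S : ℝ}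
    (hg : ∀ᵐ s ∂muI, √s * ‖g s‖ ≤ S) :
    mulW γ f g =ᵐ[muI] fun s => ((s ^ γ : ℝ) : ℂ) * (f s * g s) := by
  rw [mulW_comm]
  filter_upwards [coeFn_mulW hγ (g := f) hg] with s hs
  rw [hs, mul_comm (g s)]

/-- Write `s · s^γ f g = s^{γ-1} (s f) (s g)`, a product of three primitives. In the product rule
the coefficients of the factors add up and the weight contributes `γ`. -/
lemma EulerRel.mul {a b γ : ℝ} (hγ : 1 / 2 ≤ γ) {f f' g g' : HI} (h : EulerRel a f f')
    (h' : EulerRel b g g') :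
    EulerRel (a + b + γ) (mulW γ f g) (mulW γ f' g + mulW γ f g') := by
  obtain ⟨r, hr, hp⟩ := h.exists_rep
  obtain ⟨q, hq, hp'⟩ := h'.exists_rep
  have hmul := (IsPrim.rpow (γ - 1)).mul (hp.mul hp')
  have hrpow : ∀ s ∈ Ioo (0 : ℝ) 1, ((s ^ (γ - 1) : ℝ) : ℂ) * s = ((s ^ γ : ℝ) : ℂ) := by
    intro s hs
    rw [← Complex.ofReal_mul, ← Real.rpow_add_one hs.1.ne']
    simp
  have hrpow2 : ∀ s ∈ Ioo (0 : ℝ) 1, ((s ^ (γ - 1 - 1) : ℝ) : ℂ) * s = ((s ^ (γ - 1) : ℝ) : ℂ) := by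
    intro s hs
    rw [← Complex.ofReal_mul, ← Real.rpow_add_one hs.1.ne']
    simp
  refine EulerRel.of_isPrim (r := fun s => ((s ^ γ : ℝ) : ℂ) * (r s * q s)) ?_
    (hmul.congr (f' := fun s => s * (((s ^ γ : ℝ) : ℂ) * (r s * q s))) ?_ (by rfl)) ?_
  · filter_upwards [coeFn_mulW hγ (g := g) h.ae_bound, hr, hq] with s h1 h2 h3
    rw [h1, h2, h3]
  · intro s hs
    rw [← hrpow s hs]
    ring
  · filter_upwards [coeFn_mulW hγ (g := g) h.ae_bound, hr, hq, ae_mem_muI,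
      Lp.coeFn_add (mulW γ f' g) (mulW γ f g'), coeFn_mulW hγ (g := g') h.ae_bound,
      coeFn_mulW' hγ (f := f') h'.ae_bound] with s h1 h2 h3 hm h4 h5 h6
    rw [h4, Pi.add_apply, h1, h5, h6, ← hrpow s hm, h2, h3]
    push_cast
    rw [← hrpow2 s hm]
    ring

/-- The weighted derivatives of a product. -/
def leibW (γ : ℝ) (F G : ℕ → HI) (p : ℕ) : HI :=
  ∑ i ∈ Finset.HasAntidiagonal.antidiagonal p, p.choose i.1 • mulW γ (F i.1) (G i.2)

/-- Pascal's rule for the Leibniz sum. All summands obey a relation with the same coefficient, as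
`(i - γ) + (j - γ) + γ = p - γ` when `i + j = p`. -/
lemma eulerRel_leibW {γ : ℝ} (hγ : 1 / 2 ≤ γ) {n : ℕ} {F G : ℕ → HI}
    (hF : ∀ p < n, EulerRel (p - γ) (F p) (F (p + 1)))
    (hG : ∀ p < n, EulerRel (p - γ) (G p) (G (p + 1))) {p : ℕ} (hp : p < n) :
    EulerRel (p - γ) (leibW γ F G p) (leibW γ F G (p + 1)) := by
  have e : leibW γ F G (p + 1) = ∑ i ∈ Finset.HasAntidiagonal.antidiagonal p,
      p.choose i.1 • (mulW γ (F (i.1 + 1)) (G i.2) + mulW γ (F i.1) (G (i.2 + 1))) := by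
    unfold leibW
    rw [Finset.sum_antidiagonal_choose_succ_nsmul (fun r d => mulW γ (F r) (G d)) p, add_comm,
      ← Finset.sum_add_distrib]
    refine Finset.sum_congr rfl fun i hi => ?_
    have hi' := Finset.HasAntidiagonal.mem_antidiagonal.mp hi
    rw [smul_add, Nat.choose_symm_of_eq_add (by omega : p = i.1 + i.2)]
  rw [e]
  refine EulerRel.sum _ fun i hi => ?_
  have hi' := Finset.HasAntidiagonal.mem_antidiagonal.mp hi
  have h := (hF i.1 (by omega)).mul hγ (hG i.2 (by omega))
  have e2 : ((i.1 : ℝ) - γ) + ((i.2 : ℝ) - γ) + γ = (p : ℝ) - γ := by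
    rw [← hi']; push_cast; ring
  rw [e2] at h
  exact h.nsmul _

end

noncomputable section

/-! ### Fourier series on `Π` -/

open scoped ENNReal

lemma sqrt_two_pi_pos : 0 < √(2 * Real.pi) := Real.sqrt_pos.mpr (by positivity)

/-- The function `(2π)^{-1/2} e^{ikθ} f(ψ)`. -/
def modeFun (k : ℤ) (f : ℝ → ℂ) (x : ℝ × ℝ) : ℂ :=
  f x.1 * (((√(2 * Real.pi))⁻¹ : ℝ) * Complex.exp (Complex.I * k * x.2))

lemma memLp_modeFun (k : ℤ) (f : HI) : MemLp (modeFun k f) 2 muPi := by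
  have hm : AEStronglyMeasurable (fun x : ℝ × ℝ => f x.1) muPi :=
    (Lp.aestronglyMeasurable f).comp_fst
  have hm2 : AEStronglyMeasurable (modeFun k f) muPi :=
    hm.mul (by fun_prop : Continuous fun x : ℝ × ℝ => (((√(2 * Real.pi))⁻¹ : ℝ) : ℂ) *
      Complex.exp (Complex.I * k * x.2)).aestronglyMeasurable
  rw [memLp_two_iff_integrable_sq_norm hm2]
  have h1 : Integrable (fun s => ‖f s‖ ^ 2) muI :=
    (memLp_two_iff_integrable_sq_norm (Lp.aestronglyMeasurable f)).mp (Lp.memLp f)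
  have h2 := h1.mul_prod (integrable_const (((√(2 * Real.pi))⁻¹) ^ 2) : Integrable _ muT)
  refine h2.congr (Filter.Eventually.of_forall fun x => ?_)
  simp only [modeFun, norm_mul, norm_exp_I_mul, mul_one, mul_pow, Complex.norm_real,
    Real.norm_eq_abs, sq_abs]

lemma modeFun_congr {k : ℤ} {f g : ℝ → ℂ} (h : f =ᵐ[muI] g) :
    modeFun k f =ᵐ[muPi] modeFun k g := by
  have : ∀ᵐ x ∂muPi, f x.1 = g x.1 := Measure.quasiMeasurePreserving_fst.ae h
  filter_upwards [this] with x hx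
  simp only [modeFun, hx]

/-- The map `f ↦ (2π)^{-1/2} e^{ikθ} f(ψ)` of `L²(0, 1)` to `L²(Π)`. -/
def modeLin (k : ℤ) : HI →ₗ[ℂ] Lp ℂ 2 muPi where
  toFun f := (memLp_modeFun k f).toLp _
  map_add' f g := by
    refine Lp.ext ?_
    filter_upwards [(memLp_modeFun k (f + g)).coeFn_toLp, (memLp_modeFun k f).coeFn_toLp,
      (memLp_modeFun k g).coeFn_toLp, modeFun_congr (k := k) (Lp.coeFn_add f g),
      Lp.coeFn_add ((memLp_modeFun k f).toLp _) ((memLp_modeFun k g).toLp _)] with x h1 h2 h3 h4 h5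
    rw [h1, h4, h5, Pi.add_apply, h2, h3]
    simp only [modeFun, Pi.add_apply, add_mul]
  map_smul' c f := by
    refine Lp.ext ?_
    filter_upwards [(memLp_modeFun k (c • f)).coeFn_toLp, (memLp_modeFun k f).coeFn_toLp,
      modeFun_congr (k := k) (Lp.coeFn_smul c f),
      Lp.coeFn_smul c ((memLp_modeFun k f).toLp _)] with x h1 h2 h3 h4
    rw [h1, h3, RingHom.id_apply, h4, Pi.smul_apply, h2]
    simp only [modeFun, Pi.smul_apply, smul_eq_mul, mul_assoc]

lemma coeFn_modeLin (k : ℤ) (f : HI) : modeLin k f =ᵐ[muPi] modeFun k f :=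
  (memLp_modeFun k f).coeFn_toLp

lemma integral_exp_mul_exp (j k : ℤ) :
    ∫ t : ℝ, Complex.exp (-(Complex.I * k * t)) * Complex.exp (Complex.I * j * t) ∂muT =
      if k = j then 2 * (Real.pi : ℂ) else 0 := by
  have h := fcoef_exp j k
  unfold fcoef at h
  have hpi : (Real.pi : ℂ) ≠ 0 := by exact_mod_cast Real.pi_ne_zero
  have h2 : (2 * (Real.pi : ℂ)) ≠ 0 := by simp [hpi]
  rw [one_div, inv_mul_eq_iff_eq_mul₀ h2] at h
  rw [h]
  split_ifs <;> simp

lemma ofReal_sqrt_two_pi_sq : ((√(2 * Real.pi) : ℝ) : ℂ) * ((√(2 * Real.pi) : ℝ) : ℂ) =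
    2 * (Real.pi : ℂ) := by
  rw [← Complex.ofReal_mul, Real.mul_self_sqrt (by positivity)]
  push_cast
  ring

lemma conj_exp_I_mul (k : ℤ) (t : ℝ) :
    (starRingEnd ℂ) (Complex.exp (Complex.I * k * t)) = Complex.exp (-(Complex.I * k * t)) := by
  rw [← Complex.exp_conj]
  simp

lemma inner_modeLin (j k : ℤ) (f g : HI) :
    inner ℂ (modeLin j f) (modeLin k g) = if j = k then inner ℂ f g else 0 := by
  rw [L2.inner_def]
  have e : ∫ x, inner ℂ (modeLin j f x) (modeLin k g x) ∂muPi =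
      ∫ x, (inner ℂ (f x.1) (g x.1)) * ((((√(2 * Real.pi))⁻¹ : ℝ) : ℂ) ^ 2 *
        (Complex.exp (-(Complex.I * j * x.2)) * Complex.exp (Complex.I * k * x.2))) ∂muPi := by
    refine integral_congr_ae ?_
    filter_upwards [coeFn_modeLin j f, coeFn_modeLin k g] with x h1 h2
    rw [h1, h2]
    simp only [modeFun, RCLike.inner_apply, map_mul, conj_exp_I_mul, Complex.conj_ofReal]
    ring
  rw [e]
  unfold muPi
  rw [integral_prod_mul (fun s => inner ℂ (f s) (g s)) (fun t : ℝ =>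
    (((√(2 * Real.pi))⁻¹ : ℝ) : ℂ) ^ 2 *
        (Complex.exp (-(Complex.I * j * t)) * Complex.exp (Complex.I * k * t))),
    integral_const_mul, integral_exp_mul_exp, ← L2.inner_def]
  split_ifs with h
  · have h3 : ((√(2 * Real.pi) : ℝ) : ℂ) ≠ 0 := by exact_mod_cast sqrt_two_pi_pos.ne'
    rw [← ofReal_sqrt_two_pi_sq]
    push_cast
    field_simp
  · simp

/-- The isometry `f ↦ (2π)^{-1/2} e^{ikθ} f(ψ)`. -/
def modeL (k : ℤ) : HI →ₗᵢ[ℂ] Lp ℂ 2 muPi :=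
  (modeLin k).isometryOfInner fun f g => by rw [inner_modeLin, if_pos rfl]

lemma coeFn_modeL (k : ℤ) (f : HI) : modeL k f =ᵐ[muPi] modeFun k f := coeFn_modeLin k f

/-- The normalized Fourier coefficient of index `k` in the angle. -/
def cf (k : ℤ) : Lp ℂ 2 muPi →L[ℂ] HI :=
  ContinuousLinearMap.adjoint (modeL k).toContinuousLinearMap

lemma inner_cf (k : ℤ) (f : HI) (U : Lp ℂ 2 muPi) :
    inner ℂ f (cf k U) = inner ℂ (modeL k f) U := by
  unfold cf
  rw [ContinuousLinearMap.adjoint_inner_right]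
  rfl

lemma orthogonalFamily_modeL : OrthogonalFamily ℂ (fun _ : ℤ => HI) modeL := by
  intro j k hjk f g
  have := inner_modeLin j k f g
  rw [if_neg hjk] at this
  exact this

lemma memLp_conj {f : ℝ → ℂ} (hf : MemLp f 2 muI) :
    MemLp (fun s => (starRingEnd ℂ) (f s)) 2 muI := hf.star

lemma integrable_exp_mul_muPi {U : ℝ × ℝ → ℂ} (hU : Integrable U muPi) (k : ℤ) :
    Integrable (fun x : ℝ × ℝ => Complex.exp (-(Complex.I * k * x.2)) * U x) muPi := by
  refine hU.bdd_mul (c := 1) ?_ ?_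
  · exact (by fun_prop : Continuous fun x : ℝ × ℝ =>
      Complex.exp (-(Complex.I * k * x.2))).aestronglyMeasurable
  · exact Filter.Eventually.of_forall fun x => (norm_exp_neg_I_mul k x.2).le

lemma integrable_fcoef {U : ℝ × ℝ → ℂ} (hU : Integrable U muPi) (k : ℤ) :
    Integrable (fun s => fcoef (fun t => U (s, t)) k) muI :=
  (integrable_exp_mul_muPi hU k).integral_prod_left.const_mul _

/-- As an adjoint `cf k` is bounded by construction; pairing with `η` and Fubini identify it with
the coefficient on almost every circle. The factor `√(2π)` comes from the normalisation of `modeL`.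
-/
lemma coeFn_cf (k : ℤ) (U : Lp ℂ 2 muPi) :
    cf k U =ᵐ[muI] fun s => (√(2 * Real.pi) : ℝ) * fcoef (fun t => U (s, t)) k := by
  have hF := (integrable_fcoef (Lp_integrable_muPi U) k).const_mul ((√(2 * Real.pi) : ℝ) : ℂ)
  have h0 : (fun s => cf k U s - (√(2 * Real.pi) : ℝ) * fcoef (fun t => U (s, t)) k)
      =ᵐ[muI] 0 := by
    refine ae_eq_zero_of_test
      (IntegrableOn.locallyIntegrableOn ((HI.integrable _).sub hF)) fun η hη => ?_
    obtain ⟨C, hC⟩ := hη.compact.exists_bound_of_continuous hη.smooth.continuous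
    have hbd : ∀ g : ℝ → ℂ, Integrable g muI → Integrable (fun s => g s * η s) muI := fun g hg =>
      hg.mul_bdd (c := C) hη.smooth.continuous.aestronglyMeasurable
        (Filter.Eventually.of_forall hC)
    have hη' := memLp_conj hη.memLp
    have h1 := inner_cf k (hη'.toLp _) U
    rw [L2.inner_def, L2.inner_def] at h1
    have e1 : ∫ s, inner ℂ (hη'.toLp _ s) (cf k U s) ∂muI = ∫ s, cf k U s * η s ∂muI := by
      refine integral_congr_ae ?_
      filter_upwards [hη'.coeFn_toLp] with s hs
      rw [hs]
      simp
    have e2 : ∫ x, inner ℂ (modeL k (hη'.toLp _) x) (U x) ∂muPi =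
        ∫ x, (((√(2 * Real.pi))⁻¹ : ℝ) : ℂ) * (η x.1 *
          (Complex.exp (-(Complex.I * k * x.2)) * U x)) ∂muPi := by
      refine integral_congr_ae ?_
      filter_upwards [coeFn_modeL k (hη'.toLp _), modeFun_congr (k := k) hη'.coeFn_toLp]
        with x h1 h2
      rw [h1, h2]
      simp only [modeFun, RCLike.inner_apply, map_mul, conj_exp_I_mul, Complex.conj_ofReal,
        Complex.conj_conj]
      ring
    have i2 : Integrable (fun x : ℝ × ℝ => (((√(2 * Real.pi))⁻¹ : ℝ) : ℂ) * (η x.1 *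
          (Complex.exp (-(Complex.I * k * x.2)) * U x))) muPi := by
      refine Integrable.const_mul ?_ _
      refine (integrable_exp_mul_muPi (Lp_integrable_muPi U) k).bdd_mul (c := C)
        (hη.smooth.continuous.comp continuous_fst).aestronglyMeasurable
        (Filter.Eventually.of_forall fun x => hC x.1)
    rw [e1, e2] at h1
    have h5 := h1.trans (integral_prod (μ := muI) (ν := muT) _ i2)
    have e3 : ∫ s, (cf k U s - (√(2 * Real.pi) : ℝ) * fcoef (fun t => U (s, t)) k) * η s ∂muI =
        (∫ s, cf k U s * η s ∂muI) -
          ∫ s, (√(2 * Real.pi) : ℝ) * fcoef (fun t => U (s, t)) k * η s ∂muI := by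
      rw [← integral_sub (hbd _ (HI.integrable _)) (hbd _ hF)]
      simp only [sub_mul]
    rw [e3, h5, sub_eq_zero]
    congr 1
    funext s
    rw [integral_const_mul]
    dsimp only
    rw [integral_const_mul]
    unfold fcoef
    have h3 : ((√(2 * Real.pi) : ℝ) : ℂ) ≠ 0 := by exact_mod_cast sqrt_two_pi_pos.ne'
    rw [← ofReal_sqrt_two_pi_sq]
    push_cast
    field_simp
  filter_upwards [h0] with s hs
  exact sub_eq_zero.mp hs

/-- An element orthogonal to all modes has vanishing Fourier coefficients on almost every circle,
hence is zero; so the modes span a dense subspace. -/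
lemma isHilbertSum_modeL : IsHilbertSum ℂ (fun _ : ℤ => HI) modeL := by
  refine IsHilbertSum.mk orthogonalFamily_modeL ?_
  rw [top_le_iff, Submodule.topologicalClosure_eq_top_iff, Submodule.eq_bot_iff]
  intro U hU
  have hz : ∀ k, cf k U = 0 := by
    intro k
    refine ext_inner_left ℂ fun f => ?_
    rw [inner_cf, inner_zero_right]
    exact hU _ (Submodule.mem_iSup_of_mem k (LinearMap.mem_range_self _ f))
  rw [Lp.eq_zero_iff_ae_eq_zero]
  refine ae_eq_zero_of_slices (Lp.memLp U) fun k => ?_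
  have h1 := coeFn_cf k U
  rw [hz k] at h1
  filter_upwards [h1, Lp.coeFn_zero ℂ 2 muI] with s hs h0
  rw [h0] at hs
  have h3 : ((√(2 * Real.pi) : ℝ) : ℂ) ≠ 0 := by exact_mod_cast sqrt_two_pi_pos.ne'
  exact (mul_eq_zero.mp hs.symm).resolve_left h3

lemma linearIsometryEquiv_modeL_apply (U : Lp ℂ 2 muPi) (k : ℤ) :
    isHilbertSum_modeL.linearIsometryEquiv U k = cf k U := by
  classical
  refine ext_inner_left ℂ fun f => ?_
  have h1 := lp.inner_single_left (𝕜 := ℂ) k f (isHilbertSum_modeL.linearIsometryEquiv U)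
  have h2 := LinearIsometryEquiv.inner_map_map isHilbertSum_modeL.linearIsometryEquiv
    (modeL k f) U
  rw [← isHilbertSum_modeL.linearIsometryEquiv_symm_apply_single,
    LinearIsometryEquiv.apply_symm_apply] at h2
  rw [isHilbertSum_modeL.linearIsometryEquiv_symm_apply_single] at h2
  exact h1.symm.trans (h2.trans (inner_cf k f U).symm)

lemma hasSum_modeL (U : Lp ℂ 2 muPi) : HasSum (fun k => modeL k (cf k U)) U := by
  have h := isHilbertSum_modeL.hasSum_linearIsometryEquiv_symm
    (isHilbertSum_modeL.linearIsometryEquiv U)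
  simpa only [LinearIsometryEquiv.symm_apply_apply, linearIsometryEquiv_modeL_apply] using h

lemma ext_cf {U W : Lp ℂ 2 muPi} (h : ∀ k, cf k U = cf k W) : U = W :=
  (hasSum_modeL U).unique (by simpa only [h] using hasSum_modeL W)

/-- Parseval's identity, in extended norms so that estimates of sums need no summability conditions.
-/
lemma tsum_enorm_cf_sq (U : Lp ℂ 2 muPi) : ∑' k, ‖cf k U‖ₑ ^ 2 = ‖U‖ₑ ^ 2 := by
  have h := lp.hasSum_norm (p := 2) (by norm_num) (isHilbertSum_modeL.linearIsometryEquiv U)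
  simp only [linearIsometryEquiv_modeL_apply, LinearIsometryEquiv.norm_map] at h
  norm_num at h
  have e : ∀ x : ℝ, 0 ≤ x → ENNReal.ofReal x ^ 2 = ENNReal.ofReal (x ^ 2) := fun x hx =>
    (ENNReal.ofReal_pow hx 2).symm
  simp only [← ofReal_norm, e _ (norm_nonneg _)]
  rw [← ENNReal.ofReal_tsum_of_nonneg (fun _ => by positivity) h.summable, h.tsum_eq]

lemma exists_of_cf {g : ℤ → HI} (hg : ∑' k, ‖g k‖ₑ ^ 2 ≠ ⊤) :
    ∃ U : Lp ℂ 2 muPi, ∀ k, cf k U = g k := by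
  have hs : Summable fun k => ‖g k‖ ^ 2 := by
    have := ENNReal.summable_toReal hg
    simpa [ENNReal.toReal_pow] using this
  have hm : Memℓp g 2 := memℓp_gen (by simpa using hs)
  refine ⟨isHilbertSum_modeL.linearIsometryEquiv.symm ⟨g, hm⟩, fun k => ?_⟩
  rw [← linearIsometryEquiv_modeL_apply, LinearIsometryEquiv.apply_symm_apply]

end

noncomputable section

/-! ### Weak derivatives and Fourier coefficients -/

/-- The function `s^{c - p} g` is the weak derivative of order `p` of `s^c f` on `(0, 1)`. -/
def Weak1 (c : ℝ) (p : ℕ) (f g : HI) : Prop :=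
  ∀ η, IsTest1 η → ∫ s, ((s ^ c : ℝ) : ℂ) * f s * iteratedDeriv p η s ∂muI =
    (-1) ^ p * ∫ s, ((s ^ (c - p) : ℝ) : ℂ) * g s * η s ∂muI

lemma IsTest1.rpow_mul {η : ℝ → ℂ} (h : IsTest1 η) (c : ℝ) :
    IsTest1 fun s => ((s ^ c : ℝ) : ℂ) * η s := by
  obtain ⟨δ, hδ, hz⟩ := h.exists_Icc
  refine IsTest1.of_Icc ?_ hδ.1 fun s hs => by rw [hz s hs, mul_zero]
  rw [contDiff_iff_contDiffAt]
  intro s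
  by_cases hs : s ∈ Icc δ (1 - δ)
  · have h0 : s ≠ 0 := (hδ.1.trans_le hs.1).ne'
    exact (Complex.ofRealCLM.contDiff.contDiffAt.comp s
      (Real.contDiffAt_rpow_const_of_ne h0)).mul h.smooth.contDiffAt
  · refine (contDiffAt_const (c := (0 : ℂ))).congr_of_eventuallyEq ?_
    filter_upwards [isClosed_Icc.isOpen_compl.mem_nhds hs] with t ht
    rw [hz t ht, mul_zero]

lemma IsTest1.iteratedDeriv {η : ℝ → ℂ} (h : IsTest1 η) (p : ℕ) : IsTest1 (iteratedDeriv p η) := by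
  induction p with
  | zero => simpa using h
  | succ p ih => rw [iteratedDeriv_succ]; exact ih.deriv

lemma integrable_rpow_mul_test {η : ℝ → ℂ} (h : IsTest1 η) (c : ℝ) (f : HI) :
    Integrable (fun s => ((s ^ c : ℝ) : ℂ) * f s * η s) muI := by
  refine ((Lp.memLp f).integrable_mul (h.rpow_mul c).memLp).congr
    (Filter.Eventually.of_forall fun s => ?_)
  simp only [Pi.mul_apply]
  ring

lemma ae_eq_zero_of_rpow_test {c : ℝ} {g : HI}
    (h : ∀ η, IsTest1 η → ∫ s, ((s ^ c : ℝ) : ℂ) * g s * η s ∂muI = 0) : g = 0 := by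
  rw [Lp.eq_zero_iff_ae_eq_zero]
  refine ae_eq_zero_of_test (IntegrableOn.locallyIntegrableOn (HI.integrable _)) fun η hη => ?_
  rw [← h _ (hη.rpow_mul (-c))]
  refine integral_congr_ae ?_
  filter_upwards [ae_mem_muI] with s hs
  have : ((s ^ c : ℝ) : ℂ) * ((s ^ (-c) : ℝ) : ℂ) = 1 := by
    rw [← Complex.ofReal_mul, ← Real.rpow_add hs.1, add_neg_cancel, Real.rpow_zero,
      Complex.ofReal_one]
  linear_combination -(g s * η s) * this

lemma Weak1.unique {c : ℝ} {p : ℕ} {f g g' : HI} (h : Weak1 c p f g) (h' : Weak1 c p f g') :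
    g = g' := by
  rw [← sub_eq_zero]
  refine ae_eq_zero_of_rpow_test (c := c - p) fun η hη => ?_
  have h1 : ∫ s, ((s ^ (c - p) : ℝ) : ℂ) * (g - g' : HI) s * η s ∂muI =
      (∫ s, ((s ^ (c - p) : ℝ) : ℂ) * g s * η s ∂muI) -
        ∫ s, ((s ^ (c - p) : ℝ) : ℂ) * g' s * η s ∂muI := by
    rw [← integral_sub (integrable_rpow_mul_test hη _ _) (integrable_rpow_mul_test hη _ _)]
    refine integral_congr_ae ?_
    filter_upwards [Lp.coeFn_sub g g'] with s hs
    rw [hs, Pi.sub_apply]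
    ring
  have h2 := (h η hη).symm.trans (h' η hη)
  rw [h1, mul_left_cancel₀ (by simp) h2, sub_self]

lemma Weak1.smul {c : ℝ} {p : ℕ} {f g : HI} (h : Weak1 c p f g) (a : ℂ) :
    Weak1 c p (a • f) (a • g) := by
  intro η hη
  have e : ∀ (d : ℝ) (k : HI) (ζ : ℝ → ℂ), ∫ s, ((s ^ d : ℝ) : ℂ) * (a • k : HI) s * ζ s ∂muI =
      a * ∫ s, ((s ^ d : ℝ) : ℂ) * k s * ζ s ∂muI := by
    intro d k ζ
    rw [← integral_const_mul]
    refine integral_congr_ae ?_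
    filter_upwards [Lp.coeFn_smul a k] with s hs
    rw [hs, Pi.smul_apply, smul_eq_mul]
    ring
  rw [e, e, h η hη]
  ring

lemma deriv_rpow_mul {η : ℝ → ℂ} (h : IsTest1 η) (c : ℝ) {s : ℝ} (hs : 0 < s) :
    (s : ℂ) * deriv (fun s => ((s ^ c : ℝ) : ℂ) * η s) s =
      c * (((s ^ c : ℝ) : ℂ) * η s) + ((s ^ (c + 1) : ℝ) : ℂ) * deriv η s := by
  have h1 : HasDerivAt (fun s : ℝ => ((s ^ c : ℝ) : ℂ)) ((c * s ^ (c - 1) : ℝ) : ℂ) s :=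
    (Real.hasDerivAt_rpow_const (Or.inl hs.ne')).ofReal_comp
  have h2 : HasDerivAt η (deriv η s) s :=
    (h.smooth.differentiable (by simp)).differentiableAt.hasDerivAt
  have h4 := (h1.mul h2).deriv
  rw [show ((fun s : ℝ => ((s ^ c : ℝ) : ℂ)) * η) = fun s => ((s ^ c : ℝ) : ℂ) * η s from rfl] at h4
  rw [h4, Real.rpow_add_one hs.ne', Real.rpow_sub_one hs.ne']
  have h3 : (s : ℂ) ≠ 0 := by exact_mod_cast hs.ne'
  push_cast
  field_simp

/-- Formally `(s^c f)' = s^{c-1} (c f + s f')`, which is `s^{c-1} g` exactly when `s f' = -c f + g`.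
Weakly one substitutes `s^{c-1} η` for `η`, a bijection of the test functions because their supports
avoid `0`. -/
lemma eulerRel_iff_weak (c : ℝ) (f g : HI) : EulerRel (-c) f g ↔ ∀ η, IsTest1 η →
    ∫ s, ((s ^ c : ℝ) : ℂ) * f s * deriv η s ∂muI =
      -∫ s, ((s ^ (c - 1) : ℝ) : ℂ) * g s * η s ∂muI := by
  have key : ∀ η, IsTest1 η →
      (∫ s, f s * (s * deriv (fun s => ((s ^ (c - 1) : ℝ) : ℂ) * η s) s) ∂muI =
        -∫ s, ((1 + (-c : ℝ)) * f s + g s) * (((s ^ (c - 1) : ℝ) : ℂ) * η s) ∂muI ↔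
      ∫ s, ((s ^ c : ℝ) : ℂ) * f s * deriv η s ∂muI =
        -∫ s, ((s ^ (c - 1) : ℝ) : ℂ) * g s * η s ∂muI) := by
    intro η hη
    have i1 := (integrable_rpow_mul_test hη (c - 1) f)
    have i2 := (integrable_rpow_mul_test hη (c - 1) g)
    have i3 := (integrable_rpow_mul_test hη.deriv c f)
    have e1 : ∫ s, f s * (s * deriv (fun s => ((s ^ (c - 1) : ℝ) : ℂ) * η s) s) ∂muI =
        ((c - 1 : ℝ) : ℂ) * (∫ s, ((s ^ (c - 1) : ℝ) : ℂ) * f s * η s ∂muI) +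
          ∫ s, ((s ^ c : ℝ) : ℂ) * f s * deriv η s ∂muI := by
      rw [← integral_const_mul, ← integral_add (i1.const_mul _) i3]
      refine integral_congr_ae ?_
      filter_upwards [ae_mem_muI] with s hs
      rw [deriv_rpow_mul hη (c - 1) hs.1, sub_add_cancel]
      ring
    have e2 : ∫ s, ((1 + (-c : ℝ)) * f s + g s) * (((s ^ (c - 1) : ℝ) : ℂ) * η s) ∂muI =
        (1 + (-c : ℝ)) * (∫ s, ((s ^ (c - 1) : ℝ) : ℂ) * f s * η s ∂muI) +
          ∫ s, ((s ^ (c - 1) : ℝ) : ℂ) * g s * η s ∂muI := by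
      rw [← integral_const_mul, ← integral_add (i1.const_mul _) i2]
      congr 1
      funext s
      ring
    rw [e1, e2]
    push_cast
    constructor <;> intro h <;> linear_combination h
  constructor
  · exact fun h η hη => (key η hη).mp (h _ (hη.rpow_mul _))
  · intro h η hη
    have h1 := (key _ (hη.rpow_mul (1 - c))).mpr (h _ (hη.rpow_mul (1 - c)))
    have hcancel : ∀ s ∈ Ioo (0 : ℝ) 1, ((s ^ (c - 1) : ℝ) : ℂ) * (((s ^ (1 - c) : ℝ) : ℂ) * η s) =
        η s := by
      intro s hs
      rw [← mul_assoc, ← Complex.ofReal_mul, ← Real.rpow_add hs.1]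
      simp
    have e1 : ∫ s, f s * (s * deriv (fun s => ((s ^ (c - 1) : ℝ) : ℂ) *
        (((s ^ (1 - c) : ℝ) : ℂ) * η s)) s) ∂muI = ∫ s, f s * (s * deriv η s) ∂muI := by
      refine integral_congr_ae ?_
      filter_upwards [ae_mem_muI] with s hs
      congr 2
      refine Filter.EventuallyEq.deriv_eq ?_
      filter_upwards [Ioo_mem_nhds hs.1 hs.2] with t ht using hcancel t ht
    rw [e1] at h1
    rw [h1]
    congr 1
    refine integral_congr_ae ?_
    filter_upwards [ae_mem_muI] with s hs
    rw [hcancel s hs]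

/-- Each relation with coefficient `p - γ` says that the derivative of `s^{γ-p} F p` is `s^{γ-p-1} F
(p + 1)`; these first-order statements compose. -/
lemma weak1_of_eulerRel {γ : ℝ} {n : ℕ} {F : ℕ → HI}
    (hF : ∀ p < n, EulerRel (p - γ) (F p) (F (p + 1))) {p : ℕ} (hp : p ≤ n) :
    Weak1 γ p (F 0) (F p) := by
  induction p with
  | zero => intro η _; simp
  | succ p ih =>
    intro η hη
    have h1 := ih (by omega) _ hη.deriv
    have h2 := hF p (by omega)
    rw [← neg_sub, eulerRel_iff_weak] at h2
    rw [← iteratedDeriv_succ', h2 η hη] at h1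
    rw [h1]
    push_cast
    rw [sub_sub]
    ring

/-- Testing the identity of order `p` with `deriv η` and comparing it with the one of order `p + 1`
isolates a single derivative. -/
lemma eulerRel_of_weak1 {γ : ℝ} {p : ℕ} {f g h : HI} (h1 : Weak1 γ p f g)
    (h2 : Weak1 γ (p + 1) f h) : EulerRel (p - γ) g h := by
  rw [← neg_sub, eulerRel_iff_weak]
  intro η hη
  have e1 := h1 _ hη.deriv
  have e2 := h2 η hη
  rw [← iteratedDeriv_succ', e2] at e1
  push_cast at e1
  rw [← sub_sub] at e1
  have h0 : ((-1 : ℂ)) ^ p ≠ 0 := by simp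
  refine mul_left_cancel₀ h0 ?_
  rw [← e1]
  ring

/-! ### Test functions on `Π` -/

lemma locInt_wmul (c : ℝ) {U : ℝ × ℝ → ℂ} (hU : Integrable U muPi) : LocInt (wmul c U) := by
  intro δ hδ
  have hm : MeasurableSet (Icc δ (1 - δ) ×ˢ (univ : Set ℝ)) :=
    measurableSet_Icc.prod MeasurableSet.univ
  have hc : ContinuousOn (fun s : ℝ => ((s ^ c : ℝ) : ℂ)) (Icc δ (1 - δ)) :=
    Complex.continuous_ofReal.comp_continuousOn fun s hs =>
      (Real.continuousAt_rpow_const s c (Or.inl (hδ.trans_le hs.1).ne')).continuousWithinAt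
  obtain ⟨C, hC⟩ := isCompact_Icc.exists_bound_of_continuousOn hc
  refine hU.integrableOn.bdd_mul (c := C) ?_ ?_
  · exact (Complex.measurable_ofReal.comp
      (measurable_fst.pow_const c)).aestronglyMeasurable
  · filter_upwards [ae_restrict_mem hm] with x hx using hC x.1 hx.1

lemma isTest_mode {η : ℝ → ℂ} (h : IsTest1 η) (k : ℤ) (a : ℂ) :
    IsTest fun x => a * (η x.1 * Complex.exp (-(Complex.I * k * x.2))) := by
  obtain ⟨δ, hδ, hz⟩ := h.exists_Icc
  refine ⟨?_, ?_, δ, hδ.1, fun s t hst => ?_⟩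
  · have h2 : ContDiff ℝ ∞ fun x : ℝ × ℝ => (x.2 : ℂ) :=
      Complex.ofRealCLM.contDiff.comp contDiff_snd
    exact contDiff_const.mul
      ((h.smooth.comp contDiff_fst).mul ((contDiff_const.mul h2).neg.cexp))
  · intro s t
    dsimp only
    congr 2
    rw [Complex.exp_eq_exp_iff_exists_int]
    exact ⟨-k, by push_cast; ring⟩
  · by_contra hn
    exact hst (by simp [hz s hn])

lemma dTheta_mode (η : ℝ → ℂ) (k : ℤ) (a : ℂ) :
    dTheta (fun x => a * (η x.1 * Complex.exp (-(Complex.I * k * x.2)))) =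
      fun x => (a * -(Complex.I * k)) * (η x.1 * Complex.exp (-(Complex.I * k * x.2))) := by
  funext x
  have h1 : HasDerivAt (fun t : ℝ => -(Complex.I * k * (t : ℂ))) (-(Complex.I * k)) x.2 := by
    have := ((hasDerivAt_id x.2).ofReal_comp.const_mul (Complex.I * k)).neg
    rw [Complex.ofReal_one, mul_one] at this
    exact this
  have h2 := ((h1.cexp).const_mul (η x.1)).const_mul a
  unfold dTheta
  rw [h2.deriv]
  ring

lemma dPsi_mode {η : ℝ → ℂ} (h : IsTest1 η) (k : ℤ) (a : ℂ) :
    dPsi (fun x => a * (η x.1 * Complex.exp (-(Complex.I * k * x.2)))) =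
      fun x => a * (deriv η x.1 * Complex.exp (-(Complex.I * k * x.2))) := by
  funext x
  have h1 : HasDerivAt η (deriv η x.1) x.1 :=
    (h.smooth.differentiable (by simp)).differentiableAt.hasDerivAt
  exact ((h1.mul_const (Complex.exp (-(Complex.I * k * x.2)))).const_mul a).deriv

lemma iterate_mode {η : ℝ → ℂ} (h : IsTest1 η) (k : ℤ) (p q : ℕ) :
    dPsi^[p] (dTheta^[q] (fun x => 1 * (η x.1 * Complex.exp (-(Complex.I * k * x.2))))) =
      fun x => (-(Complex.I * k)) ^ q *
        (iteratedDeriv p η x.1 * Complex.exp (-(Complex.I * k * x.2))) := by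
  have hq : dTheta^[q] (fun x => 1 * (η x.1 * Complex.exp (-(Complex.I * k * x.2)))) =
      fun x => (-(Complex.I * k)) ^ q * (η x.1 * Complex.exp (-(Complex.I * k * x.2))) := by
    induction q with
    | zero => simp
    | succ q ih => rw [Function.iterate_succ_apply', ih, dTheta_mode, pow_succ]
  rw [hq]
  induction p with
  | zero => simp
  | succ p ih =>
    rw [Function.iterate_succ_apply', ih, dPsi_mode (h.iteratedDeriv p), iteratedDeriv_succ]

lemma integral_wmul_mode (c : ℝ) (U : Lp ℂ 2 muPi) {η : ℝ → ℂ} (h : IsTest1 η) (k : ℤ) (a : ℂ) :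
    ∫ x, wmul c U x * (a * (η x.1 * Complex.exp (-(Complex.I * k * x.2)))) ∂muPi =
      a * √(2 * Real.pi) * ∫ s, ((s ^ c : ℝ) : ℂ) * cf k U s * η s ∂muI := by
  have hi := (locInt_wmul c (Lp_integrable_muPi U)).integrable_mul (isTest_mode h k a)
  have h1 := integral_prod (μ := muI) (ν := muT) _ hi
  refine h1.trans ?_
  rw [← integral_const_mul]
  refine integral_congr_ae ?_
  filter_upwards [coeFn_cf k U] with s hs
  rw [hs]
  unfold fcoef
  have h3 : ((√(2 * Real.pi) : ℝ) : ℂ) ≠ 0 := by exact_mod_cast sqrt_two_pi_pos.ne'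
  have e : ∫ t, wmul c U (s, t) * (a * (η s * Complex.exp (-(Complex.I * k * t)))) ∂muT =
      ((s ^ c : ℝ) : ℂ) * a * η s *
        ∫ t, Complex.exp (-(Complex.I * k * t)) * U (s, t) ∂muT := by
    rw [← integral_const_mul]
    congr 1
    funext t
    simp only [wmul]
    ring
  rw [e, ← ofReal_sqrt_two_pi_sq]
  field_simp

/-- Separated test functions `η(ψ) e^{-ikθ}` extract the `k`-th mode and turn angular derivatives
into powers of `ik`. -/
lemma weak1_of_isWeakDeriv {p q : ℕ} {c : ℝ} {U G : Lp ℂ 2 muPi}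
    (h : IsWeakDeriv p q (wmul c U) (wmul (c - p) G)) (k : ℤ) :
    Weak1 c p ((Complex.I * k) ^ q • cf k U) (cf k G) := by
  intro η hη
  have h1 := h.2.2 _ (isTest_mode hη k 1)
  rw [iterate_mode hη, integral_wmul_mode c U (hη.iteratedDeriv p),
    integral_wmul_mode _ G hη] at h1
  have h3 : ((√(2 * Real.pi) : ℝ) : ℂ) ≠ 0 := by exact_mod_cast sqrt_two_pi_pos.ne'
  have e : ∫ s, ((s ^ c : ℝ) : ℂ) * ((Complex.I * k) ^ q • cf k U : HI) s *
      iteratedDeriv p η s ∂muI =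
      (Complex.I * k) ^ q * ∫ s, ((s ^ c : ℝ) : ℂ) * cf k U s * iteratedDeriv p η s ∂muI := by
    rw [← integral_const_mul]
    refine integral_congr_ae ?_
    filter_upwards [Lp.coeFn_smul ((Complex.I * k) ^ q) (cf k U)] with s hs
    rw [hs, Pi.smul_apply, smul_eq_mul]
    ring
  rw [e]
  have h4 : (-(Complex.I * k)) ^ q = (-1) ^ q * (Complex.I * k) ^ q := by
    rw [← mul_pow]; ring
  rw [h4, pow_add] at h1
  have h0 : ((-1 : ℂ)) ^ q ≠ 0 := by simp
  refine mul_left_cancel₀ (mul_ne_zero h0 h3) ?_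
  linear_combination h1

/-- The Fourier transform in the angle of a test function. -/
def angInt (k : ℤ) (φ : ℝ × ℝ → ℂ) (s : ℝ) : ℂ :=
  ∫ t : ℝ, Complex.exp (Complex.I * k * t) * φ (s, t) ∂muT

lemma hasDerivAt_angInt (k : ℤ) {φ : ℝ × ℝ → ℂ} (h : IsTest φ) (s : ℝ) :
    HasDerivAt (angInt k φ) (angInt k (dPsi φ) s) s := by
  have hc : Continuous (dPsi φ) := h.dPsi.smooth.continuous
  have hce : Continuous fun t : ℝ => Complex.exp (Complex.I * k * t) := by fun_prop
  obtain ⟨C, hC⟩ := ((isCompact_closedBall s 1).prod isCompact_Icc :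
    IsCompact (Metric.closedBall s 1 ×ˢ Icc (0 : ℝ) (2 * Real.pi))).exists_bound_of_continuousOn
      hc.continuousOn
  have hmem : ∀ᵐ t ∂muT, t ∈ Ioo (0 : ℝ) (2 * Real.pi) := ae_restrict_mem measurableSet_Ioo
  refine (hasDerivAt_integral_of_dominated_loc_of_deriv_le (μ := muT)
    (F := fun s t => Complex.exp (Complex.I * k * t) * φ (s, t))
    (F' := fun s t => Complex.exp (Complex.I * k * t) * dPsi φ (s, t)) (bound := fun _ => C)
    (Metric.ball_mem_nhds s one_pos) ?_ ?_ ?_ ?_ (integrable_const C) ?_).2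
  · refine Filter.Eventually.of_forall fun x => ?_
    exact (hce.mul (h.smooth.continuous.comp (by fun_prop))).aestronglyMeasurable
  · have hc2 : Continuous fun t : ℝ => Complex.exp (Complex.I * k * t) * φ (s, t) :=
      hce.mul (h.smooth.continuous.comp (by fun_prop))
    unfold muT
    exact (hc2.continuousOn.integrableOn_compact isCompact_Icc).mono_set Ioo_subset_Icc_self
  · exact (hce.mul (hc.comp (by fun_prop))).aestronglyMeasurable
  · filter_upwards [hmem] with t ht x hx
    rw [norm_mul, norm_exp_I_mul, one_mul]
    exact hC (x, t) ⟨Metric.ball_subset_closedBall hx, Ioo_subset_Icc_self ht⟩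
  · refine Filter.Eventually.of_forall fun t x _ => ?_
    have h1 : DifferentiableAt ℝ (fun x => φ (x, t)) x :=
      ((h.smooth.comp (contDiff_id.prodMk contDiff_const)).differentiable
        (by simp)).differentiableAt
    exact h1.hasDerivAt.const_mul _

lemma deriv_angInt (k : ℤ) {φ : ℝ × ℝ → ℂ} (h : IsTest φ) :
    deriv (angInt k φ) = angInt k (dPsi φ) := funext fun s => (hasDerivAt_angInt k h s).deriv

/-- Differentiation under the integral sign produces the transform of another test function, so
smoothness follows by induction on the order. -/
lemma isTest1_angInt (k : ℤ) {φ : ℝ × ℝ → ℂ} (h : IsTest φ) : IsTest1 (angInt k φ) := by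
  obtain ⟨δ, hδ, hz⟩ := h.support
  refine IsTest1.of_Icc ?_ hδ fun s hs => ?_
  · refine contDiff_infty.mpr fun n => ?_
    have key : ∀ n : ℕ, ∀ φ, IsTest φ → ContDiff ℝ n (angInt k φ) := by
      intro n
      induction n with
      | zero =>
        intro φ h
        refine contDiff_zero.mpr ?_
        exact continuous_iff_continuousAt.mpr fun s => (hasDerivAt_angInt k h s).continuousAt
      | succ n ih =>
        intro φ h
        push_cast
        rw [contDiff_succ_iff_deriv]
        refine ⟨fun s => (hasDerivAt_angInt k h s).differentiableAt, by simp, ?_⟩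
        rw [deriv_angInt k h]
        exact ih _ h.dPsi
    exact key n φ h
  · unfold angInt
    have : ∀ t, φ (s, t) = 0 := fun t => by
      by_contra hne
      exact hs (hz s t hne)
    simp [this]

/-- Integration by parts over a full period, where the boundary terms cancel. -/
lemma angInt_dTheta (k : ℤ) {φ : ℝ × ℝ → ℂ} (h : IsTest φ) (s : ℝ) :
    angInt k (dTheta φ) s = -(Complex.I * k) * angInt k φ s := by
  have h2 : (0 : ℝ) ≤ 2 * Real.pi := by positivity
  have hce : ∀ t : ℝ, HasDerivAt (fun t : ℝ => Complex.exp (Complex.I * k * t))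
      (Complex.exp (Complex.I * k * t) * (Complex.I * k)) t := by
    intro t
    have := ((hasDerivAt_id t).ofReal_comp.const_mul (Complex.I * k)).cexp
    simpa using this
  have hφ : ∀ t : ℝ, HasDerivAt (fun t => φ (s, t)) (dTheta φ (s, t)) t := fun t =>
    ((h.smooth.comp (contDiff_const.prodMk contDiff_id)).differentiable
        (by simp)).differentiableAt.hasDerivAt
  have c1 : Continuous fun t : ℝ => Complex.exp (Complex.I * k * t) * (Complex.I * k) := by fun_prop
  have c2 : Continuous fun t : ℝ => dTheta φ (s, t) :=
    h.dTheta.smooth.continuous.comp (by fun_prop)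
  have e := intervalIntegral.integral_mul_deriv_eq_deriv_mul (a := 0) (b := 2 * Real.pi)
    (fun t _ => hce t) (fun t _ => hφ t) (c1.intervalIntegrable _ _) (c2.intervalIntegrable _ _)
  have hp := h.periodic s 0
  have hexp : Complex.exp (Complex.I * k * ((2 * Real.pi : ℝ) : ℂ)) = 1 := by
    rw [Complex.exp_eq_one_iff]
    exact ⟨k, by push_cast; ring⟩
  rw [zero_add] at hp
  rw [hp, hexp] at e
  simp only [Complex.ofReal_zero, mul_zero, Complex.exp_zero, sub_self, zero_sub] at e
  have hmu : ∀ g : ℝ → ℂ, ∫ t, g t ∂muT = ∫ t in (0 : ℝ)..(2 * Real.pi), g t := by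
    intro g
    rw [intervalIntegral.integral_of_le h2]
    unfold muT
    rw [restrict_Ioo_eq_restrict_Ioc]
  unfold angInt
  rw [hmu, e, hmu, ← intervalIntegral.integral_neg, ← intervalIntegral.integral_const_mul]
  congr 1
  funext t
  ring

lemma IsTest.dTheta_iterate {φ : ℝ × ℝ → ℂ} (h : IsTest φ) (q : ℕ) :
    IsTest (_root_.dTheta^[q] φ) := h.iterate 0 q

lemma angInt_iterate (k : ℤ) {φ : ℝ × ℝ → ℂ} (h : IsTest φ) (p q : ℕ) :
    angInt k (dPsi^[p] (dTheta^[q] φ)) =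
      fun s => (-(Complex.I * k)) ^ q * iteratedDeriv p (angInt k φ) s := by
  have hq : angInt k (dTheta^[q] φ) = fun s => (-(Complex.I * k)) ^ q * angInt k φ s := by
    induction q with
    | zero => simp
    | succ q ih =>
      funext s
      rw [Function.iterate_succ_apply', angInt_dTheta k (h.dTheta_iterate q), ih, pow_succ]
      ring
  induction p with
  | zero => simpa using hq
  | succ p ih =>
    rw [Function.iterate_succ_apply', ← deriv_angInt k (h.iterate p q), ih]
    funext s
    rw [deriv_const_mul_field, iteratedDeriv_succ]

/-- The support stays away from `ψ = 0`, so any power of `ψ` is harmless. This makes pairing with a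
test function continuous on `L²(Π)`. -/
lemma memLp_rpow_mul_test (c : ℝ) {φ : ℝ × ℝ → ℂ} (h : IsTest φ) :
    MemLp (fun x => ((x.1 ^ c : ℝ) : ℂ) * φ x) 2 muPi := by
  obtain ⟨δ, hδ, hs⟩ := h.support
  have hc : ContinuousOn (fun x : ℝ × ℝ => ((x.1 ^ c : ℝ) : ℂ) * φ x)
      (Icc δ (1 - δ) ×ˢ Icc (0 : ℝ) (2 * Real.pi)) := by
    refine ContinuousOn.mul ?_ h.smooth.continuous.continuousOn
    refine Complex.continuous_ofReal.comp_continuousOn fun x hx => ?_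
    exact ((Real.continuousAt_rpow_const x.1 c (Or.inl (hδ.trans_le hx.1.1).ne')).comp
      continuousAt_fst).continuousWithinAt
  obtain ⟨C, hC⟩ := (isCompact_Icc.prod isCompact_Icc).exists_bound_of_continuousOn hc
  refine MemLp.of_bound ?_ (max C 0) ?_
  · exact ((Complex.measurable_ofReal.comp (measurable_fst.pow_const c)).mul
      h.smooth.continuous.measurable).aestronglyMeasurable
  · filter_upwards [ae_mem_muPi] with x hx
    by_cases h0 : φ x = 0
    · simp [h0]
    · exact (hC x ⟨hs x.1 x.2 h0, Ioo_subset_Icc_self hx.2⟩).trans (le_max_left _ _)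

lemma integral_wmul_test (c : ℝ) {φ : ℝ × ℝ → ℂ} (h : IsTest φ) (U : Lp ℂ 2 muPi) :
    ∫ x, wmul c U x * φ x ∂muPi = pairL ((memLp_rpow_mul_test c h).toLp _) U := by
  rw [pairL_toLp]
  congr 1
  funext x
  simp only [wmul]
  ring

lemma integral_wmul_modeL (c : ℝ) {φ : ℝ × ℝ → ℂ} (h : IsTest φ) (k : ℤ) (f : HI) :
    ∫ x, wmul c (modeL k f) x * φ x ∂muPi =
      ((√(2 * Real.pi))⁻¹ : ℝ) * ∫ s, ((s ^ c : ℝ) : ℂ) * f s * angInt k φ s ∂muI := by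
  have hi := (locInt_wmul c (Lp_integrable_muPi (modeL k f))).integrable_mul h
  have hae : (fun x => wmul c (modeL k f) x * φ x) =ᵐ[muPi]
      fun x => wmul c (modeFun k f) x * φ x := by
    filter_upwards [coeFn_modeL k f] with x hx
    simp only [wmul, hx]
  rw [integral_congr_ae hae]
  have h1 := integral_prod (μ := muI) (ν := muT) _ (hi.congr hae)
  refine h1.trans ?_
  rw [← integral_const_mul]
  congr 1
  funext s
  unfold angInt
  rw [← integral_const_mul, ← integral_const_mul]
  congr 1
  funext t
  simp only [wmul, modeFun]
  ring

/-- Both sides of the weak identity are continuous in `U` and `G`, so it is enough to treat one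
angular mode at a time; there it is the one-dimensional identity tested with `angInt k φ`. -/
lemma isWeakDeriv_of_weak1 {p q : ℕ} {c : ℝ} {U G : Lp ℂ 2 muPi}
    (h : ∀ k : ℤ, Weak1 c p ((Complex.I * k) ^ q • cf k U) (cf k G)) :
    IsWeakDeriv p q (wmul c U) (wmul (c - p) G) := by
  refine ⟨locInt_wmul c (Lp_integrable_muPi U), locInt_wmul _ (Lp_integrable_muPi G),
    fun φ hφ => ?_⟩
  rw [integral_wmul_test c (hφ.iterate p q), integral_wmul_test _ hφ]
  have hs1 := (pairL ((memLp_rpow_mul_test c (hφ.iterate p q)).toLp _)).hasSum (hasSum_modeL U)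
  have hs2 := ((pairL ((memLp_rpow_mul_test (c - p) hφ).toLp _)).hasSum
    (hasSum_modeL G)).mul_left ((-1) ^ (p + q))
  have hterm : ∀ k : ℤ, pairL ((memLp_rpow_mul_test c (hφ.iterate p q)).toLp _)
      (modeL k (cf k U)) = (-1) ^ (p + q) *
        pairL ((memLp_rpow_mul_test (c - p) hφ).toLp _) (modeL k (cf k G)) := ?_
  · rw [funext hterm] at hs1
    exact hs1.unique hs2
  intro k
  rw [← integral_wmul_test c (hφ.iterate p q), ← integral_wmul_test (c - p) hφ, integral_wmul_modeL c (hφ.iterate p q),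
    integral_wmul_modeL _ hφ, angInt_iterate k hφ]
  have h1 := h k _ (isTest1_angInt k hφ)
  have e : ∫ s, ((s ^ c : ℝ) : ℂ) * ((Complex.I * k) ^ q • cf k U : HI) s *
      iteratedDeriv p (angInt k φ) s ∂muI =
      (-1) ^ q * ∫ s, ((s ^ c : ℝ) : ℂ) * cf k U s *
        ((-(Complex.I * k)) ^ q * iteratedDeriv p (angInt k φ) s) ∂muI := by
    rw [← integral_const_mul]
    refine integral_congr_ae ?_
    filter_upwards [Lp.coeFn_smul ((Complex.I * k) ^ q) (cf k U)] with s hs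
    rw [hs, Pi.smul_apply, smul_eq_mul, neg_pow (Complex.I * (k : ℂ)) q]
    have h5 : ((-1 : ℂ)) ^ q * (-1) ^ q = 1 := by rw [← mul_pow]; simp
    linear_combination -(((s ^ c : ℝ) : ℂ) * cf k U s * (Complex.I * k) ^ q *
      iteratedDeriv p (angInt k φ) s) * h5
  rw [e] at h1
  have h5 : ((-1 : ℂ)) ^ q * (-1) ^ q = 1 := by rw [← mul_pow]; simp
  rw [pow_add]
  linear_combination ((√(2 * Real.pi))⁻¹ : ℝ) * (-1) ^ q * h1 -
    ((√(2 * Real.pi))⁻¹ : ℝ) * (∫ s, ((s ^ c : ℝ) : ℂ) * cf k U s *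
        ((-(Complex.I * k)) ^ q * iteratedDeriv p (angInt k φ) s) ∂muI) * h5

end

noncomputable section

/-! ### Angular Fourier coefficients in the Kondratev spaces -/

open scoped ENNReal

/-- The multi-index `(p, q)`. -/
def DIdx.mk' {n : ℕ} (p q : ℕ) (h : p + q ≤ n) : DIdx n :=
  ⟨(p, q), by simp only [Finset.mem_filter, Finset.mem_product, Finset.mem_range]; omega⟩

lemma DIdx.le {n : ℕ} (i : DIdx n) : i.1.1 + i.1.2 ≤ n := (Finset.mem_filter.mp i.2).2

/-- The space `⨁ L²(Π)` containing `K_γ^n(Π)`. -/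
abbrev KAmb (n : ℕ) : Type := PiLp 2 fun _ : DIdx n => Lp ℂ 2 muPi

/-- The Fourier coefficient of index `k` of `ψ^{p - γ} ∂_ψ^p u`. -/
def kc {n : ℕ} (U : KAmb n) (p : ℕ) (k : ℤ) : HI :=
  if h : p ≤ n then cf k (U (DIdx.mk' p 0 h)) else 0

lemma kc_eq {n : ℕ} (U : KAmb n) {p : ℕ} (h : p + 0 ≤ n) (k : ℤ) :
    kc U p k = cf k (U (DIdx.mk' p 0 h)) := dif_pos h

lemma kc_zero {n : ℕ} (U : KAmb n) (k : ℤ) : kc U 0 k = cf k (U (DIdx.zero n)) :=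
  kc_eq U (Nat.zero_le n) k

lemma continuous_kc (n p : ℕ) (k : ℤ) : Continuous fun U : KAmb n => kc U p k := by
  unfold kc
  split_ifs with h
  · exact (cf k).continuous.comp (PiLp.continuous_apply 2 _ _)
  · exact continuous_const

/-- Weak differentiability on `Π` decouples over the modes into one chain of ordinary differential
relations for each `k`, angular derivatives being mere powers of `ik`. Regularity and norm estimates
in the Kondratev spaces are then carried out on the profiles `kc`. -/
theorem mem_KSpace_iff {n : ℕ} {γ : ℝ} (U : KAmb n) : U ∈ KSpace n γ ↔
    (∀ i k, cf k (U i) = (Complex.I * k) ^ i.1.2 • kc U i.1.1 k) ∧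
      ∀ k, ∀ p < n, EulerRel (p - γ) (kc U p k) (kc U (p + 1) k) := by
  constructor
  · intro hU
    have hw : ∀ p, ∀ h : p + 0 ≤ n, ∀ k, Weak1 γ p (kc U 0 k) (kc U p k) := by
      intro p h k
      have h1 := weak1_of_isWeakDeriv (hU (DIdx.mk' p 0 h)) k
      rw [kc_zero, kc_eq U h]
      simpa [DIdx.mk'] using h1
    refine ⟨fun i k => ?_, fun k p hp => ?_⟩
    · have h1 := weak1_of_isWeakDeriv (hU i) k
      have h2 := (hw i.1.1 (by have := i.le; omega) k).smul ((Complex.I * k) ^ i.1.2)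
      rw [kc_zero] at h2
      exact h1.unique h2
    · exact eulerRel_of_weak1 (hw p (by omega) k) (hw (p + 1) (by omega) k)
  · rintro ⟨h1, h2⟩ i
    refine isWeakDeriv_of_weak1 fun k => ?_
    have h3 := weak1_of_eulerRel (h2 k) (p := i.1.1) (by have := i.le; omega)
    rw [kc_zero] at h3
    rw [h1 i k]
    exact h3.smul _

/-- The criterion consists of equalities of continuous maps and instances of the closed Euler
relation. -/
lemma isClosed_KSpace (n : ℕ) (γ : ℝ) : IsClosed (KSpace n γ : Set (KAmb n)) := by
  have e : (KSpace n γ : Set (KAmb n)) = {U : KAmb n |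
    (∀ i k, cf k (U i) = (Complex.I * k) ^ i.1.2 • kc U i.1.1 k) ∧
      ∀ k, ∀ p < n, EulerRel (p - γ) (kc U p k) (kc U (p + 1) k)} := by
    ext U
    exact mem_KSpace_iff U
  rw [e]
  refine IsClosed.and ?_ ?_
  · simp only [Set.ofPred_forall]
    refine isClosed_iInter fun i => isClosed_iInter fun k => ?_
    have hc : Continuous fun U : KAmb n => (Complex.I * (k : ℂ)) ^ i.1.2 • kc U i.1.1 k :=
      (continuous_const_smul _).comp (continuous_kc n i.1.1 k)
    exact isClosed_eq ((cf k).continuous.comp (PiLp.continuous_apply 2 _ _)) hc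
  · simp only [Set.ofPred_forall]
    refine isClosed_iInter fun k => isClosed_iInter fun p => isClosed_iInter fun _ => ?_
    exact (isClosed_eulerRel (p - γ)).preimage
      ((continuous_kc n p k).prodMk (continuous_kc n (p + 1) k))

instance (n : ℕ) (γ : ℝ) : CompleteSpace (KSpace n γ) := (isClosed_KSpace n γ).completeSpace_coe

/-- In each mode the zeroth profile determines the later ones by uniqueness in the Euler relation,
and these determine all components. -/
lemma KSpace.ext_kc {n : ℕ} {γ : ℝ} {U W : KSpace n γ} (h : ∀ k, kc U.1 0 k = kc W.1 0 k) :
    U = W := by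
  obtain ⟨u1, u2⟩ := (mem_KSpace_iff U.1).mp U.2
  obtain ⟨w1, w2⟩ := (mem_KSpace_iff W.1).mp W.2
  have hp : ∀ p ≤ n, ∀ k, kc U.1 p k = kc W.1 p k := by
    intro p
    induction p with
    | zero => exact fun _ => h
    | succ p ih =>
      intro hpn k
      have h1 := u2 k p (by omega)
      rw [ih (by omega) k] at h1
      exact h1.unique (w2 k p (by omega))
  refine Subtype.ext (PiLp.ext fun i => ext_cf fun k => ?_)
  rw [u1, w1, hp _ (by have := i.le; omega)]

lemma enorm_sq_KAmb {n : ℕ} (U : KAmb n) : ‖U‖ₑ ^ 2 = ∑ i, ∑' k, ‖cf k (U i)‖ₑ ^ 2 := by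
  have h := PiLp.norm_sq_eq_of_L2 (fun _ : DIdx n => Lp ℂ 2 muPi) U
  simp only [tsum_enorm_cf_sq]
  have e : ∀ x : ℝ, 0 ≤ x → ENNReal.ofReal x ^ 2 = ENNReal.ofReal (x ^ 2) := fun x hx =>
    (ENNReal.ofReal_pow hx 2).symm
  simp only [← ofReal_norm, e _ (norm_nonneg _)]
  rw [h, ENNReal.ofReal_sum_of_nonneg fun _ _ => by positivity]

/-- The weight `(1 + |k|)^r`. -/
def pwt (r : ℕ) (k : ℤ) : ℝ≥0∞ := ENNReal.ofReal ((1 + |(k : ℝ)|) ^ r)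

lemma enorm_I_mul_pow (k : ℤ) (q : ℕ) : ‖(Complex.I * k) ^ q‖ₑ = ENNReal.ofReal (|(k : ℝ)| ^ q) := by
  rw [← ofReal_norm]
  congr 1
  simp

lemma enorm_I_mul_pow_le (k : ℤ) {q r : ℕ} (h : q ≤ r) : ‖(Complex.I * k) ^ q‖ₑ ≤ pwt r k := by
  rw [enorm_I_mul_pow]
  refine ENNReal.ofReal_le_ofReal ?_
  have h0 : 0 ≤ |(k : ℝ)| := abs_nonneg _
  calc |(k : ℝ)| ^ q ≤ (1 + |(k : ℝ)|) ^ q := by gcongr; linarith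
    _ ≤ (1 + |(k : ℝ)|) ^ r := pow_le_pow_right₀ (by linarith) h

lemma pwt_le (k : ℤ) (r : ℕ) : pwt r k ≤ 2 ^ r * (1 + ‖(Complex.I * k) ^ r‖ₑ) := by
  rw [enorm_I_mul_pow]
  have h0 : 0 ≤ |(k : ℝ)| := abs_nonneg _
  have h1 : (1 + |(k : ℝ)|) ^ r ≤ 2 ^ r * (1 + |(k : ℝ)| ^ r) := by
    refine (add_pow_le zero_le_one h0 r).trans ?_
    rw [one_pow]
    gcongr
    · norm_num
    · omega
  refine (ENNReal.ofReal_le_ofReal h1).trans_eq ?_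
  rw [ENNReal.ofReal_mul (by positivity), ENNReal.ofReal_add zero_le_one (by positivity),
    ENNReal.ofReal_one, ENNReal.ofReal_pow (by norm_num)]
  norm_num

lemma ENNReal.sum_sq_le {ι : Type*} (s : Finset ι) (a : ι → ℝ≥0∞) :
    (∑ i ∈ s, a i) ^ 2 ≤ s.card * ∑ i ∈ s, a i ^ 2 := by
  have h := ENNReal.tsum_mul_sq_le (fun _ : s => (1 : ℝ≥0∞)) (fun i : s => a i)
  rw [tsum_fintype, tsum_fintype, tsum_fintype, Finset.sum_coe_sort s (fun i => 1 * a i),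
    Finset.sum_coe_sort s (fun i => a i ^ 2)] at h
  simpa using h

/-- The constant in `KSpace.tsum_sq_le`. -/
def kconst (n : ℕ) : ℝ≥0∞ :=
  (((n + 1 : ℕ) : ℝ≥0∞) * (2 ^ n * 2)) ^ 2 * (Finset.univ : Finset (DIdx n)).card

lemma kconst_ne_top (n : ℕ) : kconst n ≠ ⊤ := by
  unfold kconst
  refine ENNReal.mul_ne_top (ENNReal.pow_ne_top (ENNReal.mul_ne_top ?_ ?_)) ?_
  · exact ENNReal.natCast_ne_top _
  · exact ENNReal.mul_ne_top (by simp) (by simp)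
  · exact ENNReal.natCast_ne_top _

/-- The weight `(1 + |k|)^{n-p}` is controlled by `1 + |k|^{n-p}`, and these two terms are the
components `(p, 0)` and `(p, n - p)`, both of which are part of the norm. -/
lemma KSpace.tsum_sq_le {n : ℕ} {γ : ℝ} (U : KSpace n γ) :
    ∑' k, (∑ p ∈ Finset.range (n + 1), pwt (n - p) k * ‖kc U.1 p k‖ₑ) ^ 2 ≤
      kconst n * ‖U‖ₑ ^ 2 := by
  obtain ⟨u1, -⟩ := (mem_KSpace_iff U.1).mp U.2
  have hterm : ∀ k, ∀ p ∈ Finset.range (n + 1), pwt (n - p) k * ‖kc U.1 p k‖ₑ ≤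
      (2 ^ n * 2) * ∑ i, ‖cf k (U.1 i)‖ₑ := by
    intro k p hp
    have hpn : p ≤ n := by simpa [Nat.lt_succ_iff] using hp
    have e1 : ‖kc U.1 p k‖ₑ ≤ ∑ i, ‖cf k (U.1 i)‖ₑ := by
      rw [kc_eq U.1 (by omega : p + 0 ≤ n)]
      exact Finset.single_le_sum (f := fun i => ‖cf k (U.1 i)‖ₑ) (fun _ _ => zero_le)
        (Finset.mem_univ _)
    have e2 : ‖(Complex.I * k) ^ (n - p)‖ₑ * ‖kc U.1 p k‖ₑ ≤ ∑ i, ‖cf k (U.1 i)‖ₑ := by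
      have := u1 (DIdx.mk' p (n - p) (by omega)) k
      have h2 : ‖(Complex.I * k) ^ (n - p)‖ₑ * ‖kc U.1 p k‖ₑ =
          ‖cf k (U.1 (DIdx.mk' p (n - p) (by omega)))‖ₑ := by
        rw [this, enorm_smul]
        rfl
      rw [h2]
      exact Finset.single_le_sum (f := fun i => ‖cf k (U.1 i)‖ₑ) (fun _ _ => zero_le)
        (Finset.mem_univ _)
    calc pwt (n - p) k * ‖kc U.1 p k‖ₑ
        ≤ (2 ^ (n - p) * (1 + ‖(Complex.I * k) ^ (n - p)‖ₑ)) * ‖kc U.1 p k‖ₑ := by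
          gcongr; exact pwt_le _ _
      _ = 2 ^ (n - p) * (‖kc U.1 p k‖ₑ + ‖(Complex.I * k) ^ (n - p)‖ₑ * ‖kc U.1 p k‖ₑ) := by ring
      _ ≤ 2 ^ n * (∑ i, ‖cf k (U.1 i)‖ₑ + ∑ i, ‖cf k (U.1 i)‖ₑ) := by
          gcongr
          · norm_num
          · omega
      _ = _ := by ring
  have hk : ∀ k, (∑ p ∈ Finset.range (n + 1), pwt (n - p) k * ‖kc U.1 p k‖ₑ) ^ 2 ≤
      kconst n * ∑ i, ‖cf k (U.1 i)‖ₑ ^ 2 := by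
    intro k
    have h1 := Finset.sum_le_sum (hterm k)
    rw [Finset.sum_const, Finset.card_range, nsmul_eq_mul, ← mul_assoc] at h1
    refine (pow_le_pow_left₀ zero_le h1 2).trans ?_
    rw [mul_pow]
    unfold kconst
    rw [mul_assoc (_ ^ 2)]
    gcongr
    exact ENNReal.sum_sq_le _ _
  refine (ENNReal.tsum_le_tsum hk).trans_eq ?_
  rw [ENNReal.tsum_mul_left, Summable.tsum_finsetSum fun _ _ => ENNReal.summable, ← enorm_sq_KAmb]
  rfl

/-- Elements of `K_γ^n(Π)` from their Fourier coefficients. -/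
lemma KSpace.exists_of_kc {n : ℕ} {γ : ℝ} {F : ℕ → ℤ → HI} {B : ℝ≥0∞} (hB : B ≠ ⊤)
    (hF : ∀ k, ∀ p < n, EulerRel (p - γ) (F p k) (F (p + 1) k))
    (hs : ∀ p ≤ n, ∑' k, (pwt (n - p) k * ‖F p k‖ₑ) ^ 2 ≤ B) :
    ∃ U : KSpace n γ, (∀ p ≤ n, ∀ k, kc U.1 p k = F p k) ∧
      ‖U‖ₑ ^ 2 ≤ (Finset.univ : Finset (DIdx n)).card * B := by
  have hi : ∀ i : DIdx n, ∑' k : ℤ, ‖(Complex.I * k) ^ i.1.2 • F i.1.1 k‖ₑ ^ 2 ≤ B := by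
    intro i
    have := i.le
    refine (ENNReal.tsum_le_tsum fun k => ?_).trans (hs i.1.1 (by omega))
    rw [enorm_smul]
    gcongr
    exact enorm_I_mul_pow_le k (by omega)
  choose W hW using fun i : DIdx n => exists_of_cf (ne_top_of_le_ne_top hB (hi i))
  have hkc : ∀ p ≤ n, ∀ k, kc (WithLp.toLp 2 W : KAmb n) p k = F p k := by
    intro p hp k
    rw [kc_eq _ (by omega : p + 0 ≤ n)]
    change cf k (W _) = _
    rw [hW]
    simp [DIdx.mk']
  refine ⟨⟨WithLp.toLp 2 W, (mem_KSpace_iff _).mpr ⟨fun i k => ?_, fun k p hp => ?_⟩⟩, hkc, ?_⟩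
  · rw [hkc _ (by have := i.le; omega)]
    exact hW i k
  · rw [hkc _ (by omega), hkc _ (by omega)]
    exact hF k p hp
  · change ‖(WithLp.toLp 2 W : KAmb n)‖ₑ ^ 2 ≤ _
    rw [enorm_sq_KAmb]
    refine (Finset.sum_le_sum fun i _ => ?_).trans_eq
      (by rw [Finset.sum_const, nsmul_eq_mul] : ∑ _i : DIdx n, B = _)
    simp only [hW]
    exact hi i

/-! ### The spaces `K_γ^{n,σ}(Π)` -/

/-- The weight `e^{σ|k|}`. -/
def ewt (σ : ℝ) (k : ℤ) : ℂ := (Real.exp (σ * |(k : ℝ)|) : ℂ)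

lemma ewt_ne_zero (σ : ℝ) (k : ℤ) : ewt σ k ≠ 0 := by
  unfold ewt; exact_mod_cast (Real.exp_pos _).ne'

namespace KSig

variable {n : ℕ} {γ σ : ℝ}

lemma kFun_slice (U : KSpace n γ) (k : ℤ) : ∀ᵐ s ∂muI, fcoef (fun t => kFun U (s, t)) k =
    ((s ^ γ : ℝ) : ℂ) * (((√(2 * Real.pi))⁻¹ : ℝ) * kc U.1 0 k s) := by
  rw [kc_zero]
  filter_upwards [coeFn_cf k (U.1 (DIdx.zero n))] with s hs
  rw [hs]
  unfold kFun
  rw [wmul_slice]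
  have h3 : ((√(2 * Real.pi) : ℝ) : ℂ) ≠ 0 := by exact_mod_cast sqrt_two_pi_pos.ne'
  push_cast
  field_simp

lemma mem_KSigSub_iff (P : KSpace n γ × KSpace n γ) : P ∈ KSigSub n γ σ ↔
    ∀ k, kc P.2.1 0 k = ewt σ k • kc P.1.1 0 k := by
  refine forall_congr' fun k => ?_
  have h3 : (((√(2 * Real.pi))⁻¹ : ℝ) : ℂ) ≠ 0 := by
    exact_mod_cast (inv_pos.mpr sqrt_two_pi_pos).ne'
  constructor
  · intro h
    refine Lp.ext ?_
    filter_upwards [h, kFun_slice P.1 k, kFun_slice P.2 k, ae_mem_muI,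
      Lp.coeFn_smul (ewt σ k) (kc P.1.1 0 k)] with s h1 h2 h4 hm h5
    rw [h2, h4] at h1
    rw [h5, Pi.smul_apply, smul_eq_mul]
    have h0 : ((s ^ γ : ℝ) : ℂ) ≠ 0 := by exact_mod_cast (Real.rpow_pos_of_pos hm.1 γ).ne'
    refine mul_left_cancel₀ h0 (mul_left_cancel₀ h3 ?_)
    unfold ewt
    linear_combination h1
  · intro h
    filter_upwards [kFun_slice P.1 k, kFun_slice P.2 k,
      Lp.coeFn_smul (ewt σ k) (kc P.1.1 0 k)] with s h2 h4 h5
    rw [h2, h4, h, h5, Pi.smul_apply, smul_eq_mul]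
    unfold ewt
    ring

/-- The definition gives this for `p = 0`; both sides obey the same Euler relation, so uniqueness
carries it to higher orders. -/
lemma kc_lift (P : KSig n γ σ) {p : ℕ} (hp : p ≤ n) (k : ℤ) :
    kc (lift P).1 p k = ewt σ k • kc (base P).1 p k := by
  induction p with
  | zero => exact (mem_KSigSub_iff (base P, lift P)).mp P.2 k
  | succ p ih =>
    have h1 := ((mem_KSpace_iff (lift P).1).mp (lift P).2).2 k p (by omega)
    have h2 := ((mem_KSpace_iff (base P).1).mp (base P).2).2 k p (by omega)
    rw [ih (by omega)] at h1
    exact h1.unique (h2.smul _)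

lemma ext_kc {P Q : KSig n γ σ} (h : ∀ k, kc (base P).1 0 k = kc (base Q).1 0 k) : P = Q := by
  refine lift_injective (KSpace.ext_kc fun k => ?_)
  rw [kc_lift P (Nat.zero_le n), kc_lift Q (Nat.zero_le n), h]

/-- Since `e^{σ|k|} ≥ 1`, the bound on the weighted profiles yields the lift and also the function
itself. -/
lemma exists_of_kc (hσ : 0 ≤ σ) {F : ℕ → ℤ → HI} {B : ℝ≥0∞} (hB : B ≠ ⊤)
    (hF : ∀ k, ∀ p < n, EulerRel (p - γ) (F p k) (F (p + 1) k))
    (hs : ∀ p ≤ n, ∑' k, (pwt (n - p) k * ‖ewt σ k • F p k‖ₑ) ^ 2 ≤ B) :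
    ∃ P : KSig n γ σ, (∀ p ≤ n, ∀ k, kc (base P).1 p k = F p k) ∧
      ‖P‖ₑ ^ 2 ≤ (Finset.univ : Finset (DIdx n)).card * B := by
  obtain ⟨W, hW, hWn⟩ := KSpace.exists_of_kc hB (F := fun p k => ewt σ k • F p k)
    (fun k p hp => (hF k p hp).smul _) hs
  obtain ⟨U, hU, -⟩ := KSpace.exists_of_kc hB hF fun p hp => by
    refine (ENNReal.tsum_le_tsum fun k => ?_).trans (hs p hp)
    gcongr
    rw [enorm_smul]
    refine le_mul_of_one_le_left zero_le ?_
    rw [← ofReal_norm, ← ENNReal.ofReal_one]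
    refine ENNReal.ofReal_le_ofReal ?_
    unfold ewt
    rw [Complex.norm_real, Real.norm_of_nonneg (Real.exp_pos _).le]
    exact Real.one_le_exp (by positivity)
  refine ⟨⟨(U, W), (mem_KSigSub_iff _).mpr fun k => ?_⟩, hU, hWn⟩
  rw [hW 0 (Nat.zero_le n), hU 0 (Nat.zero_le n)]

lemma tsum_sq_le (P : KSig n γ σ) :
    ∑' k, (∑ p ∈ Finset.range (n + 1), pwt (n - p) k * ‖ewt σ k • kc (base P).1 p k‖ₑ) ^ 2 ≤
      kconst n * ‖P‖ₑ ^ 2 := by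
  refine le_trans (le_of_eq ?_) (KSpace.tsum_sq_le (lift P))
  refine tsum_congr fun k => ?_
  congr 1
  refine Finset.sum_congr rfl fun p hp => ?_
  rw [kc_lift P (by simpa [Nat.lt_succ_iff] using hp)]

/-- Dividing the profiles by `e^{σ|k|}` preserves the Euler relations. Thus `lift` is an isometry
onto a complete space, which is how completeness is obtained. -/
lemma lift_surjective (hσ : 0 ≤ σ) :
    Function.Surjective (lift : KSig n γ σ →ₗ[ℂ] KSpace n γ) := by
  intro W
  have hc : ∀ p k, ewt σ k • ((ewt σ k)⁻¹ • kc W.1 p k) = kc W.1 p k := fun p k => by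
    rw [smul_smul, mul_inv_cancel₀ (ewt_ne_zero σ k), one_smul]
  obtain ⟨P, hP, -⟩ := exists_of_kc (γ := γ) hσ (n := n) (B := kconst n * ‖W‖ₑ ^ 2)
    (F := fun p k => (ewt σ k)⁻¹ • kc W.1 p k)
    (ENNReal.mul_ne_top (kconst_ne_top n) (ENNReal.pow_ne_top enorm_ne_top))
    (fun k p hp => (((mem_KSpace_iff W.1).mp W.2).2 k p hp).smul _) fun p hp => by
      refine (ENNReal.tsum_le_tsum fun k => ?_).trans (KSpace.tsum_sq_le W)
      rw [hc]
      gcongr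
      exact Finset.single_le_sum (f := fun p => pwt (n - p) k * ‖kc W.1 p k‖ₑ)
        (fun _ _ => zero_le) (Finset.mem_range.mpr (by omega))
  refine ⟨P, KSpace.ext_kc fun k => ?_⟩
  rw [kc_lift P (Nat.zero_le n), hP 0 (Nat.zero_le n), hc]

/-- The isometry `P ↦ lift P` as a linear isometric equivalence. -/
def liftEquiv (hσ : 0 ≤ σ) : KSig n γ σ ≃ₗᵢ[ℂ] KSpace n γ :=
  LinearIsometryEquiv.ofSurjective ⟨lift, fun _ => rfl⟩ (lift_surjective hσ)

lemma completeSpace (hσ : 0 ≤ σ) : CompleteSpace (KSig n γ σ) :=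
  (liftEquiv hσ).toIsometryEquiv.completeSpace_iff.mpr inferInstance

end KSig

end

noncomputable section

open scoped ENNReal

/-! ### Weights -/

lemma pwt_zero (k : ℤ) : pwt 0 k = 1 := by simp [pwt]

lemma pwt_mono {r r' : ℕ} (h : r ≤ r') (k : ℤ) : pwt r k ≤ pwt r' k :=
  ENNReal.ofReal_le_ofReal (pow_le_pow_right₀ (by linarith [abs_nonneg (k : ℝ)]) h)

lemma one_le_pwt (r : ℕ) (k : ℤ) : 1 ≤ pwt r k := by
  rw [← pwt_zero k]; exact pwt_mono (Nat.zero_le r) k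

lemma hwt_mul_pwt_succ (r : ℕ) (k : ℤ) : hwt k * pwt (r + 1) k = pwt r k := by
  unfold hwt pwt
  have h0 : 0 < 1 + |(k : ℝ)| := by positivity
  rw [← ENNReal.ofReal_mul (by positivity), pow_succ]
  congr 1
  field_simp

/-- One power of `1 + |k|` is exchanged for the square summable factor `hwt k`. -/
lemma le_hwt_mul {r : ℕ} (hr : 1 ≤ r) (k : ℤ) (a : ℝ≥0∞) : a ≤ hwt k * (pwt r k * a) := by
  obtain ⟨r, rfl⟩ := Nat.exists_eq_add_of_le' hr
  rw [← mul_assoc, hwt_mul_pwt_succ]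
  exact le_mul_of_one_le_left zero_le (one_le_pwt r k)

lemma pwt_add_le (r : ℕ) (j l : ℤ) : pwt r (j + l) ≤ 2 ^ r * (pwt r j + pwt r l) := by
  have h1 : (1 + |((j + l : ℤ) : ℝ)|) ^ r ≤
      2 ^ r * ((1 + |(j : ℝ)|) ^ r + (1 + |(l : ℝ)|) ^ r) := by
    have : 1 + |((j + l : ℤ) : ℝ)| ≤ (1 + |(j : ℝ)|) + (1 + |(l : ℝ)|) := by
      push_cast
      linarith [abs_add_le (j : ℝ) l]
    refine (pow_le_pow_left₀ (by positivity) this r).trans ?_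
    refine (add_pow_le (by positivity) (by positivity) r).trans ?_
    gcongr
    · norm_num
    · omega
  refine (ENNReal.ofReal_le_ofReal h1).trans_eq ?_
  rw [ENNReal.ofReal_mul (by positivity), ENNReal.ofReal_add (by positivity) (by positivity),
    ENNReal.ofReal_pow (by norm_num)]
  norm_num [pwt]

lemma enorm_ewt (σ : ℝ) (k : ℤ) : ‖ewt σ k‖ₑ = ENNReal.ofReal (Real.exp (σ * |(k : ℝ)|)) := by
  rw [← ofReal_norm]
  unfold ewt
  rw [Complex.norm_real, Real.norm_of_nonneg (Real.exp_pos _).le]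

lemma one_le_enorm_ewt {σ : ℝ} (hσ : 0 ≤ σ) (k : ℤ) : 1 ≤ ‖ewt σ k‖ₑ := by
  rw [enorm_ewt, ← ENNReal.ofReal_one]
  exact ENNReal.ofReal_le_ofReal (Real.one_le_exp (by positivity))

/-- Submultiplicativity from `|j + l| ≤ |j| + |l|`; because of it the exponential weight costs
nothing in convolutions. -/
lemma enorm_ewt_add_le {σ : ℝ} (hσ : 0 ≤ σ) (j l : ℤ) :
    ‖ewt σ (j + l)‖ₑ ≤ ‖ewt σ j‖ₑ * ‖ewt σ l‖ₑ := by
  rw [enorm_ewt, enorm_ewt, enorm_ewt, ← ENNReal.ofReal_mul (Real.exp_pos _).le, ← Real.exp_add]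
  refine ENNReal.ofReal_le_ofReal (Real.exp_le_exp.mpr ?_)
  rw [← mul_add]
  push_cast
  exact mul_le_mul_of_nonneg_left (abs_add_le _ _) hσ

/-- Cauchy–Schwarz against `hwt`: a polynomial weight of order at least one embeds `ℓ²` into `ℓ¹`.
-/
lemma tsum_ne_top_of_pwt {r : ℕ} (hr : 1 ≤ r) {a : ℤ → ℝ≥0∞}
    (h : ∑' k, (pwt r k * a k) ^ 2 ≠ ⊤) : ∑' k, a k ≠ ⊤ := by
  refine ne_top_of_le_ne_top ?_ (ENNReal.tsum_le_tsum fun k => le_hwt_mul hr k (a k))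
  have h1 := ENNReal.tsum_mul_sq_le hwt (fun k => pwt r k * a k)
  intro htop
  rw [htop] at h1
  exact ENNReal.mul_ne_top tsum_hwt_sq_ne_top h (top_le_iff.mp (by simpa using h1))

lemma summable_norm_of_tsum_enorm {ι E : Type*} [SeminormedAddCommGroup E] {f : ι → E}
    (h : ∑' i, ‖f i‖ₑ ≠ ⊤) : Summable fun i => ‖f i‖ := by
  simpa using ENNReal.summable_toReal h

/-- Convolutions in weighted `ℓ²` spaces. -/
lemma conv_bound {E : Type*} [NormedAddCommGroup E] [NormedSpace ℂ E] {σ : ℝ}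
    (hσ : 0 ≤ σ) {r : ℕ} {C : ℝ≥0∞} (hC : C ≠ ⊤) {x y : ℤ → ℝ≥0∞} (hx : ∑' k, x k ^ 2 ≠ ⊤)
    (hy : ∑' k, y k ^ 2 ≠ ⊤) {m : ℤ → ℤ → E}
    (hm : ∀ j l, pwt r (j + l) * ‖ewt σ (j + l) • m j l‖ₑ ≤
      C * ((hwt j + hwt l) * (x j * y l))) :
    (∀ k, Summable fun j => ‖m j (k - j)‖) ∧
    ∑' k, (pwt r k * ‖ewt σ k • ∑' j, m j (k - j)‖ₑ) ^ 2 ≤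
      C ^ 2 * hconst * ((∑' k, x k ^ 2) * ∑' k, y k ^ 2) := by
  have hm' : ∀ k j, pwt r k * ‖ewt σ k • m j (k - j)‖ₑ ≤
      C * ((hwt j + hwt (k - j)) * (x j * y (k - j))) := by
    intro k j
    have := hm j (k - j)
    rwa [add_sub_cancel] at this
  have hfin : ∑' k, (∑' j, C * ((hwt j + hwt (k - j)) * (x j * y (k - j)))) ^ 2 ≤
      C ^ 2 * hconst * ((∑' k, x k ^ 2) * ∑' k, y k ^ 2) := by
    simp only [ENNReal.tsum_mul_left, mul_pow]
    rw [mul_assoc]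
    gcongr
    exact tsum_conv_hwt_sq_le x y
  have htop : C ^ 2 * hconst * ((∑' k, x k ^ 2) * ∑' k, y k ^ 2) ≠ ⊤ :=
    ENNReal.mul_ne_top (ENNReal.mul_ne_top (ENNReal.pow_ne_top hC) hconst_ne_top)
      (ENNReal.mul_ne_top hx hy)
  have hle : ∀ k, ∑' j, pwt r k * ‖ewt σ k • m j (k - j)‖ₑ ≤
      ∑' j, C * ((hwt j + hwt (k - j)) * (x j * y (k - j))) := fun k =>
    ENNReal.tsum_le_tsum fun j => hm' k j
  refine ⟨fun k => summable_norm_of_tsum_enorm ?_, ?_⟩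
  · have h1 : (∑' j, C * ((hwt j + hwt (k - j)) * (x j * y (k - j)))) ^ 2 ≠ ⊤ :=
      ne_top_of_le_ne_top htop ((ENNReal.le_tsum k).trans hfin)
    have h2 : ∑' j, C * ((hwt j + hwt (k - j)) * (x j * y (k - j))) ≠ ⊤ := by
      intro h; rw [h] at h1; exact h1 (by simp)
    -- Both weights are at least one, so they may be dropped to obtain plain absolute summability.
    refine ne_top_of_le_ne_top h2 ((ENNReal.tsum_le_tsum fun j => ?_).trans (hle k))
    rw [enorm_smul]
    exact (le_mul_of_one_le_left zero_le (one_le_enorm_ewt hσ k)).trans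
      (le_mul_of_one_le_left zero_le (one_le_pwt r k))
  · refine (ENNReal.tsum_le_tsum fun k => ?_).trans hfin
    gcongr
    refine le_trans ?_ (hle k)
    rw [ENNReal.tsum_mul_left]
    gcongr
    simp only [enorm_smul]
    rw [ENNReal.tsum_mul_left]
    gcongr
    exact enorm_tsum_le_tsum_enorm

/-! ### The spaces `X_σ^n(𝕋)` -/

namespace XSpace

variable {n : ℕ} {σ : ℝ}

/-- The Fourier coefficients. -/
def coef (v : XSpace n σ) (k : ℤ) : ℂ := fcoef v.toFun k

lemma memLp (v : XSpace n σ) : MemLp v.toFun 2 muT := Lp.memLp (toL2 v)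

lemma enorm_sq (v : XSpace n σ) : ‖v‖ₑ ^ 2 = ∑' k, ‖(xWeight n σ k : ℂ) * v.coef k‖ₑ ^ 2 := by
  have h := lp.hasSum_norm (p := 2) (by norm_num) (toSeq v)
  norm_num at h
  have h' : HasSum (fun k => ‖(xWeight n σ k : ℂ) * v.coef k‖ ^ 2) (‖v‖ ^ 2) := h
  have e : ∀ x : ℝ, 0 ≤ x → ENNReal.ofReal x ^ 2 = ENNReal.ofReal (x ^ 2) := fun x hx =>
    (ENNReal.ofReal_pow hx 2).symm
  simp only [← ofReal_norm, e _ (norm_nonneg _)]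
  rw [← ENNReal.ofReal_tsum_of_nonneg (fun _ => by positivity) h'.summable, h'.tsum_eq]

lemma enorm_xWeight_mul_le (k : ℤ) (z : ℂ) :
    ‖(xWeight n σ k : ℂ) * z‖ₑ ≤ pwt n k * ‖ewt σ k • z‖ₑ := by
  rw [enorm_mul, enorm_smul, ← mul_assoc, enorm_ewt, pwt, ← ENNReal.ofReal_mul (by positivity)]
  gcongr
  rw [← ofReal_norm, Complex.norm_real, Real.norm_of_nonneg (xWeight_pos n σ k).le]
  unfold xWeight
  gcongr
  rw [Real.sqrt_le_left (by positivity), ← pow_mul, mul_comm, pow_mul]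
  gcongr
  nlinarith [abs_nonneg (k : ℝ), sq_abs (k : ℝ)]

/-- The inequality `(1 + |k|)² ≤ 4 (1 + k²)` makes the weight of the norm comparable with `pwt`
times `ewt`, up to `2^n`. -/
lemma le_enorm_xWeight_mul (k : ℤ) (z : ℂ) :
    pwt n k * ‖ewt σ k • z‖ₑ ≤ 2 ^ n * ‖(xWeight n σ k : ℂ) * z‖ₑ := by
  rw [enorm_mul, enorm_smul, ← mul_assoc, enorm_ewt, pwt, ← ENNReal.ofReal_mul (by positivity),
    ← mul_assoc]
  gcongr
  rw [← ofReal_norm, Complex.norm_real, Real.norm_of_nonneg (xWeight_pos n σ k).le]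
  have e : (2 : ℝ≥0∞) ^ n = ENNReal.ofReal (2 ^ n) := by
    rw [ENNReal.ofReal_pow (by norm_num)]; norm_num
  rw [e, ← ENNReal.ofReal_mul (by positivity)]
  refine ENNReal.ofReal_le_ofReal ?_
  unfold xWeight
  rw [← mul_assoc]
  gcongr
  have h1 : (1 + |(k : ℝ)|) ^ n = √(((1 + |(k : ℝ)|) ^ 2) ^ n) := by
    rw [← pow_mul, mul_comm, pow_mul, Real.sqrt_sq (by positivity)]
  have h2 : (2 : ℝ) ^ n = √((2 ^ 2) ^ n) := by
    rw [← pow_mul, mul_comm, pow_mul, Real.sqrt_sq (by positivity)]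
  rw [h1, h2, ← Real.sqrt_mul (by positivity), ← mul_pow]
  refine Real.sqrt_le_sqrt ?_
  gcongr
  nlinarith [abs_nonneg (k : ℝ), sq_abs (k : ℝ), sq_nonneg (|(k : ℝ)| - 1)]

lemma tsum_sq_le (v : XSpace n σ) :
    ∑' k, (pwt n k * ‖ewt σ k • v.coef k‖ₑ) ^ 2 ≤ (2 ^ n) ^ 2 * ‖v‖ₑ ^ 2 := by
  rw [enorm_sq, ← ENNReal.tsum_mul_left]
  refine ENNReal.tsum_le_tsum fun k => ?_
  rw [← mul_pow]
  exact pow_le_pow_left₀ zero_le (le_enorm_xWeight_mul k _) 2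

lemma summable_of_pwt (hn : 1 ≤ n) (hσ : 0 ≤ σ) {x : ℤ → ℂ}
    (h : ∑' k, (pwt n k * ‖ewt σ k • x k‖ₑ) ^ 2 ≠ ⊤) : Summable fun k => ‖x k‖ := by
  refine summable_norm_of_tsum_enorm (ne_top_of_le_ne_top (tsum_ne_top_of_pwt hn h) ?_)
  refine ENNReal.tsum_le_tsum fun k => ?_
  rw [enorm_smul]
  exact le_mul_of_one_le_left zero_le (one_le_enorm_ewt hσ k)

lemma summable_coef (hn : 1 ≤ n) (hσ : 0 ≤ σ) (v : XSpace n σ) :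
    Summable fun k => ‖v.coef k‖ :=
  summable_of_pwt hn hσ (ne_top_of_le_ne_top
    (ENNReal.mul_ne_top (by simp) (ENNReal.pow_ne_top enorm_ne_top)) (tsum_sq_le v))

lemma ae_eq_fsum_coef (hn : 1 ≤ n) (hσ : 0 ≤ σ) (v : XSpace n σ) :
    v.toFun =ᵐ[muT] fsum v.coef := ae_eq_fsum v.memLp (summable_coef hn hσ v)

lemma exists_of_coef (hn : 1 ≤ n) (hσ : 0 ≤ σ) {x : ℤ → ℂ} {B : ℝ≥0∞} (hB : B ≠ ⊤)
    (h : ∑' k, (pwt n k * ‖ewt σ k • x k‖ₑ) ^ 2 ≤ B) :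
    ∃ v : XSpace n σ, v.coef = x ∧ ‖v‖ₑ ^ 2 ≤ B := by
  have hs := summable_of_pwt hn hσ (ne_top_of_le_ne_top hB h)
  have hc : ∀ k, fcoef ((memLp_fsum hs).toLp _) k = x k := fun k => by
    rw [fcoef_congr (memLp_fsum hs).coeFn_toLp k, fcoef_fsum hs k]
  have hle : ∑' k, ‖(xWeight n σ k : ℂ) * x k‖ₑ ^ 2 ≤ B :=
    (ENNReal.tsum_le_tsum fun k => by gcongr; exact enorm_xWeight_mul_le k _).trans h
  have hm : (memLp_fsum hs).toLp _ ∈ XSub n σ := by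
    change Memℓp _ 2
    simp only [hc]
    have h1 := ENNReal.summable_toReal (ne_top_of_le_ne_top hB hle)
    refine memℓp_gen ?_
    simpa [ENNReal.toReal_pow, ENNReal.toReal_mul] using h1
  let v : XSpace n σ := ⟨_, hm⟩
  have hv : v.coef = x := funext hc
  refine ⟨v, hv, ?_⟩
  rw [enorm_sq, hv]
  exact hle

lemma ext_coef {v w : XSpace n σ} (h : v.coef = w.coef) : v = w := by
  have hae : v.toFun =ᵐ[muT] w.toFun := ae_eq_of_fcoef v.memLp w.memLp (congrFun h)
  exact Subtype.ext (Lp.ext hae)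

/-- The isometry onto `ℓ²`. -/
def toSeqEquiv (hn : 1 ≤ n) (hσ : 0 ≤ σ) : XSpace n σ ≃ₗᵢ[ℂ] lp (fun _ : ℤ => ℂ) 2 := by
  refine LinearIsometryEquiv.ofSurjective ⟨toSeq, fun _ => rfl⟩ fun z => ?_
  have hz : ∑' k, ‖z k‖ₑ ^ 2 ≠ ⊤ := by
    have h := (lp.hasSum_norm (p := 2) (by norm_num) z).summable
    norm_num at h
    have e : ∀ k, ‖z k‖ₑ ^ 2 = ENNReal.ofReal (‖z k‖ ^ 2) := fun k => by
      rw [← ofReal_norm, ENNReal.ofReal_pow (norm_nonneg _)]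
    simp only [e]
    rw [← ENNReal.ofReal_tsum_of_nonneg (fun _ => by positivity) h]
    exact ENNReal.ofReal_ne_top
  have hw : ∀ k, (xWeight n σ k : ℂ) ≠ 0 := fun k => by exact_mod_cast (xWeight_pos n σ k).ne'
  obtain ⟨v, hv, -⟩ := exists_of_coef (σ := σ) hn hσ (x := fun k => (xWeight n σ k : ℂ)⁻¹ * z k)
    (B := (2 ^ n) ^ 2 * ∑' k, ‖z k‖ₑ ^ 2) (ENNReal.mul_ne_top (by simp) hz) (by
      rw [← ENNReal.tsum_mul_left]
      refine ENNReal.tsum_le_tsum fun k => ?_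
      rw [← mul_pow]
      refine pow_le_pow_left₀ zero_le ((le_enorm_xWeight_mul k _).trans_eq ?_) 2
      rw [mul_inv_cancel_left₀ (hw k)])
  refine ⟨v, ?_⟩
  ext k
  change (xWeight n σ k : ℂ) * v.coef k = z k
  rw [hv, mul_inv_cancel_left₀ (hw k)]

lemma completeSpace (hn : 1 ≤ n) (hσ : 0 ≤ σ) : CompleteSpace (XSpace n σ) :=
  (toSeqEquiv hn hσ).toIsometryEquiv.completeSpace_iff.mpr inferInstance

end XSpace

/-! ### Products of Fourier coefficients -/

lemma weight_mul_le {σ : ℝ} (hσ : 0 ≤ σ) (r : ℕ) (j l : ℤ) (a : ℝ≥0∞) :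
    pwt r (j + l) * (‖ewt σ (j + l)‖ₑ * a) ≤
      2 ^ r * (pwt r j * (‖ewt σ j‖ₑ * ‖ewt σ l‖ₑ * a) +
        pwt r l * (‖ewt σ j‖ₑ * ‖ewt σ l‖ₑ * a)) := by
  rw [← add_mul, ← mul_assoc (2 ^ r)]
  gcongr
  · exact pwt_add_le r j l
  · exact enorm_ewt_add_le hσ j l

/-- The exponential weight at `j + l` factorises, and the polynomial weight is bounded by one at `j`
plus one at `l`. It then suffices to place these two separately; the extra factor 2 in `2 ^ (n + 1)`
is their sum. -/
lemma weight_smul_le {E : Type*} [NormedAddCommGroup E] [NormedSpace ℂ E] {σ : ℝ} (hσ : 0 ≤ σ)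
    {r n : ℕ} (hr : r ≤ n) {j l : ℤ} {z : E} {A T : ℝ≥0∞}
    (hA : ‖ewt σ j‖ₑ * ‖ewt σ l‖ₑ * ‖z‖ₑ ≤ A) (h1 : pwt r j * A ≤ T) (h2 : pwt r l * A ≤ T) :
    pwt r (j + l) * ‖ewt σ (j + l) • z‖ₑ ≤ 2 ^ (n + 1) * T := by
  rw [enorm_smul]
  refine (weight_mul_le hσ r j l _).trans ?_
  have hpow : (2 : ℝ≥0∞) ^ r ≤ 2 ^ n := pow_le_pow_right₀ (by norm_num) hr
  refine (mul_le_mul' hpow (add_le_add ((mul_le_mul_right hA _).trans h1)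
    ((mul_le_mul_right hA _).trans h2))).trans_eq ?_
  ring

/-- The first factor has all `n` powers available. If the weight falls on `l`, one of them pays for
`hwt j`. If it falls on `j`, the second factor pays for `hwt l` when `p < n`; otherwise there is no
weight to place and the first factor pays. -/
lemma half_bound {n p : ℕ} (hn : 1 ≤ n) {j l : ℤ} {a b x y : ℝ≥0∞} (hx : pwt n j * a ≤ x)
    (hy : pwt (n - p) l * b ≤ y) :
    pwt (n - p) j * (a * b) ≤ (hwt j + hwt l) * (x * y) ∧
      pwt (n - p) l * (a * b) ≤ (hwt j + hwt l) * (x * y) := by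
  have ha : a ≤ hwt j * x := (le_hwt_mul hn j a).trans (mul_le_mul_right hx _)
  have hb : b ≤ y := (le_mul_of_one_le_left zero_le (one_le_pwt _ l)).trans hy
  have hj : hwt j * (x * y) ≤ (hwt j + hwt l) * (x * y) := mul_le_mul_left le_self_add _
  have hl : hwt l * (x * y) ≤ (hwt j + hwt l) * (x * y) := mul_le_mul_left le_add_self _
  constructor
  · rcases Nat.eq_zero_or_pos (n - p) with h | h
    · rw [h, pwt_zero, one_mul]
      refine le_trans ?_ hj
      rw [← mul_assoc]
      exact mul_le_mul' ha hb
    · refine le_trans ?_ hl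
      rw [← mul_assoc, mul_left_comm]
      refine mul_le_mul' ((mul_le_mul_left (pwt_mono (by omega) j) a).trans hx) ?_
      exact (le_hwt_mul h l b).trans (mul_le_mul_right hy _)
  · refine le_trans ?_ hj
    calc pwt (n - p) l * (a * b) = a * (pwt (n - p) l * b) := by ring
      _ ≤ (hwt j * x) * y := mul_le_mul' ha hy
      _ = _ := by ring

lemma bound_XX {n : ℕ} (hn : 1 ≤ n) {σ : ℝ} (hσ : 0 ≤ σ) (x y : ℤ → ℂ) (j l : ℤ) :
    pwt n (j + l) * ‖ewt σ (j + l) • (x j * y l)‖ₑ ≤ 2 ^ (n + 1) * ((hwt j + hwt l) *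
      ((pwt n j * ‖ewt σ j • x j‖ₑ) * (pwt n l * ‖ewt σ l • y l‖ₑ))) := by
  have h := half_bound (p := 0) hn (le_refl (pwt n j * ‖ewt σ j • x j‖ₑ))
    (le_refl (pwt n l * ‖ewt σ l • y l‖ₑ))
  refine weight_smul_le hσ le_rfl (le_of_eq ?_) h.1 h.2
  rw [enorm_mul, enorm_smul, enorm_smul]
  ring

lemma bound_XK {n : ℕ} (hn : 1 ≤ n) {σ : ℝ} (hσ : 0 ≤ σ) (x : ℤ → ℂ) (G : ℕ → ℤ → HI) {p : ℕ}
    (hp : p ≤ n) (j l : ℤ) :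
    pwt (n - p) (j + l) * ‖ewt σ (j + l) • (x j • G p l)‖ₑ ≤ 2 ^ (n + 1) * ((hwt j + hwt l) *
      ((pwt n j * ‖ewt σ j • x j‖ₑ) *
        ∑ p ∈ Finset.range (n + 1), pwt (n - p) l * ‖ewt σ l • G p l‖ₑ)) := by
  have hy : pwt (n - p) l * ‖ewt σ l • G p l‖ₑ ≤
      ∑ p ∈ Finset.range (n + 1), pwt (n - p) l * ‖ewt σ l • G p l‖ₑ :=
    Finset.single_le_sum (f := fun p => pwt (n - p) l * ‖ewt σ l • G p l‖ₑ)
      (fun _ _ => zero_le) (Finset.mem_range.mpr (by omega))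
  have h := half_bound hn (le_refl (pwt n j * ‖ewt σ j • x j‖ₑ)) hy
  refine weight_smul_le hσ (Nat.sub_le n p) (le_of_eq ?_) h.1 h.2
  rw [enorm_smul, enorm_smul, enorm_smul]
  ring

/-- The combinatorial core of the algebra property: the term with `r` derivatives on the first and
`d` derivatives on the second factor. -/
lemma leibniz_bound {n r d : ℕ} (hn : 2 ≤ n) (hrd : r + d ≤ n) {j l : ℤ} {a b : ℕ → ℝ≥0∞}
    {x y T : ℝ≥0∞} (ha : ∀ p ≤ n, pwt (n - p) j * a p ≤ x) (hb : ∀ p ≤ n, pwt (n - p) l * b p ≤ y)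
    (h1 : d < n → T ≤ a r * (b d + b (d + 1))) (h2 : r < n → T ≤ (a r + a (r + 1)) * b d) :
    pwt (n - (r + d)) j * T ≤ 2 * ((hwt j + hwt l) * (x * y)) := by
  have hj : hwt j * (x * y) ≤ (hwt j + hwt l) * (x * y) := mul_le_mul_left le_self_add _
  have hl : hwt l * (x * y) ≤ (hwt j + hwt l) * (x * y) := mul_le_mul_left le_add_self _
  have hb' : ∀ p ≤ n, b p ≤ y := fun p hp =>
    (le_mul_of_one_le_left zero_le (one_le_pwt _ l)).trans (hb p hp)
  have hwta : ∀ e p, e + 1 + p ≤ n → pwt e j * a p ≤ hwt j * x := fun e p he => by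
    rw [← hwt_mul_pwt_succ, mul_assoc]
    exact mul_le_mul_right ((mul_le_mul_left (pwt_mono (by omega) j) _).trans (ha p (by omega))) _
  have hwtb : ∀ p, 1 + p ≤ n → b p ≤ hwt l * y := fun p hp =>
    (le_hwt_mul (by omega : 1 ≤ n - p) l (b p)).trans (mul_le_mul_right (hb p (by omega)) _)
  -- The Sobolev bound, which costs one radial derivative, goes to the second factor whenever that
  -- one has an order to spare.
  rcases lt_or_ge d n with hd | hd
  · refine (mul_le_mul_right (h1 hd) _).trans ?_
    rw [← mul_assoc]
    rcases Nat.eq_zero_or_pos d with h0 | h0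
    -- With `d = 0` the weight uses up the first factor, so `hwt l` must come from the second, whose
    -- profiles of orders `0` and `1` both lie below `n` because `2 ≤ n`.
    · subst h0
      refine le_trans ?_ (mul_le_mul_right hl 2)
      have e1 : pwt (n - (r + 0)) j * a r ≤ x := ha r (by omega)
      refine (mul_le_mul' e1 (add_le_add (hwtb 0 (by omega)) (hwtb (0 + 1) (by omega)))).trans_eq ?_
      ring
    -- For `d > 0` the weight `n - (r + d)` is less than the first factor allows, and the spare
    -- power pays for `hwt j`.
    · refine le_trans ?_ (mul_le_mul_right hj 2)
      refine (mul_le_mul' (hwta (n - (r + d)) r (by omega))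
        (add_le_add (hb' d (by omega)) (hb' (d + 1) (by omega)))).trans_eq ?_
      ring
  -- All derivatives fall on the second factor, so `r = 0` and no weight remains. The Sobolev bound
  -- goes to the first factor, and `2 ≤ n` leaves its orders `0` and `1` a power for `hwt j`.
  · have hdn : d = n := by omega
    have hr : r = 0 := by omega
    subst hr
    refine (mul_le_mul_right (h2 (by omega)) _).trans ?_
    refine le_trans ?_ (mul_le_mul_right hj 2)
    have e0 : n - (0 + d) = 0 := by omega
    rw [e0, ← mul_assoc, mul_add]
    refine (mul_le_mul' (add_le_add (hwta 0 0 (by omega)) (hwta 0 (0 + 1) (by omega)))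
      (hb' d (by omega))).trans_eq ?_
    ring

/-- The constant in the one dimensional product estimate. -/
def sconst (n : ℕ) (γ : ℝ) : ℝ≥0∞ := ENNReal.ofReal (2 + n + |γ|)

/-- The Sobolev constant `2 + |p - γ|` is dominated by `sconst n γ` uniformly in the order `p`. -/
lemma enorm_mulW_le {γ : ℝ} (hγ : 1 / 2 ≤ γ) {n p : ℕ} (hp : p < n) {f f' g : HI}
    (h : EulerRel (p - γ) f f') :
    ‖mulW γ f g‖ₑ ≤ sconst n γ * ((‖f‖ₑ + ‖f'‖ₑ) * ‖g‖ₑ) := by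
  have h1 := norm_mulW_le hγ (g := g) h.ae_bound
  have hp' : (p : ℝ) ≤ n := by exact_mod_cast hp.le
  have h2 : |(p : ℝ) - γ| ≤ n + |γ| := by
    refine (abs_sub _ _).trans ?_
    rw [Nat.abs_cast]
    linarith
  have h3 : ‖mulW γ f g‖ ≤ (2 + n + |γ|) * ((‖f‖ + ‖f'‖) * ‖g‖) := by
    refine h1.trans ?_
    rw [← mul_assoc]
    gcongr
    have : (1 : ℝ) ≤ 2 + n + |γ| := by
      have : (0 : ℝ) ≤ n := Nat.cast_nonneg n
      linarith [abs_nonneg γ]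
    nlinarith [norm_nonneg f, norm_nonneg f', abs_nonneg γ]
  unfold sconst
  rw [← ofReal_norm, ← ofReal_norm, ← ofReal_norm, ← ofReal_norm,
    ← ENNReal.ofReal_add (norm_nonneg _) (norm_nonneg _), ← ENNReal.ofReal_mul (by positivity),
    ← ENNReal.ofReal_mul (by positivity)]
  exact ENNReal.ofReal_le_ofReal h3

lemma bound_mulW {n : ℕ} (hn : 2 ≤ n) {γ : ℝ} (hγ : 1 / 2 ≤ γ) {σ : ℝ} (hσ : 0 ≤ σ)
    {F G : ℕ → ℤ → HI} (hF : ∀ k, ∀ p < n, EulerRel (p - γ) (F p k) (F (p + 1) k))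
    (hG : ∀ k, ∀ p < n, EulerRel (p - γ) (G p k) (G (p + 1) k)) {r d : ℕ} (hrd : r + d ≤ n)
    (j l : ℤ) :
    pwt (n - (r + d)) (j + l) * ‖ewt σ (j + l) • mulW γ (F r j) (G d l)‖ₑ ≤
      2 ^ (n + 1) * (sconst n γ * (2 * ((hwt j + hwt l) *
      ((∑ p ∈ Finset.range (n + 1), pwt (n - p) j * ‖ewt σ j • F p j‖ₑ) *
        ∑ p ∈ Finset.range (n + 1), pwt (n - p) l * ‖ewt σ l • G p l‖ₑ)))) := by
  have hsingle : ∀ (H : ℕ → ℤ → HI) (i : ℤ), ∀ p ≤ n, pwt (n - p) i * (‖ewt σ i‖ₑ * ‖H p i‖ₑ) ≤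
      ∑ p ∈ Finset.range (n + 1), pwt (n - p) i * ‖ewt σ i • H p i‖ₑ := by
    intro H i p hp
    rw [← enorm_smul]
    exact Finset.single_le_sum (f := fun p => pwt (n - p) i * ‖ewt σ i • H p i‖ₑ)
      (fun _ _ => zero_le) (Finset.mem_range.mpr (by omega))
  set x := ∑ p ∈ Finset.range (n + 1), pwt (n - p) j * ‖ewt σ j • F p j‖ₑ
  set y := ∑ p ∈ Finset.range (n + 1), pwt (n - p) l * ‖ewt σ l • G p l‖ₑ
  set a : ℕ → ℝ≥0∞ := fun p => ‖ewt σ j‖ₑ * ‖F p j‖ₑ with ha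
  set b : ℕ → ℝ≥0∞ := fun p => ‖ewt σ l‖ₑ * ‖G p l‖ₑ with hb
  set A := ‖ewt σ j‖ₑ * ‖ewt σ l‖ₑ * ‖mulW γ (F r j) (G d l)‖ₑ with hA
  have h1 : d < n → A ≤ sconst n γ * (a r * (b d + b (d + 1))) := fun hd => by
    have := enorm_mulW_le hγ hd (g := F r j) (hG l d hd)
    rw [mulW_comm] at this
    refine (mul_le_mul_right this _).trans_eq ?_
    simp only [ha, hb]
    ring
  have h2 : r < n → A ≤ sconst n γ * ((a r + a (r + 1)) * b d) := fun hr => by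
    have := enorm_mulW_le hγ hr (g := G d l) (hF j r hr)
    refine (mul_le_mul_right this _).trans_eq ?_
    simp only [ha, hb]
    ring
  have hs0 : sconst n γ ≠ 0 := by
    unfold sconst
    rw [Ne, ENNReal.ofReal_eq_zero, not_le]
    positivity
  have hst : sconst n γ ≠ ⊤ := ENNReal.ofReal_ne_top
  -- Removing the Sobolev constant brings both alternatives into the form required by
  -- `leibniz_bound`.
  set T := (sconst n γ)⁻¹ * A with hT
  have hAT : A = sconst n γ * T := by
    rw [hT, ← mul_assoc, ENNReal.mul_inv_cancel hs0 hst, one_mul]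
  have hT1 : ∀ z, A ≤ sconst n γ * z → T ≤ z := fun z hz => by
    rw [hT]
    refine (mul_le_mul_right hz _).trans_eq ?_
    rw [← mul_assoc, ENNReal.inv_mul_cancel hs0 hst, one_mul]
  refine weight_smul_le hσ (Nat.sub_le _ _) le_rfl ?_ ?_
  · rw [← hA, hAT, mul_left_comm]
    exact mul_le_mul_right (leibniz_bound hn hrd (hsingle F j) (hsingle G l)
      (fun hd => hT1 _ (h1 hd)) (fun hr => hT1 _ (h2 hr))) _
  -- The weight at `l` is the mirror image: the same combinatorial bound with the two factors
  -- exchanged.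
  · rw [← hA, hAT, mul_left_comm, add_comm r d, add_comm (hwt j), mul_comm x]
    exact mul_le_mul_right (leibniz_bound hn (by omega) (hsingle G l) (hsingle F j)
      (fun hr => (hT1 _ (h2 hr)).trans_eq (mul_comm _ _))
      (fun hd => (hT1 _ (h1 hd)).trans_eq (mul_comm _ _))) _

/-- The constant in `bound_leibW`. -/
def lconst (n : ℕ) (γ : ℝ) : ℝ≥0∞ := 2 ^ n * (2 ^ (n + 1) * (sconst n γ * 2))

lemma lconst_ne_top (n : ℕ) (γ : ℝ) : lconst n γ ≠ ⊤ := by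
  unfold lconst
  refine ENNReal.mul_ne_top (by simp) (ENNReal.mul_ne_top (by simp) (ENNReal.mul_ne_top ?_ ?_))
  · exact ENNReal.ofReal_ne_top
  · simp

/-- Each Leibniz term has the same bound, and the binomial coefficients sum to `2^p ≤ 2^n`. -/
lemma bound_leibW {n : ℕ} (hn : 2 ≤ n) {γ : ℝ} (hγ : 1 / 2 ≤ γ) {σ : ℝ} (hσ : 0 ≤ σ)
    {F G : ℕ → ℤ → HI} (hF : ∀ k, ∀ p < n, EulerRel (p - γ) (F p k) (F (p + 1) k))
    (hG : ∀ k, ∀ p < n, EulerRel (p - γ) (G p k) (G (p + 1) k)) {p : ℕ} (hp : p ≤ n)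
    (j l : ℤ) :
    pwt (n - p) (j + l) *
      ‖ewt σ (j + l) • leibW γ (fun r => F r j) (fun d => G d l) p‖ₑ ≤
      lconst n γ * ((hwt j + hwt l) *
      ((∑ p ∈ Finset.range (n + 1), pwt (n - p) j * ‖ewt σ j • F p j‖ₑ) *
        ∑ p ∈ Finset.range (n + 1), pwt (n - p) l * ‖ewt σ l • G p l‖ₑ)) := by
  set Z := (∑ p ∈ Finset.range (n + 1), pwt (n - p) j * ‖ewt σ j • F p j‖ₑ) *
        ∑ p ∈ Finset.range (n + 1), pwt (n - p) l * ‖ewt σ l • G p l‖ₑ with hZ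
  have h1 : pwt (n - p) (j + l) * ‖ewt σ (j + l) • leibW γ (fun r => F r j) (fun d => G d l) p‖ₑ ≤
      ∑ i ∈ Finset.HasAntidiagonal.antidiagonal p, (p.choose i.1 : ℝ≥0∞) *
        (2 ^ (n + 1) * (sconst n γ * (2 * ((hwt j + hwt l) * Z)))) := by
    unfold leibW
    rw [Finset.smul_sum]
    refine (mul_le_mul_right (enorm_sum_le _ _) _).trans ?_
    rw [Finset.mul_sum]
    refine Finset.sum_le_sum fun i hi => ?_
    have hi' := Finset.HasAntidiagonal.mem_antidiagonal.mp hi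
    have h2 := bound_mulW hn hγ hσ hF hG (by omega : i.1 + i.2 ≤ n) j l
    rw [hi'] at h2
    rw [← Nat.cast_smul_eq_nsmul ℂ, smul_comm, enorm_smul, mul_left_comm]
    refine mul_le_mul' (le_of_eq ?_) h2
    rw [← ofReal_norm]
    simp
  refine h1.trans ?_
  rw [← Finset.sum_mul]
  have h3 : ∑ i ∈ Finset.HasAntidiagonal.antidiagonal p, (p.choose i.1 : ℝ≥0∞) ≤ 2 ^ n := by
    rw [Finset.Nat.sum_antidiagonal_eq_sum_range_succ (fun i _ => (p.choose i : ℝ≥0∞)) p,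
      ← Nat.cast_sum, Nat.sum_range_choose]
    push_cast
    exact pow_le_pow_right₀ (by norm_num) hp
  refine (mul_le_mul_left h3 _).trans_eq ?_
  unfold lconst
  ring

end

noncomputable section

open scoped ENNReal

/-! ### Products: existence with given Fourier coefficients -/

lemma KSig.rel {n : ℕ} {γ σ : ℝ} (P : KSig n γ σ) (k : ℤ) :
    ∀ p < n, EulerRel (p - γ) (kc (base P).1 p k) (kc (base P).1 (p + 1) k) :=
  ((mem_KSpace_iff _).mp (base P).2).2 k

lemma KSig.tsum_ne_top {n : ℕ} {γ σ : ℝ} (P : KSig n γ σ) :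
    ∑' k, (∑ p ∈ Finset.range (n + 1), pwt (n - p) k * ‖ewt σ k • kc (base P).1 p k‖ₑ) ^ 2 ≠ ⊤ :=
  ne_top_of_le_ne_top (ENNReal.mul_ne_top (kconst_ne_top n) (ENNReal.pow_ne_top enorm_ne_top))
    P.tsum_sq_le

lemma XSpace.tsum_ne_top {n : ℕ} {σ : ℝ} (v : XSpace n σ) :
    ∑' k, (pwt n k * ‖ewt σ k • v.coef k‖ₑ) ^ 2 ≠ ⊤ :=
  ne_top_of_le_ne_top (ENNReal.mul_ne_top (by simp) (ENNReal.pow_ne_top enorm_ne_top)) v.tsum_sq_le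

lemma XSpace.exists_mul {n : ℕ} (hn : 1 ≤ n) {σ : ℝ} (hσ : 0 ≤ σ) : ∃ C : ℝ≥0∞, C ≠ ⊤ ∧
    ∀ v w : XSpace n σ, ∃ z : XSpace n σ, z.coef = sconv v.coef w.coef ∧
      ‖z‖ₑ ^ 2 ≤ C * (‖v‖ₑ ^ 2 * ‖w‖ₑ ^ 2) := by
  have hC : ((2 : ℝ≥0∞) ^ (n + 1)) ^ 2 * hconst * ((2 ^ n) ^ 2 * (2 ^ n) ^ 2) ≠ ⊤ :=
    ENNReal.mul_ne_top (ENNReal.mul_ne_top (by simp) hconst_ne_top)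
      (ENNReal.mul_ne_top (by simp) (by simp))
  refine ⟨_, hC, fun v w => ?_⟩
  have h := (conv_bound hσ (by simp) v.tsum_ne_top w.tsum_ne_top
    (bound_XX hn hσ v.coef w.coef)).2
  refine exists_of_coef hn hσ (ENNReal.mul_ne_top hC (ENNReal.mul_ne_top
    (ENNReal.pow_ne_top enorm_ne_top) (ENNReal.pow_ne_top enorm_ne_top))) (h.trans ?_)
  refine (mul_le_mul_right (mul_le_mul' v.tsum_sq_le w.tsum_sq_le) _).trans_eq ?_
  ring

/-- A factor depending on the angle alone commutes with radial differentiation, so at every order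
the profiles of the product are convolutions with the profiles of that same order. -/
lemma KSig.exists_smul {n : ℕ} (hn : 1 ≤ n) {γ σ : ℝ} (hσ : 0 ≤ σ) : ∃ C : ℝ≥0∞, C ≠ ⊤ ∧
    ∀ (v : XSpace n σ) (Q : KSig n γ σ), ∃ P : KSig n γ σ,
      (∀ k, HasSum (fun j => v.coef j • kc (base Q).1 0 (k - j)) (kc (base P).1 0 k)) ∧
      ‖P‖ₑ ^ 2 ≤ C * (‖v‖ₑ ^ 2 * ‖Q‖ₑ ^ 2) := by
  have hC0 : ((2 : ℝ≥0∞) ^ (n + 1)) ^ 2 * hconst * ((2 ^ n) ^ 2 * kconst n) ≠ ⊤ :=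
    ENNReal.mul_ne_top (ENNReal.mul_ne_top (by simp) hconst_ne_top)
      (ENNReal.mul_ne_top (by simp) (kconst_ne_top n))
  refine ⟨(Finset.univ : Finset (DIdx n)).card * _,
    ENNReal.mul_ne_top (ENNReal.natCast_ne_top _) hC0, fun v Q => ?_⟩
  have h := fun (p : ℕ) (hp : p ≤ n) => conv_bound hσ (by simp) v.tsum_ne_top Q.tsum_ne_top
    (bound_XK hn hσ v.coef (kc (base Q).1) hp)
  have hs : ∀ p ≤ n, ∀ k, Summable fun j => v.coef j • kc (base Q).1 p (k - j) :=
    fun p hp k => ((h p hp).1 k).of_norm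
  obtain ⟨P, hP, hPn⟩ := exists_of_kc (γ := γ) hσ
    (F := fun p k => ∑' j, v.coef j • kc (base Q).1 p (k - j))
    (B := ((2 : ℝ≥0∞) ^ (n + 1)) ^ 2 * hconst * ((2 ^ n) ^ 2 * kconst n) *
      (‖v‖ₑ ^ 2 * ‖Q‖ₑ ^ 2))
    (ENNReal.mul_ne_top hC0 (ENNReal.mul_ne_top
      (ENNReal.pow_ne_top enorm_ne_top) (ENNReal.pow_ne_top enorm_ne_top)))
    (fun k p hp => EulerRel.hasSum (hs p hp.le k).hasSum (hs (p + 1) hp k).hasSum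
      fun j => (Q.rel (k - j) p hp).smul _)
    (fun p hp => by
      refine (h p hp).2.trans ?_
      refine (mul_le_mul_right (mul_le_mul' v.tsum_sq_le Q.tsum_sq_le) _).trans_eq ?_
      ring)
  refine ⟨P, fun k => ?_, by rw [mul_assoc]; exact hPn⟩
  rw [hP 0 (Nat.zero_le n)]
  exact (hs 0 (Nat.zero_le n) k).hasSum

/-- The profiles of order `p` are convolutions of Leibniz sums. Their Euler relations hold termwise
and pass to the series by closedness, and `conv_bound` gives the weighted norms. The scalar
`(2π)^{-1/2}` compensates the normalisation of `cf`. -/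
lemma KSig.exists_mul {n : ℕ} (hn : 2 ≤ n) {γ σ : ℝ} (hγ : 1 / 2 ≤ γ) (hσ : 0 ≤ σ) :
    ∃ C : ℝ≥0∞, C ≠ ⊤ ∧ ∀ P Q : KSig n γ σ, ∃ R : KSig n γ σ,
      (∀ k, HasSum (fun j => (((√(2 * Real.pi))⁻¹ : ℝ) : ℂ) •
        mulW γ (kc (base P).1 0 j) (kc (base Q).1 0 (k - j))) (kc (base R).1 0 k)) ∧
      ‖R‖ₑ ^ 2 ≤ C * (‖P‖ₑ ^ 2 * ‖Q‖ₑ ^ 2) := by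
  set c : ℂ := (((√(2 * Real.pi))⁻¹ : ℝ) : ℂ) with hc
  have hC0 : ‖c‖ₑ ^ 2 * (lconst n γ ^ 2 * hconst * (kconst n * kconst n)) ≠ ⊤ :=
    ENNReal.mul_ne_top (ENNReal.pow_ne_top enorm_ne_top)
      (ENNReal.mul_ne_top (ENNReal.mul_ne_top (ENNReal.pow_ne_top (lconst_ne_top n γ))
        hconst_ne_top) (ENNReal.mul_ne_top (kconst_ne_top n) (kconst_ne_top n)))
  refine ⟨(Finset.univ : Finset (DIdx n)).card * _,
    ENNReal.mul_ne_top (ENNReal.natCast_ne_top _) hC0, fun P Q => ?_⟩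
  set T : ℕ → ℤ → ℤ → HI := fun p j l => leibW γ (fun r => kc (base P).1 r j)
    (fun d => kc (base Q).1 d l) p with hT
  have h := fun (p : ℕ) (hp : p ≤ n) => conv_bound hσ (lconst_ne_top n γ)
    P.tsum_ne_top Q.tsum_ne_top (bound_leibW hn hγ hσ P.rel Q.rel hp)
  have hs : ∀ p ≤ n, ∀ k, Summable fun j => T p j (k - j) :=
    fun p hp k => ((h p hp).1 k).of_norm
  obtain ⟨R, hR, hRn⟩ := exists_of_kc (γ := γ) hσ
    (F := fun p k => c • ∑' j, T p j (k - j))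
    (B := ‖c‖ₑ ^ 2 * (lconst n γ ^ 2 * hconst * (kconst n * kconst n)) *
      (‖P‖ₑ ^ 2 * ‖Q‖ₑ ^ 2))
    (ENNReal.mul_ne_top hC0 (ENNReal.mul_ne_top
      (ENNReal.pow_ne_top enorm_ne_top) (ENNReal.pow_ne_top enorm_ne_top)))
    (fun k p hp => (EulerRel.hasSum (hs p hp.le k).hasSum (hs (p + 1) hp k).hasSum
      fun j => eulerRel_leibW hγ (P.rel j) (Q.rel (k - j)) hp).smul c)
    (fun p hp => by
      have e : ∀ k, (pwt (n - p) k * ‖ewt σ k • c • ∑' j, T p j (k - j)‖ₑ) ^ 2 =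
          ‖c‖ₑ ^ 2 * (pwt (n - p) k * ‖ewt σ k • ∑' j, T p j (k - j)‖ₑ) ^ 2 := fun k => by
        rw [smul_comm, enorm_smul c]
        ring
      simp only [e]
      rw [ENNReal.tsum_mul_left, mul_assoc]
      refine mul_le_mul_right ((h p hp).2.trans ?_) _
      refine (mul_le_mul_right (mul_le_mul' P.tsum_sq_le Q.tsum_sq_le) _).trans_eq ?_
      ring)
  refine ⟨R, fun k => ?_, by rw [mul_assoc]; exact hRn⟩
  rw [hR 0 (Nat.zero_le n)]
  have h0 := (hs 0 (Nat.zero_le n) k).hasSum.const_smul c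
  simpa [hT, leibW] using h0

/-! ### Functions on `Π` with absolutely convergent angular Fourier series -/

/-- The function `f` has the absolutely convergent angular Fourier series with coefficients `c`. -/
def HasSlices (f : ℝ × ℝ → ℂ) (c : ℤ → ℝ → ℂ) : Prop :=
  ∀ᵐ s ∂muI, (Summable fun k => ‖c k s‖) ∧
    (fun t => f (s, t)) =ᵐ[muT] fsum fun k => c k s

lemma HasSlices.congr {f : ℝ × ℝ → ℂ} {c d : ℤ → ℝ → ℂ} (h : HasSlices f c)
    (hcd : ∀ k, ∀ᵐ s ∂muI, c k s = d k s) : HasSlices f d := by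
  filter_upwards [h, ae_all_iff.mpr hcd] with s hs he
  simp only [← he]
  exact hs

lemma HasSlices.mul {f g : ℝ × ℝ → ℂ} {c d : ℤ → ℝ → ℂ} (hf : HasSlices f c)
    (hg : HasSlices g d) : HasSlices (fun x => f x * g x)
      fun k s => ∑' j, c j s * d (k - j) s := by
  filter_upwards [hf, hg] with s hs hs'
  change (Summable fun k => ‖sconv (fun j => c j s) (fun j => d j s) k‖) ∧
    _ =ᵐ[muT] fsum (sconv (fun j => c j s) (fun j => d j s))
  refine ⟨summable_norm_sconv hs.1 hs'.1, ?_⟩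
  filter_upwards [hs.2, hs'.2] with t ht ht'
  rw [ht, ht', ← fsum_mul hs.1 hs'.1]

lemma ae_eq_of_ae_slices {f g : ℝ × ℝ → ℂ} (hf : AEStronglyMeasurable f muPi)
    (hg : AEStronglyMeasurable g muPi)
    (h : ∀ᵐ s ∂muI, (fun t => f (s, t)) =ᵐ[muT] fun t => g (s, t)) : f =ᵐ[muPi] g := by
  have hV : hf.mk f =ᵐ[muPi] hg.mk g := by
    have hmeas : MeasurableSet {x | hf.mk f x = hg.mk g x} :=
      hf.stronglyMeasurable_mk.measurableSet_eq_fun hg.stronglyMeasurable_mk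
    refine (Measure.ae_prod_mem_iff_ae_ae_mem hmeas).mpr ?_
    filter_upwards [h, ae_ae_slice hf.ae_eq_mk, ae_ae_slice hg.ae_eq_mk] with s hs h1 h2
    filter_upwards [hs, h1, h2] with t ht h1 h2
    rw [← h1, ht, h2]
  exact hf.ae_eq_mk.trans (hV.trans hg.ae_eq_mk.symm)

/-- This identifies an element constructed from its coefficients with the pointwise product of two
functions. -/
lemma HasSlices.ae_eq {f g : ℝ × ℝ → ℂ} {c : ℤ → ℝ → ℂ} (hf : HasSlices f c)
    (hg : HasSlices g c) (hfm : AEStronglyMeasurable f muPi)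
    (hgm : AEStronglyMeasurable g muPi) : f =ᵐ[muPi] g := by
  refine ae_eq_of_ae_slices hfm hgm ?_
  filter_upwards [hf, hg] with s hs hs'
  exact hs.2.trans hs'.2.symm

/-- A sequence of partial sums of the `L²` series converges almost everywhere, and pointwise
summability identifies its limit. -/
lemma ae_eq_tsum {g : ℤ → HI} {G : HI} (h : HasSum g G)
    (hs : ∀ᵐ s ∂muI, Summable fun j => g j s) : ∀ᵐ s ∂muI, G s = ∑' j, g j s := by
  have hm : TendstoInMeasure muI (fun (S : Finset ℤ) => ((∑ j ∈ S, g j : HI) : ℝ → ℂ))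
      Filter.atTop G := tendstoInMeasure_of_tendsto_Lp h
  obtain ⟨ns, hns, hlim⟩ := hm.exists_seq_tendsto_ae'
  have hsum : ∀ᵐ s ∂muI, ∀ S : Finset ℤ, (∑ j ∈ S, g j : HI) s = ∑ j ∈ S, g j s := by
    refine ae_all_iff.mpr fun S => ?_
    filter_upwards [Lp.coeFn_finsetSum S g] with s h1
    rw [h1, Finset.sum_apply]
  filter_upwards [hs, hlim, hsum] with s h1 h2 h3
  simp only [h3] at h2
  exact tendsto_nhds_unique h2 (h1.hasSum.comp hns)

lemma XSpace.hasSlices {n : ℕ} (hn : 1 ≤ n) {σ : ℝ} (hσ : 0 ≤ σ) (v : XSpace n σ) :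
    HasSlices (fun x => v.toFun x.2) fun k _ => v.coef k :=
  Filter.Eventually.of_forall fun _ => ⟨v.summable_coef hn hσ, v.ae_eq_fsum_coef hn hσ⟩

lemma XSpace.aestronglyMeasurable {n : ℕ} {σ : ℝ} (v : XSpace n σ) :
    AEStronglyMeasurable (fun x : ℝ × ℝ => v.toFun x.2) muPi :=
  v.memLp.1.comp_quasiMeasurePreserving Measure.quasiMeasurePreserving_snd

lemma aestronglyMeasurable_wmul (c : ℝ) {U : ℝ × ℝ → ℂ} (hU : AEStronglyMeasurable U muPi) :
    AEStronglyMeasurable (wmul c U) muPi := by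
  refine AEStronglyMeasurable.mul ?_ hU
  exact (Complex.measurable_ofReal.comp (measurable_fst.pow_const c)).aestronglyMeasurable

lemma KSpace.aestronglyMeasurable {n : ℕ} {γ : ℝ} (U : KSpace n γ) :
    AEStronglyMeasurable (kFun U) muPi := aestronglyMeasurable_wmul γ (Lp.aestronglyMeasurable _)

namespace KSig

variable {n : ℕ} {γ σ : ℝ}

lemma summable_norm_kc (hσ : 0 ≤ σ) (P : KSig n γ σ) {p : ℕ} (hp : p < n) :
    Summable fun k => ‖kc (base P).1 p k‖ := by
  refine summable_norm_of_tsum_enorm (tsum_ne_top_of_pwt (r := n - p) (by omega) ?_)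
  refine ne_top_of_le_ne_top P.tsum_ne_top (ENNReal.tsum_le_tsum fun k => ?_)
  refine pow_le_pow_left₀ zero_le ?_ 2
  refine le_trans (mul_le_mul_right ?_ _) (Finset.single_le_sum
    (f := fun p => pwt (n - p) k * ‖ewt σ k • kc (base P).1 p k‖ₑ)
    (fun _ _ => zero_le) (Finset.mem_range.mpr (by omega : p < n + 1)))
  rw [enorm_smul]
  exact le_mul_of_one_le_left zero_le (one_le_enorm_ewt hσ k)

/-- The Sobolev bound dominates the values at `s` by the norms of the profiles of orders `0` and
`1`; these norms are summable in `k` since both orders are below `n`. -/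
lemma ae_summable (hn : 2 ≤ n) (hσ : 0 ≤ σ) (P : KSig n γ σ) :
    ∀ᵐ s ∂muI, Summable fun k => ‖kc (base P).1 0 k s‖ := by
  have h0 := P.summable_norm_kc hσ (by omega : 0 < n)
  have h1 := P.summable_norm_kc hσ (by omega : 0 + 1 < n)
  have hb := ae_all_iff.mpr fun k => (P.rel k 0 (by omega)).ae_bound
  filter_upwards [hb, ae_mem_muI] with s hs hm
  have hpos : 0 < √s := Real.sqrt_pos.mpr hm.1
  refine .of_nonneg_of_le (fun _ => norm_nonneg _) (fun k => ?_)
    (((h0.mul_left (2 + |((0 : ℕ) : ℝ) - γ|)).add h1).mul_left (√s)⁻¹)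
  rw [← div_eq_inv_mul, le_div_iff₀' hpos]
  exact hs k

/-- The slice coefficients. -/
def slice (P : KSig n γ σ) (k : ℤ) (s : ℝ) : ℂ :=
  ((s ^ γ : ℝ) : ℂ) * ((√(2 * Real.pi))⁻¹ * kc (base P).1 0 k s)

lemma hasSlices (hn : 2 ≤ n) (hσ : 0 ≤ σ) (P : KSig n γ σ) :
    HasSlices (kFun (base P)) P.slice := by
  have hU : MemLp ((base P).1 (DIdx.zero n)) 2 muPi := Lp.memLp _
  have h2 : ∀ᵐ s ∂muI, MemLp (fun t => kFun (base P) (s, t)) 2 muT := by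
    have hi := (memLp_two_iff_integrable_sq_norm hU.1).mp hU
    have hm : ∀ᵐ s ∂muI, AEStronglyMeasurable
      (fun t => ((base P).1 (DIdx.zero n)) (s, t)) muT := hU.1.prodMk_left
    filter_upwards [hi.prod_right_ae, hm] with s hs hms
    exact ((memLp_two_iff_integrable_sq_norm hms).mpr hs).const_mul ((s ^ γ : ℝ) : ℂ)
  filter_upwards [h2, P.ae_summable hn hσ, ae_all_iff.mpr (kFun_slice (base P))] with s hs h1 he
  have hsum : Summable fun k => ‖P.slice k s‖ := by
    simp only [slice, norm_mul]
    exact (h1.mul_left _).mul_left _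
  have he' : fcoef (fun t => kFun (base P) (s, t)) = fun k => P.slice k s := by
    funext k
    rw [he k, slice]
  refine ⟨hsum, ?_⟩
  rw [← he']
  exact ae_eq_fsum hs (by rw [he']; exact hsum)

end KSig

/-! ### Products of functions -/

lemma XSpace.mul_ae_eq {n : ℕ} (hn : 1 ≤ n) {σ : ℝ} (hσ : 0 ≤ σ) {v w z : XSpace n σ}
    (h : z.coef = sconv v.coef w.coef) :
    z.toFun =ᵐ[muT] fun t => v.toFun t * w.toFun t := by
  filter_upwards [z.ae_eq_fsum_coef hn hσ, v.ae_eq_fsum_coef hn hσ, w.ae_eq_fsum_coef hn hσ]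
    with t h1 h2 h3
  rw [h1, h2, h3, h, fsum_mul (v.summable_coef hn hσ) (w.summable_coef hn hσ)]

lemma KSig.smul_ae_eq {n : ℕ} (hn : 2 ≤ n) {γ σ : ℝ} (hσ : 0 ≤ σ) {v : XSpace n σ}
    {P Q : KSig n γ σ}
    (h : ∀ k, HasSum (fun j => v.coef j • kc (base Q).1 0 (k - j)) (kc (base P).1 0 k)) :
    kFun (base P) =ᵐ[muPi] fun x => v.toFun x.2 * kFun (base Q) x := by
  have hn1 : 1 ≤ n := by omega
  refine (P.hasSlices hn hσ).ae_eq (((v.hasSlices hn1 hσ).mul (Q.hasSlices hn hσ)).congr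
    fun k => ?_) (KSpace.aestronglyMeasurable _)
    (v.aestronglyMeasurable.mul (KSpace.aestronglyMeasurable _))
  have hco : ∀ᵐ s ∂muI, ∀ j, (v.coef j • kc (base Q).1 0 (k - j) : HI) s =
      v.coef j * kc (base Q).1 0 (k - j) s :=
    ae_all_iff.mpr fun j => Lp.coeFn_smul (v.coef j) (kc (base Q).1 0 (k - j))
  have hs : ∀ᵐ s ∂muI, Summable fun j => (v.coef j • kc (base Q).1 0 (k - j) : HI) s := by
    filter_upwards [Q.ae_summable hn hσ, hco] with s h1 h2
    simp only [h2]
    exact ((summable_norm_mul_conv (v.summable_coef hn1 hσ) h1).prod_factor k).of_norm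
  filter_upwards [ae_eq_tsum (h k) hs, hco] with s h1 h2
  simp only [slice]
  rw [h1, ← tsum_mul_left, ← tsum_mul_left]
  refine tsum_congr fun j => ?_
  rw [h2]
  ring

lemma KSig.mul_ae_eq {n : ℕ} (hn : 2 ≤ n) {γ σ : ℝ} (hγ : 1 / 2 ≤ γ) (hσ : 0 ≤ σ)
    {P Q R : KSig n γ σ}
    (h : ∀ k, HasSum (fun j => (((√(2 * Real.pi))⁻¹ : ℝ) : ℂ) •
        mulW γ (kc (base P).1 0 j) (kc (base Q).1 0 (k - j))) (kc (base R).1 0 k)) :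
    kFun (base R) =ᵐ[muPi] fun x => kFun (base P) x * kFun (base Q) x := by
  refine (R.hasSlices hn hσ).ae_eq (((P.hasSlices hn hσ).mul (Q.hasSlices hn hσ)).congr
    fun k => ?_) (KSpace.aestronglyMeasurable _)
    ((KSpace.aestronglyMeasurable _).mul (KSpace.aestronglyMeasurable _))
  have hco : ∀ᵐ s ∂muI, ∀ j, ((((√(2 * Real.pi))⁻¹ : ℝ) : ℂ) •
      mulW γ (kc (base P).1 0 j) (kc (base Q).1 0 (k - j)) : HI) s =
      (((√(2 * Real.pi))⁻¹ : ℝ) : ℂ) * (((s ^ γ : ℝ) : ℂ) *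
        (kc (base P).1 0 j s * kc (base Q).1 0 (k - j) s)) := by
    refine ae_all_iff.mpr fun j => ?_
    filter_upwards [Lp.coeFn_smul (((√(2 * Real.pi))⁻¹ : ℝ) : ℂ)
      (mulW γ (kc (base P).1 0 j) (kc (base Q).1 0 (k - j))),
      coeFn_mulW hγ (g := kc (base Q).1 0 (k - j)) (P.rel j 0 (by omega)).ae_bound] with s h1 h2
    rw [h1, Pi.smul_apply, h2, smul_eq_mul]
  have hs : ∀ᵐ s ∂muI, Summable fun j => ((((√(2 * Real.pi))⁻¹ : ℝ) : ℂ) •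
      mulW γ (kc (base P).1 0 j) (kc (base Q).1 0 (k - j)) : HI) s := by
    filter_upwards [P.ae_summable hn hσ, Q.ae_summable hn hσ, hco] with s h1 h1' h2
    simp only [h2]
    exact ((((summable_norm_mul_conv h1 h1').prod_factor k).of_norm).mul_left _).mul_left _
  filter_upwards [ae_eq_tsum (h k) hs, hco] with s h1 h2
  simp only [slice]
  rw [h1, ← tsum_mul_left, ← tsum_mul_left]
  refine tsum_congr fun j => ?_
  rw [h2]
  ring

end

/-! ### The multiplication on `J_{0,γ}^{n,σ}(Π)`. -/

noncomputable section

open scoped ENNReal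

/-- A bounded bilinear operation which is specified by a functional relation. -/
lemma exists_bilinear {E F G : Type*} [NormedAddCommGroup E] [NormedSpace ℂ E]
    [NormedAddCommGroup F] [NormedSpace ℂ F] [NormedAddCommGroup G] [NormedSpace ℂ G]
    {R : E → F → G → Prop} (huniq : ∀ x y z z', R x y z → R x y z' → z = z')
    (hadd₁ : ∀ x x' y z z', R x y z → R x' y z' → R (x + x') y (z + z'))
    (hadd₂ : ∀ x y y' z z', R x y z → R x y' z' → R x (y + y') (z + z'))
    (hsmul₁ : ∀ (c : ℂ) x y z, R x y z → R (c • x) y (c • z))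
    (hsmul₂ : ∀ (c : ℂ) x y z, R x y z → R x (c • y) (c • z))
    {C : ℝ} (hex : ∀ x y, ∃ z, R x y z ∧ ‖z‖ ≤ C * ‖x‖ * ‖y‖) :
    ∃ B : E →L[ℂ] F →L[ℂ] G, ∀ x y, R x y (B x y) := by
  choose f hf hn using hex
  refine ⟨LinearMap.mkContinuous₂ (LinearMap.mk₂ ℂ f ?_ ?_ ?_ ?_) C hn, fun x y => hf x y⟩
  · exact fun x x' y => huniq _ _ _ _ (hf _ _) (hadd₁ _ _ _ _ _ (hf x y) (hf x' y))
  · exact fun c x y => huniq _ _ _ _ (hf _ _) (hsmul₁ _ _ _ _ (hf x y))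
  · exact fun x y y' => huniq _ _ _ _ (hf _ _) (hadd₂ _ _ _ _ _ (hf x y) (hf x y'))
  · exact fun c x y => huniq _ _ _ _ (hf _ _) (hsmul₂ _ _ _ _ (hf x y))

lemma norm_le_of_enorm_sq_le {E F G : Type*} [NormedAddCommGroup E] [NormedAddCommGroup F]
    [NormedAddCommGroup G] {x : E} {y : F} {z : G} {C : ℝ≥0∞} (hC : C ≠ ⊤)
    (h : ‖z‖ₑ ^ 2 ≤ C * (‖x‖ₑ ^ 2 * ‖y‖ₑ ^ 2)) : ‖z‖ ≤ √C.toReal * (‖x‖ * ‖y‖) := by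
  have h1 := ENNReal.toReal_mono (ENNReal.mul_ne_top hC (ENNReal.mul_ne_top
    (ENNReal.pow_ne_top enorm_ne_top) (ENNReal.pow_ne_top enorm_ne_top))) h
  simp only [ENNReal.toReal_mul, ENNReal.toReal_pow, toReal_enorm] at h1
  refine abs_le_of_sq_le_sq' ?_ (by positivity) |>.2
  rw [mul_pow, Real.sq_sqrt ENNReal.toReal_nonneg, mul_pow]
  exact h1

lemma ae_muPi_snd {p : ℝ → Prop} (h : ∀ᵐ t ∂muT, p t) : ∀ᵐ x ∂muPi, p x.2 :=
  Measure.quasiMeasurePreserving_snd.ae h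

namespace XSpace

variable {n : ℕ} {σ : ℝ}

lemma ext_ae {v w : XSpace n σ} (h : v.toFun =ᵐ[muT] w.toFun) : v = w :=
  Subtype.ext (Lp.ext h)

lemma toFun_add (v w : XSpace n σ) : (v + w).toFun =ᵐ[muT] fun t => v.toFun t + w.toFun t :=
  Lp.coeFn_add (toL2 v) (toL2 w)

lemma toFun_smul (c : ℂ) (v : XSpace n σ) : (c • v).toFun =ᵐ[muT] fun t => c * v.toFun t :=
  Lp.coeFn_smul c (toL2 v)

lemma toFun_one : (one n σ).toFun =ᵐ[muT] fun _ => 1 :=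
  MemLp.coeFn_toLp (memLp_const 1)

end XSpace

namespace KSig

variable {n : ℕ} {γ σ : ℝ}

/-- The underlying function on `Π`. -/
def fn (P : KSig n γ σ) : ℝ × ℝ → ℂ := kFun (base P)

lemma fn_add (P Q : KSig n γ σ) : (P + Q).fn =ᵐ[muPi] fun x => P.fn x + Q.fn x := by
  filter_upwards [Lp.coeFn_add ((base P).1 (DIdx.zero n)) ((base Q).1 (DIdx.zero n))] with x hx
  have : (P + Q).fn x = ((x.1 ^ γ : ℝ) : ℂ) *
    ((base P).1 (DIdx.zero n) + (base Q).1 (DIdx.zero n) : Lp ℂ 2 muPi) x := rfl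
  rw [this, hx, Pi.add_apply, mul_add]
  rfl

lemma fn_smul (c : ℂ) (P : KSig n γ σ) : (c • P).fn =ᵐ[muPi] fun x => c * P.fn x := by
  filter_upwards [Lp.coeFn_smul c ((base P).1 (DIdx.zero n))] with x hx
  have : (c • P).fn x = ((x.1 ^ γ : ℝ) : ℂ) *
    (c • (base P).1 (DIdx.zero n) : Lp ℂ 2 muPi) x := rfl
  rw [this, hx, Pi.smul_apply, smul_eq_mul, mul_left_comm]
  rfl

lemma fn_zero : (0 : KSig n γ σ).fn =ᵐ[muPi] fun _ => 0 := by
  filter_upwards [fn_smul 0 (0 : KSig n γ σ)] with x hx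
  rw [zero_smul, zero_mul] at hx
  exact hx

lemma ext_ae {P Q : KSig n γ σ} (h : P.fn =ᵐ[muPi] Q.fn) : P = Q := by
  refine ext_kc fun k => Lp.ext ?_
  filter_upwards [kFun_slice (base P) k, kFun_slice (base Q) k, ae_ae_slice h, ae_mem_muI]
    with s h1 h2 h3 h4
  have h5 := fcoef_congr h3 k
  unfold fn at h5
  rw [h1, h2] at h5
  have h6 : ((s ^ γ : ℝ) : ℂ) ≠ 0 := by exact_mod_cast (Real.rpow_pos_of_pos h4.1 γ).ne'
  have h7 : (((√(2 * Real.pi))⁻¹ : ℝ) : ℂ) ≠ 0 := by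
    exact_mod_cast (inv_pos.mpr sqrt_two_pi_pos).ne'
  exact mul_left_cancel₀ h7 (mul_left_cancel₀ h6 h5)

end KSig

namespace JSpace

variable {lam γ : ℝ} {n : ℕ} {σ : ℝ}

lemma toFun_apply (a : JSpace lam γ n σ) (x : ℝ × ℝ) :
    a.toFun x = (lead a).toFun x.2 * ((x.1 ^ lam : ℝ) : ℂ) + (rem a).fn x := rfl

lemma toFun_zero_apply (a : JSpace 0 γ n σ) (x : ℝ × ℝ) :
    a.toFun x = (lead a).toFun x.2 + (rem a).fn x := by
  rw [toFun_apply, Real.rpow_zero, Complex.ofReal_one, mul_one]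

/-- The function `v(θ) ψ^lam + w(ψ, θ)`. -/
def mk (v : XSpace n σ) (P : KSig n (lam + γ) σ) : JSpace lam γ n σ := (v, P)

lemma lead_mk (v : XSpace n σ) (P : KSig n (lam + γ) σ) :
    lead (mk v P : JSpace lam γ n σ) = v := rfl

lemma rem_mk (v : XSpace n σ) (P : KSig n (lam + γ) σ) :
    rem (mk v P : JSpace lam γ n σ) = P := rfl

lemma norm_mk_le {v : XSpace n σ} {P : KSig n (lam + γ) σ} {C : ℝ} (hv : ‖v‖ ≤ C) (hP : ‖P‖ ≤ C) :
    ‖(mk v P : JSpace lam γ n σ)‖ ≤ C := max_le hv hP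

lemma norm_lead_le (a : JSpace lam γ n σ) : ‖lead a‖ ≤ ‖a‖ := le_max_left _ _

lemma norm_rem_le (a : JSpace lam γ n σ) : ‖rem a‖ ≤ ‖a‖ := le_max_right _ _

lemma completeSpace (hn : 1 ≤ n) (hσ : 0 ≤ σ) : CompleteSpace (JSpace lam γ n σ) := by
  have := XSpace.completeSpace (n := n) hn hσ
  have := KSig.completeSpace (n := n) (γ := lam + γ) hσ
  exact inferInstanceAs (CompleteSpace (XSpace n σ × KSig n (lam + γ) σ))

/-- The product of the functions `a` and `b` is `c`. -/
def IsMul (a b c : JSpace 0 γ n σ) : Prop :=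
  ((lead c).toFun =ᵐ[muT] fun t => (lead a).toFun t * (lead b).toFun t) ∧
    c.toFun =ᵐ[muPi] fun x => a.toFun x * b.toFun x

lemma toFun_add (a b : JSpace 0 γ n σ) : (a + b).toFun =ᵐ[muPi] fun x => a.toFun x + b.toFun x := by
  filter_upwards [ae_muPi_snd (XSpace.toFun_add (lead a) (lead b)), KSig.fn_add (rem a) (rem b)]
    with x h1 h2
  rw [toFun_zero_apply, toFun_zero_apply, toFun_zero_apply, map_add, map_add, h1, h2]
  ring

lemma toFun_smul (c : ℂ) (a : JSpace 0 γ n σ) : (c • a).toFun =ᵐ[muPi] fun x => c * a.toFun x := by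
  filter_upwards [ae_muPi_snd (XSpace.toFun_smul c (lead a)), KSig.fn_smul c (rem a)] with x h1 h2
  rw [toFun_zero_apply, toFun_zero_apply, map_smul, map_smul, h1, h2]
  ring

lemma lead_add_ae (a b : JSpace lam γ n σ) :
    (lead (a + b)).toFun =ᵐ[muT] fun t => (lead a).toFun t + (lead b).toFun t := by
  rw [map_add]; exact XSpace.toFun_add _ _

lemma lead_smul_ae (c : ℂ) (a : JSpace lam γ n σ) :
    (lead (c • a)).toFun =ᵐ[muT] fun t => c * (lead a).toFun t := by
  rw [map_smul]; exact XSpace.toFun_smul _ _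

/-- Given the leading coefficient, the remainder is a difference of functions. Relations such as
`IsMul` therefore record the leading coefficient along with the function, and uniqueness of the
decomposition of a function is never needed. -/
lemma ext_ae {a b : JSpace 0 γ n σ} (h1 : (lead a).toFun =ᵐ[muT] (lead b).toFun)
    (h2 : a.toFun =ᵐ[muPi] b.toFun) : a = b := by
  refine Prod.ext (XSpace.ext_ae h1) (KSig.ext_ae (P := rem a) (Q := rem b) ?_)
  filter_upwards [ae_muPi_snd h1, h2] with x h1 h2
  rw [toFun_zero_apply, toFun_zero_apply, h1] at h2
  exact add_left_cancel h2

lemma IsMul.symm {a b c : JSpace 0 γ n σ} (h : IsMul a b c) : IsMul b a c := by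
  refine ⟨h.1.trans ?_, h.2.trans ?_⟩
  · exact Filter.Eventually.of_forall fun _ => mul_comm _ _
  · exact Filter.Eventually.of_forall fun _ => mul_comm _ _

lemma IsMul.add {a b b' c c' : JSpace 0 γ n σ} (h : IsMul a b c) (h' : IsMul a b' c') :
    IsMul a (b + b') (c + c') := by
  constructor
  · filter_upwards [h.1, h'.1, lead_add_ae b b', lead_add_ae c c'] with t h1 h2 h3 h4
    rw [h4, h3, h1, h2, mul_add]
  · filter_upwards [h.2, h'.2, toFun_add b b', toFun_add c c'] with t h1 h2 h3 h4
    rw [h4, h3, h1, h2, mul_add]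

lemma IsMul.smul {a b c : JSpace 0 γ n σ} (h : IsMul a b c) (z : ℂ) :
    IsMul a (z • b) (z • c) := by
  constructor
  · filter_upwards [h.1, lead_smul_ae z b, lead_smul_ae z c] with t h1 h3 h4
    rw [h4, h3, h1, mul_left_comm]
  · filter_upwards [h.2, toFun_smul z b, toFun_smul z c] with t h1 h3 h4
    rw [h4, h3, h1, mul_left_comm]

/-- Expand `(v + w)(v' + w') = v v' + (v w' + v' w + w w')`: the remainders form an algebra and a
module over the leading coefficients. -/
lemma exists_isMul (hn : 2 ≤ n) (hγ : 1 / 2 ≤ γ) (hσ : 0 ≤ σ) :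
    ∃ C : ℝ, ∀ a b : JSpace 0 γ n σ, ∃ c, IsMul a b c ∧ ‖c‖ ≤ C * ‖a‖ * ‖b‖ := by
  have hn1 : 1 ≤ n := by omega
  have hγ' : 1 / 2 ≤ 0 + γ := by rwa [zero_add]
  obtain ⟨C₁, hC₁, h₁⟩ := XSpace.exists_mul (n := n) hn1 hσ
  obtain ⟨C₂, hC₂, h₂⟩ := KSig.exists_smul (n := n) (γ := 0 + γ) hn1 hσ
  obtain ⟨C₃, hC₃, h₃⟩ := KSig.exists_mul (n := n) (γ := 0 + γ) hn hγ' hσ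
  refine ⟨√C₁.toReal + (√C₂.toReal + √C₂.toReal + √C₃.toReal), fun a b => ?_⟩
  obtain ⟨z, hz, hzn⟩ := h₁ (lead a) (lead b)
  obtain ⟨P, hP, hPn⟩ := h₂ (lead a) (rem b)
  obtain ⟨Q, hQ, hQn⟩ := h₂ (lead b) (rem a)
  obtain ⟨R, hR, hRn⟩ := h₃ (rem a) (rem b)
  have ez := XSpace.mul_ae_eq hn1 hσ hz
  refine ⟨mk z (P + Q + R), ⟨ez, ?_⟩, ?_⟩
  · filter_upwards [ae_muPi_snd ez, KSig.smul_ae_eq hn hσ hP, KSig.smul_ae_eq hn hσ hQ,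
      KSig.mul_ae_eq hn hγ' hσ hR, KSig.fn_add (P + Q) R, KSig.fn_add P Q] with x h1 h2 h3 h4 h5 h6
    rw [toFun_zero_apply, toFun_zero_apply, toFun_zero_apply, lead_mk, rem_mk, h5, h6, h1]
    change _ + (kFun _ x + kFun _ x + kFun _ x) = (_ + kFun _ x) * (_ + kFun _ x)
    rw [h2, h3, h4]
    ring
  · have e1 := norm_le_of_enorm_sq_le hC₁ hzn
    have e2 := norm_le_of_enorm_sq_le hC₂ hPn
    have e3 := norm_le_of_enorm_sq_le hC₂ hQn
    have e4 := norm_le_of_enorm_sq_le hC₃ hRn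
    have m : ∀ {x y : ℝ}, 0 ≤ y → x ≤ ‖a‖ → y ≤ ‖b‖ → x * y ≤ ‖a‖ * ‖b‖ := fun hy h h' =>
      mul_le_mul h h' hy (norm_nonneg _)
    have f1 := e1.trans (mul_le_mul_of_nonneg_left
      (m (norm_nonneg _) a.norm_lead_le b.norm_lead_le) (Real.sqrt_nonneg _))
    have f2 := e2.trans (mul_le_mul_of_nonneg_left
      (m (norm_nonneg _) a.norm_lead_le b.norm_rem_le) (Real.sqrt_nonneg _))
    have f3 := (e3.trans_eq (by rw [mul_comm ‖lead b‖])).trans (mul_le_mul_of_nonneg_left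
      (m (norm_nonneg _) a.norm_rem_le b.norm_lead_le) (Real.sqrt_nonneg C₂.toReal))
    have f4 := e4.trans (mul_le_mul_of_nonneg_left
      (m (norm_nonneg _) a.norm_rem_le b.norm_rem_le) (Real.sqrt_nonneg _))
    have hab : 0 ≤ ‖a‖ * ‖b‖ := by positivity
    have g1 : 0 ≤ √C₁.toReal * (‖a‖ * ‖b‖) := by positivity
    have g2 : 0 ≤ √C₂.toReal * (‖a‖ * ‖b‖) := by positivity
    have g3 : 0 ≤ √C₃.toReal * (‖a‖ * ‖b‖) := by positivity
    refine norm_mk_le ?_ ?_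
    · linarith
    · have := norm_add₃_le (a := P) (b := Q) (c := R)
      linarith

/-- The multiplication on `J_{0,γ}^{n,σ}(Π)`. -/
lemma exists_mul (hn : 2 ≤ n) (hγ : 1 / 2 ≤ γ) (hσ : 0 ≤ σ) :
    ∃ M : JSpace 0 γ n σ →L[ℂ] JSpace 0 γ n σ →L[ℂ] JSpace 0 γ n σ,
      ∀ a b, IsMul a b (M a b) := by
  obtain ⟨C, hC⟩ := exists_isMul (n := n) (γ := γ) hn hγ hσ
  refine exists_bilinear (R := IsMul) ?_ ?_ ?_ ?_ ?_ hC
  · exact fun a b c c' h h' => ext_ae (h.1.trans h'.1.symm) (h.2.trans h'.2.symm)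
  · exact fun a a' b c c' h h' => (h.symm.add h'.symm).symm
  · exact fun a b b' c c' h h' => h.add h'
  · exact fun z a b c h => (h.symm.smul z).symm
  · exact fun z a b c h => h.smul z

lemma lead_psiPow_ae : (lead (psiPow lam γ n σ)).toFun =ᵐ[muT] fun _ => 1 := XSpace.toFun_one

lemma toFun_psiPow_zero : (psiPow 0 γ n σ).toFun =ᵐ[muPi] fun _ => 1 := by
  filter_upwards [ae_muPi_snd (lead_psiPow_ae (lam := 0) (γ := γ) (n := n) (σ := σ)),
    KSig.fn_zero (n := n) (γ := 0 + γ) (σ := σ)] with x h1 h2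
  rw [toFun_zero_apply, h1]
  change 1 + (0 : KSig n (0 + γ) σ).fn x = 1
  rw [h2, add_zero]

lemma isMul_one (b : JSpace 0 γ n σ) : IsMul (psiPow 0 γ n σ) b b := by
  constructor
  · filter_upwards [lead_psiPow_ae (lam := 0) (γ := γ) (n := n) (σ := σ)] with t h
    rw [h, one_mul]
  · filter_upwards [toFun_psiPow_zero (γ := γ) (n := n) (σ := σ)] with t h
    rw [h, one_mul]

lemma isMul_unique {a b c c' : JSpace 0 γ n σ} (h : IsMul a b c) (h' : IsMul a b c') : c = c' :=
  ext_ae (h.1.trans h'.1.symm) (h.2.trans h'.2.symm)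

end JSpace

end

noncomputable section

open scoped ENNReal

/-! ### Rescaled derivatives: the leading coefficient -/

/-- The constant function `1` on the unit interval. -/
def oneHI : HI := MemLp.toLp (fun _ => (1 : ℂ)) (memLp_const 1)

lemma coeFn_oneHI : oneHI =ᵐ[muI] fun _ => 1 := MemLp.coeFn_toLp _

lemma eulerRel_oneHI : EulerRel 0 oneHI 0 := by
  refine EulerRel.of_isPrim (r := fun _ => 1) (E := fun _ => 1) coeFn_oneHI
    (IsPrim.of_hasDerivAt (fun x _ => ?_) continuousOn_const) ?_
  · simp only [mul_one]
    exact Complex.ofRealCLM.hasDerivAt (x := x)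
  · filter_upwards [coeFn_oneHI, Lp.coeFn_zero ℂ 2 muI] with s h1 h2
    rw [h1, h2]
    simp

/-- The coefficient `c (c - 1) ⋯ (c - p + 1)` of `ψ^{c-p}` in `∂_ψ^p ψ^c`. -/
def powCoef (c : ℝ) (p : ℕ) : ℂ := ∏ i ∈ Finset.range p, ((c - i : ℝ) : ℂ)

/-- The power `s^c` has the constant profile `1`, and differentiating `s^{c-r}` contributes the
factor `c - r`. -/
lemma weak1_powCoef (c : ℝ) (p : ℕ) : Weak1 c p oneHI (powCoef c p • oneHI) := by
  have h : ∀ r < p, EulerRel (r - c) (powCoef c r • oneHI) (powCoef c (r + 1) • oneHI) := by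
    intro r _
    have h1 := (eulerRel_oneHI.shift (b := c - r)).smul (powCoef c r)
    rw [zero_add, zero_sub, neg_sub, smul_smul] at h1
    unfold powCoef at h1 ⊢
    rwa [Finset.prod_range_succ]
  have h2 := weak1_of_eulerRel h le_rfl
  simpa [powCoef] using h2

namespace XSpace

variable {n : ℕ} {σ : ℝ}

/-- The function `(ψ, θ) ↦ v(θ)` in `L²(Π)`. -/
def onPi (v : XSpace n σ) : Lp ℂ 2 muPi := (v.memLp.comp_snd muI).toLp _

lemma coeFn_onPi (v : XSpace n σ) : v.onPi =ᵐ[muPi] fun x => v.toFun x.2 := MemLp.coeFn_toLp _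

lemma cf_onPi (v : XSpace n σ) (k : ℤ) :
    cf k v.onPi = (((√(2 * Real.pi) : ℝ) : ℂ) * v.coef k) • oneHI := by
  refine Lp.ext ?_
  filter_upwards [coeFn_cf k v.onPi, ae_ae_slice v.coeFn_onPi, coeFn_oneHI,
    Lp.coeFn_smul (((√(2 * Real.pi) : ℝ) : ℂ) * v.coef k) oneHI] with s h1 h2 h3 h4
  rw [h1, h4, Pi.smul_apply, h3, fcoef_congr h2 k, smul_eq_mul, mul_one]
  rfl

lemma isWeakDeriv {n' : ℕ} {v : XSpace n σ} {w : XSpace n' σ} {c : ℝ} {p q : ℕ}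
    (h : ∀ k, w.coef k = powCoef c p * (Complex.I * k) ^ q * v.coef k) :
    IsWeakDeriv p q (wmul c fun x => v.toFun x.2) (wmul (c - p) fun x => w.toFun x.2) := by
  refine (isWeakDeriv_of_weak1 (p := p) (q := q) (c := c) (U := v.onPi) (G := w.onPi)
    fun k => ?_).congr ?_ ?_
  · rw [cf_onPi, cf_onPi, h, smul_smul]
    have h1 := (weak1_powCoef c p).smul
      ((Complex.I * k) ^ q * (((√(2 * Real.pi) : ℝ) : ℂ) * v.coef k))
    rw [smul_smul] at h1
    convert h1 using 2
    ring
  · filter_upwards [v.coeFn_onPi] with x hx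
    simp only [wmul, hx]
  · filter_upwards [w.coeFn_onPi] with x hx
    simp only [wmul, hx]

end XSpace

lemma pwt_mul_pwt (r r' : ℕ) (k : ℤ) : pwt r k * pwt r' k = pwt (r + r') k := by
  unfold pwt
  rw [← ENNReal.ofReal_mul (by positivity), pow_add]

/-- The drop of two in the order of the weight pays for at most two factors `ik`. -/
lemma XSpace.exists_deriv {n m : ℕ} (hn : 1 ≤ n) (hnm : n + 2 ≤ m) {σ : ℝ} (hσ : 0 ≤ σ) (c : ℂ)
    {q : ℕ} (hq : q ≤ 2) : ∃ C : ℝ≥0∞, C ≠ ⊤ ∧ ∀ v : XSpace m σ, ∃ w : XSpace n σ,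
      (∀ k, w.coef k = c * (Complex.I * k) ^ q * v.coef k) ∧ ‖w‖ₑ ^ 2 ≤ C * ‖v‖ₑ ^ 2 := by
  have hC : ‖c‖ₑ ^ 2 * (2 ^ m) ^ 2 ≠ ⊤ :=
    ENNReal.mul_ne_top (ENNReal.pow_ne_top enorm_ne_top) (by simp)
  refine ⟨_, hC, fun v => ?_⟩
  obtain ⟨w, hw, hwn⟩ := exists_of_coef (n := n) (σ := σ) hn hσ
    (x := fun k => c * (Complex.I * k) ^ q * v.coef k)
    (B := ‖c‖ₑ ^ 2 * (2 ^ m) ^ 2 * ‖v‖ₑ ^ 2)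
    (ENNReal.mul_ne_top hC (ENNReal.pow_ne_top enorm_ne_top)) (by
      rw [mul_assoc]
      refine le_trans ?_ (mul_le_mul_right v.tsum_sq_le _)
      rw [← ENNReal.tsum_mul_left]
      refine ENNReal.tsum_le_tsum fun k => ?_
      rw [← mul_pow]
      refine pow_le_pow_left₀ zero_le ?_ 2
      rw [enorm_smul, enorm_smul, enorm_mul, enorm_mul]
      calc pwt n k * (‖ewt σ k‖ₑ * (‖c‖ₑ * ‖(Complex.I * k) ^ q‖ₑ * ‖v.coef k‖ₑ))
          = ‖c‖ₑ * (pwt n k * ‖(Complex.I * k) ^ q‖ₑ * (‖ewt σ k‖ₑ * ‖v.coef k‖ₑ)) := by ring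
        _ ≤ _ := by
          refine mul_le_mul_right (mul_le_mul_left ?_ _) _
          refine (mul_le_mul_right (enorm_I_mul_pow_le k hq) _).trans ?_
          rw [pwt_mul_pwt]
          exact pwt_mono hnm k)
  exact ⟨w, fun k => congrFun hw k, hwn⟩

/-! ### Rescaled derivatives: the remainder -/

/-- The coefficients of `ψ^{r-γ'} ∂_ψ^r (ψ^{p-β+γ'} ∂_ψ^p u)` if `F p` are the coefficients of
`ψ^{p-β} ∂_ψ^p u`. -/
def reweight (β γ' : ℝ) (F : ℕ → HI) : ℕ → ℕ → HI
  | 0, p => F p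
  | r + 1, p => reweight β γ' F r (p + 1) + ((p - β - r + γ' : ℝ) : ℂ) • reweight β γ' F r p

/-- The recursion combines neighbouring members of the chain. After a shift by one both satisfy a
relation with the same coefficient, so every level `r` is again a chain in `p`. -/
lemma eulerRel_reweight {β γ' : ℝ} {F : ℕ → HI} {m : ℕ}
    (hF : ∀ p < m, EulerRel (p - β) (F p) (F (p + 1))) (r : ℕ) : ∀ p, p + r < m →
      EulerRel (p - β) (reweight β γ' F r p) (reweight β γ' F r (p + 1)) := by
  induction r with
  | zero => exact fun p hp => hF p hp
  | succ r ih =>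
    intro p hp
    have h1 := ih p (by omega)
    have h2 := (ih (p + 1) (by omega)).shift (b := 1)
    have e : (((p + 1 : ℕ) : ℝ) - β - 1) = p - β := by push_cast; ring
    rw [e] at h2
    have h3 := h2.add (h1.smul ((p - β - r + γ' : ℝ) : ℂ))
    have e2 : reweight β γ' F (r + 1) (p + 1) = reweight β γ' F r (p + 1 + 1) +
        ((1 : ℝ) : ℂ) • reweight β γ' F r (p + 1) +
        ((p - β - r + γ' : ℝ) : ℂ) • reweight β γ' F r (p + 1) := by
      rw [add_assoc, ← add_smul, reweight]
      congr 2
      push_cast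
      ring
    rw [e2]
    exact h3

/-- The recursion is precisely the shift that changes the coefficient `p - β` into `r - γ'`. For
fixed `p` the sequence in `r` is therefore a chain for the weight `γ'`. -/
lemma eulerRel_reweight_succ {β γ' : ℝ} {F : ℕ → HI} {m : ℕ}
    (hF : ∀ p < m, EulerRel (p - β) (F p) (F (p + 1))) {r p : ℕ} (h : p + r < m) :
    EulerRel (r - γ') (reweight β γ' F r p) (reweight β γ' F (r + 1) p) := by
  have h1 := (eulerRel_reweight (γ' := γ') hF r p h).shift (b := p - β - r + γ')
  have e : ((p : ℝ) - β - (p - β - r + γ')) = r - γ' := by ring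
  rw [e] at h1
  exact h1

/-- The constant in `enorm_reweight_le`. -/
def rwconst (m : ℕ) (β γ' : ℝ) : ℝ≥0∞ := 1 + ENNReal.ofReal (m + |β| + m + |γ'|)

lemma enorm_reweight_le {β γ' σ : ℝ} {F : ℕ → HI} {m : ℕ} {k : ℤ} {S : ℝ≥0∞}
    (hF : ∀ p ≤ m, pwt (m - p) k * ‖ewt σ k • F p‖ₑ ≤ S) (r : ℕ) : ∀ p, p + r ≤ m →
      pwt (m - p - r) k * ‖ewt σ k • reweight β γ' F r p‖ₑ ≤ rwconst m β γ' ^ r * S := by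
  induction r with
  | zero => intro p hp; simpa [reweight] using hF p hp
  | succ r ih =>
    intro p hp
    rw [reweight, smul_add]
    refine (mul_le_mul_right (enorm_add_le _ _) _).trans ?_
    rw [mul_add, smul_comm, enorm_smul (((p : ℝ) - β - r + γ' : ℝ) : ℂ), pow_succ',
      mul_left_comm (pwt (m - p - (r + 1)) k) ‖(((p : ℝ) - β - r + γ' : ℝ) : ℂ)‖ₑ]
    have h1 := ih (p + 1) (by omega)
    have h2 := ih p (by omega)
    rw [show m - (p + 1) - r = m - p - (r + 1) by omega] at h1
    have h3 : ‖(((p : ℝ) - β - r + γ' : ℝ) : ℂ)‖ₑ ≤ ENNReal.ofReal (m + |β| + m + |γ'|) := by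
      rw [← ofReal_norm, Complex.norm_real]
      refine ENNReal.ofReal_le_ofReal ?_
      have hp' : (p : ℝ) ≤ m := by exact_mod_cast (by omega : p ≤ m)
      have hr' : (r : ℝ) ≤ m := by exact_mod_cast (by omega : r ≤ m)
      have hp0 : (0 : ℝ) ≤ p := Nat.cast_nonneg p
      have hr0 : (0 : ℝ) ≤ r := Nat.cast_nonneg r
      rw [Real.norm_eq_abs, abs_le]
      constructor <;> linarith [neg_abs_le β, le_abs_self β, neg_abs_le γ', le_abs_self γ']
    have h4 := (mul_le_mul_left (pwt_mono (by omega : m - p - (r + 1) ≤ m - p - r) k)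
      ‖ewt σ k • reweight β γ' F r p‖ₑ).trans h2
    refine (add_le_add h1 (mul_le_mul' h3 h4)).trans_eq ?_
    rw [rwconst]
    ring

/-- The function sought is `ψ^{p-β+γ'} ∂_ψ^p ∂_θ^q u`. Its higher radial profiles are supplied by
`reweight`, and since `p + q ≤ 2 ≤ m - n` there is room for `n` of them together with the `q`
angular derivatives. -/
lemma KSig.exists_deriv {n m : ℕ} (hnm : n + 2 ≤ m) {β γ' σ : ℝ} (hσ : 0 ≤ σ) {p q : ℕ}
    (hpq : p + q ≤ 2) : ∃ C : ℝ≥0∞, C ≠ ⊤ ∧ ∀ P : KSig m β σ, ∃ Q : KSig n γ' σ,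
      (∀ k, kc (base Q).1 0 k = (Complex.I * k) ^ q • kc (base P).1 p k) ∧
        ‖Q‖ₑ ^ 2 ≤ C * ‖P‖ₑ ^ 2 := by
  set D := rwconst m β γ' with hD
  have hDt : D ≠ ⊤ := by rw [hD, rwconst]; simp
  have hD1 : 1 ≤ D := by rw [hD, rwconst]; exact le_self_add
  have hC : (D ^ n) ^ 2 * kconst m ≠ ⊤ :=
    ENNReal.mul_ne_top (ENNReal.pow_ne_top (ENNReal.pow_ne_top hDt)) (kconst_ne_top m)
  refine ⟨(Finset.univ : Finset (DIdx n)).card * _,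
    ENNReal.mul_ne_top (ENNReal.natCast_ne_top _) hC, fun P => ?_⟩
  set S : ℤ → ℝ≥0∞ := fun k => ∑ p ∈ Finset.range (m + 1),
    pwt (m - p) k * ‖ewt σ k • kc (base P).1 p k‖ₑ with hS
  have hPS : ∀ k, ∀ p ≤ m, pwt (m - p) k * ‖ewt σ k • kc (base P).1 p k‖ₑ ≤ S k := fun k p hp =>
    Finset.single_le_sum (f := fun p => pwt (m - p) k * ‖ewt σ k • kc (base P).1 p k‖ₑ)
      (fun _ _ => zero_le) (Finset.mem_range.mpr (by omega))
  obtain ⟨Q, hQ, hQn⟩ := exists_of_kc (n := n) (γ := γ') hσ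
    (F := fun r k => (Complex.I * k) ^ q • reweight β γ' (fun p => kc (base P).1 p k) r p)
    (B := (D ^ n) ^ 2 * kconst m * ‖P‖ₑ ^ 2)
    (ENNReal.mul_ne_top hC (ENNReal.pow_ne_top enorm_ne_top))
    (fun k r hr => (eulerRel_reweight_succ (P.rel k) (by omega)).smul _)
    (fun r hr => by
      rw [mul_assoc]
      refine le_trans ?_ (mul_le_mul_right P.tsum_sq_le _)
      rw [← ENNReal.tsum_mul_left]
      refine ENNReal.tsum_le_tsum fun k => ?_
      rw [← mul_pow]
      refine pow_le_pow_left₀ zero_le ?_ 2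
      have h1 := enorm_reweight_le (β := β) (γ' := γ') (hPS k) r p (by omega)
      refine le_trans ?_ (h1.trans (mul_le_mul_left (pow_le_pow_right₀ hD1 hr) _))
      rw [smul_comm, enorm_smul, ← mul_assoc]
      refine mul_le_mul_left ?_ _
      refine (mul_le_mul_right (enorm_I_mul_pow_le k le_rfl) _).trans ?_
      rw [pwt_mul_pwt]
      exact pwt_mono (by omega) k)
  refine ⟨Q, fun k => ?_, by rw [mul_assoc]; exact hQn⟩
  rw [hQ 0 (Nat.zero_le n)]
  rfl

/-- The zeroth component of `Q` is the component `(p, q)` of `P`; only the bookkeeping of powers of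
`ψ` differs. -/
lemma KSig.isWeakDeriv {n m : ℕ} {β γ' σ : ℝ} {p q : ℕ} (hpq : p + q ≤ m) {P : KSig m β σ}
    {Q : KSig n γ' σ} (h : ∀ k, kc (base Q).1 0 k = (Complex.I * k) ^ q • kc (base P).1 p k) :
    IsWeakDeriv p q P.fn (wmul (β - γ' - p) Q.fn) := by
  have e : (base Q).1 (DIdx.zero n) = (base P).1 (DIdx.mk' p q hpq) := ext_cf fun k => by
    rw [← kc_zero, h]
    exact (((mem_KSpace_iff _).mp (base P).2).1 (DIdx.mk' p q hpq) k).symm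
  refine ((base P).2 (DIdx.mk' p q hpq)).congr Filter.EventuallyEq.rfl ?_
  filter_upwards [ae_mem_muPi] with x hx
  simp only [wmul, fn, kFun, e]
  rw [← mul_assoc, ← Complex.ofReal_mul, ← Real.rpow_add hx.1.1]
  congr 3
  change β - p = _
  ring

/-! ### Rescaled derivatives on `J` -/

/-- A bounded linear operator which is specified by a functional relation. -/
lemma exists_linear {E F : Type*} [NormedAddCommGroup E] [NormedSpace ℂ E]
    [NormedAddCommGroup F] [NormedSpace ℂ F] {R : E → F → Prop}
    (huniq : ∀ x z z', R x z → R x z' → z = z')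
    (hadd : ∀ x x' z z', R x z → R x' z' → R (x + x') (z + z'))
    (hsmul : ∀ (c : ℂ) x z, R x z → R (c • x) (c • z))
    {C : ℝ} (hex : ∀ x, ∃ z, R x z ∧ ‖z‖ ≤ C * ‖x‖) :
    ∃ B : E →L[ℂ] F, ∀ x, R x (B x) := by
  choose f hf hn using hex
  let L : E →ₗ[ℂ] F :=
    { toFun := f
      map_add' := fun x x' => huniq _ _ _ (hf _) (hadd _ _ _ _ (hf x) (hf x'))
      map_smul' := fun c x => huniq _ _ _ (hf _) (hsmul _ _ _ (hf x)) }
  exact ⟨L.mkContinuous C hn, fun x => hf x⟩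

lemma norm_le_of_enorm_sq_le' {E F : Type*} [NormedAddCommGroup E] [NormedAddCommGroup F]
    {x : E} {z : F} {C : ℝ≥0∞} (hC : C ≠ ⊤) (h : ‖z‖ₑ ^ 2 ≤ C * ‖x‖ₑ ^ 2) :
    ‖z‖ ≤ √C.toReal * ‖x‖ := by
  have h1 := ENNReal.toReal_mono (ENNReal.mul_ne_top hC (ENNReal.pow_ne_top enorm_ne_top)) h
  simp only [ENNReal.toReal_mul, ENNReal.toReal_pow, toReal_enorm] at h1
  refine abs_le_of_sq_le_sq' ?_ (by positivity) |>.2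
  rw [mul_pow, Real.sq_sqrt ENNReal.toReal_nonneg]
  exact h1

lemma XSpace.coef_add {n : ℕ} {σ : ℝ} (v w : XSpace n σ) (k : ℤ) :
    (v + w).coef k = v.coef k + w.coef k := by
  unfold coef
  rw [fcoef_congr (toFun_add v w) k]
  exact fcoef_add (Lp_integrable_muT _) (Lp_integrable_muT _) k

lemma XSpace.coef_smul {n : ℕ} {σ : ℝ} (c : ℂ) (v : XSpace n σ) (k : ℤ) :
    (c • v).coef k = c * v.coef k := by
  unfold coef
  rw [fcoef_congr (toFun_smul c v) k, fcoef_smul]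

lemma KSig.kc_add {n : ℕ} {γ σ : ℝ} (P Q : KSig n γ σ) (p : ℕ) (k : ℤ) :
    kc (base (P + Q)).1 p k = kc (base P).1 p k + kc (base Q).1 p k := by
  unfold kc
  split_ifs
  · exact map_add (cf k) _ _
  · rw [add_zero]

lemma KSig.kc_smul {n : ℕ} {γ σ : ℝ} (c : ℂ) (P : KSig n γ σ) (p : ℕ) (k : ℤ) :
    kc (base (c • P)).1 p k = c • kc (base P).1 p k := by
  unfold kc
  split_ifs
  · exact map_smul (cf k) _ _
  · rw [smul_zero]

namespace JSpace

variable {lam γ : ℝ} {n m : ℕ} {σ : ℝ}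

/-- The relation `b = ψ^{p-lam} ∂_ψ^p ∂_θ^q a` in terms of Fourier coefficients. -/
def IsDeriv (p q : ℕ) (a : JSpace lam γ m σ) (b : JSpace 0 γ n σ) : Prop :=
  (∀ k, (lead b).coef k = powCoef lam p * (Complex.I * k) ^ q * (lead a).coef k) ∧
    ∀ k, kc (KSig.base (rem b)).1 0 k = (Complex.I * k) ^ q • kc (KSig.base (rem a)).1 p k

lemma IsDeriv.isWeakDeriv {p q : ℕ} {a : JSpace lam γ m σ} {b : JSpace 0 γ n σ}
    (h : IsDeriv p q a b) (hpq : p + q ≤ m) :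
    IsWeakDeriv p q a.toFun (wmul (lam - p) b.toFun) := by
  refine ((XSpace.isWeakDeriv h.1).add (KSig.isWeakDeriv hpq h.2)).congr ?_ ?_
  · refine Filter.Eventually.of_forall fun x => ?_
    simp only [toFun_apply, wmul]
    ring
  · refine Filter.Eventually.of_forall fun x => ?_
    have e : lam + γ - (0 + γ) - p = lam - p := by ring
    simp only [toFun_zero_apply, wmul, e]
    ring

lemma exists_deriv (hn : 1 ≤ n) (hnm : n + 2 ≤ m) (hσ : 0 ≤ σ) {p q : ℕ} (hpq : p + q ≤ 2) :
    ∃ B : JSpace lam γ m σ →L[ℂ] JSpace 0 γ n σ, ∀ a, IsDeriv p q a (B a) := by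
  obtain ⟨C₁, hC₁, h₁⟩ := XSpace.exists_deriv hn hnm hσ (powCoef lam p) (by omega : q ≤ 2)
  obtain ⟨C₂, hC₂, h₂⟩ := KSig.exists_deriv hnm (β := lam + γ) (γ' := 0 + γ) hσ hpq
  refine exists_linear (R := IsDeriv p q) ?_ ?_ ?_ (C := √C₁.toReal + √C₂.toReal) fun a => ?_
  · intro a b b' h h'
    refine Prod.ext (XSpace.ext_coef (v := lead b) (w := lead b') ?_)
      (KSig.ext_kc (P := rem b) (Q := rem b') ?_)
    · funext k; rw [h.1, h'.1]
    · intro k; rw [h.2, h'.2]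
  · intro a a' b b' h h'
    constructor
    · intro k
      rw [map_add, map_add, XSpace.coef_add, XSpace.coef_add, h.1, h'.1, mul_add]
    · intro k
      rw [map_add rem, map_add rem, KSig.kc_add, KSig.kc_add, h.2, h'.2, smul_add]
  · intro c a b h
    constructor
    · intro k
      rw [map_smul, map_smul, XSpace.coef_smul, XSpace.coef_smul, h.1, mul_left_comm]
    · intro k
      rw [map_smul rem, map_smul rem, KSig.kc_smul, KSig.kc_smul, h.2, smul_comm]
  · obtain ⟨w, hw, hwn⟩ := h₁ (lead a)
    obtain ⟨Q, hQ, hQn⟩ := h₂ (rem a)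
    refine ⟨mk w Q, ⟨hw, hQ⟩, norm_mk_le ?_ ?_⟩
    · have e1 := norm_le_of_enorm_sq_le' hC₁ hwn
      have e2 := mul_le_mul_of_nonneg_left a.norm_lead_le (Real.sqrt_nonneg C₁.toReal)
      have : 0 ≤ √C₂.toReal * ‖a‖ := by positivity
      linarith
    · have e1 := norm_le_of_enorm_sq_le' hC₂ hQn
      have e2 := mul_le_mul_of_nonneg_left a.norm_rem_le (Real.sqrt_nonneg C₂.toReal)
      have : 0 ≤ √C₁.toReal * ‖a‖ := by positivity
      linarith

end JSpace

end

noncomputable section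

open scoped ENNReal

/-! ### The leading term of the vorticity -/

lemma hasDerivAt_fsum {x : ℤ → ℂ} (hx : Summable fun k => ‖x k‖)
    (hx' : Summable fun k : ℤ => ‖Complex.I * k * x k‖) (θ : ℝ) :
    HasDerivAt (fsum x) (fsum (fun k => Complex.I * k * x k) θ) θ := by
  refine hasDerivAt_tsum (g := fun k (t : ℝ) => x k * Complex.exp (Complex.I * k * t))
    (g' := fun k (t : ℝ) => Complex.I * k * x k * Complex.exp (Complex.I * k * t)) hx'
    (fun k t => ?_) (fun k t => ?_) (y₀ := 0) (summable_fterm hx 0) θ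
  · have h1 : HasDerivAt (fun t : ℝ => Complex.I * k * (t : ℂ)) (Complex.I * k * 1) t :=
      (Complex.ofRealCLM.hasDerivAt (x := t)).const_mul _
    refine (h1.cexp.const_mul (x k)).congr_deriv ?_
    ring
  · rw [norm_mul _ (Complex.exp _), norm_exp_I_mul, mul_one]

lemma fsum_two_pi (x : ℤ → ℂ) : fsum x (2 * Real.pi) = fsum x 0 := by
  unfold fsum
  refine tsum_congr fun k => ?_
  congr 1
  rw [Complex.exp_eq_exp_iff_exists_int]
  exact ⟨k, by push_cast; ring⟩

/-- The `±2` modes of `g'' + 4 g` vanish, for `g = v⁻²`. -/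
lemma integral_leading {v v' v'' : ℝ → ℂ} (h1 : ∀ θ, HasDerivAt v (v' θ) θ)
    (h2 : ∀ θ, HasDerivAt v' (v'' θ) θ) (h3 : Continuous v'')
    (hne : ∀ θ ∈ Icc (0 : ℝ) (2 * Real.pi), v θ ≠ 0) (hp : v (2 * Real.pi) = v 0)
    (hp' : v' (2 * Real.pi) = v' 0) {c : ℂ} (hc : c ^ 2 = -4)
    (hexp : Complex.exp (c * (2 * Real.pi : ℝ)) = 1) :
    ∫ θ in (0 : ℝ)..(2 * Real.pi), (4 * (v θ)⁻¹ ^ 2 + 6 * v' θ ^ 2 * (v θ)⁻¹ ^ 4 -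
      2 * v'' θ * (v θ)⁻¹ ^ 3) * Complex.exp (c * θ) = 0 := by
  have hpi : (0 : ℝ) ≤ 2 * Real.pi := by positivity
  have hv : Continuous v := continuous_iff_continuousAt.mpr fun θ => (h1 θ).continuousAt
  have hv' : Continuous v' := continuous_iff_continuousAt.mpr fun θ => (h2 θ).continuousAt
  have hinv : ContinuousOn (fun θ => (v θ)⁻¹) (Icc 0 (2 * Real.pi)) := hv.continuousOn.inv₀ hne
  have hE : ∀ θ : ℝ, HasDerivAt (fun θ : ℝ => Complex.exp (c * θ)) (Complex.exp (c * θ) * (c * 1)) θ :=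
    fun θ => ((Complex.ofRealCLM.hasDerivAt (x := θ)).const_mul c).cexp
  -- For `g = v⁻²` and `c² = -4` the integrand `(g'' + 4 g) e^{cθ}` is the derivative of `(g' - c g)
  -- e^{cθ}`, which takes equal values at both ends.
  have hF : ∀ θ ∈ uIcc (0 : ℝ) (2 * Real.pi), HasDerivAt
      (fun θ : ℝ => (-2 * v' θ * (v θ)⁻¹ ^ 3 - c * (v θ)⁻¹ ^ 2) * Complex.exp (c * θ))
      ((4 * (v θ)⁻¹ ^ 2 + 6 * v' θ ^ 2 * (v θ)⁻¹ ^ 4 -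
        2 * v'' θ * (v θ)⁻¹ ^ 3) * Complex.exp (c * θ)) θ := by
    intro θ hθ
    rw [uIcc_of_le hpi] at hθ
    have hi := (h1 θ).inv (hne θ hθ)
    have h := ((((h2 θ).const_mul (-2)).mul (hi.pow 3)).sub ((hi.pow 2).const_mul c)).mul (hE θ)
    refine h.congr_deriv ?_
    have h4 : (4 : ℂ) = - c ^ 2 := by rw [hc]; ring
    have hv0 := hne θ hθ
    simp only [Pi.inv_apply, Pi.pow_apply, Pi.mul_apply, Pi.sub_apply]
    rw [h4, show 3 - 1 = 2 from rfl, show 2 - 1 = 1 from rfl]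
    push_cast
    field_simp
    ring
  rw [intervalIntegral.integral_eq_sub_of_hasDerivAt hF, hp, hp', hexp]
  · simp
  · refine ContinuousOn.intervalIntegrable ?_
    rw [uIcc_of_le hpi]
    refine ContinuousOn.mul ?_ (by fun_prop)
    refine ((continuousOn_const.mul (hinv.pow 2)).add
      ((continuousOn_const.mul (hv'.continuousOn.pow 2)).mul (hinv.pow 4))).sub
      ((continuousOn_const.mul h3.continuousOn).mul (hinv.pow 3))

namespace XSpace

variable {n : ℕ} {σ : ℝ}

lemma norm_coef_le (v : XSpace n σ) (k : ℤ) : ‖v.coef k‖ ≤ (xWeight n σ k)⁻¹ * ‖v‖ := by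
  have h : ‖(xWeight n σ k : ℂ) * v.coef k‖ ≤ ‖v‖ :=
    lp.norm_apply_le_norm (p := 2) (by norm_num) (toSeq v) k
  rw [norm_mul, Complex.norm_real, Real.norm_of_nonneg (xWeight_pos n σ k).le] at h
  rw [← div_eq_inv_mul, le_div_iff₀' (xWeight_pos n σ k)]
  exact h

/-- The Fourier coefficient as a continuous functional. -/
def coefL (k : ℤ) : XSpace n σ →L[ℂ] ℂ :=
  LinearMap.mkContinuous
    { toFun := fun v => v.coef k
      map_add' := fun v w => coef_add v w k
      map_smul' := fun c v => coef_smul c v k } (xWeight n σ k)⁻¹ fun v => norm_coef_le v k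

/-- Evaluation of the leading term of the vorticity. -/
lemma integral_leading {m : ℕ} (hn : 1 ≤ n) (hσ : 0 ≤ σ) {v : XSpace m σ}
    {u v' v'' w : XSpace n σ} (hu : ∀ k, u.coef k = v.coef k)
    (hv' : ∀ k, v'.coef k = Complex.I * k * v.coef k)
    (hv'' : ∀ k, v''.coef k = (Complex.I * k) ^ 2 * v.coef k)
    (hw : ∀ᵐ t ∂muT, u.toFun t * w.toFun t = 1) {ε : ℂ} (hε : ε = 1 ∨ ε = -1) :
    ∫ θ, (4 * (u.toFun θ)⁻¹ ^ 2 + 6 * v'.toFun θ ^ 2 * (u.toFun θ)⁻¹ ^ 4 -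
      2 * v''.toFun θ * (u.toFun θ)⁻¹ ^ 3) * Complex.exp (ε * 2 * Complex.I * θ) ∂muT = 0 := by
  have hpi : (0 : ℝ) < 2 * Real.pi := by positivity
  have e' : (fun k : ℤ => Complex.I * k * u.coef k) = v'.coef := by
    funext k; rw [hv', hu]
  have e'' : (fun k : ℤ => Complex.I * k * v'.coef k) = v''.coef := by
    funext k; rw [hv'', hv']; ring
  have su := u.summable_coef hn hσ
  have sv' := v'.summable_coef hn hσ
  have sv'' := v''.summable_coef hn hσ
  have hd1 : ∀ θ, HasDerivAt (fsum u.coef) (fsum v'.coef θ) θ := fun θ => by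
    have := hasDerivAt_fsum su (by simp only [sv', funext_iff.mp e']) θ
    rwa [e'] at this
  have hd2 : ∀ θ, HasDerivAt (fsum v'.coef) (fsum v''.coef θ) θ := fun θ => by
    have := hasDerivAt_fsum sv' (by simp only [sv'', funext_iff.mp e'']) θ
    rwa [e''] at this
  -- The identity `u w = 1` is known almost everywhere; both Fourier sums are continuous, so it
  -- extends to the closed interval and excludes zeros of `u`.
  have hne : ∀ θ ∈ Icc (0 : ℝ) (2 * Real.pi), fsum u.coef θ ≠ 0 := by
    have hc : Continuous fun θ => fsum u.coef θ * fsum w.coef θ :=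
      (continuous_fsum su).mul (continuous_fsum (w.summable_coef hn hσ))
    have hae : (fun θ => fsum u.coef θ * fsum w.coef θ) =ᵐ[muT] fun _ => 1 := by
      filter_upwards [hw, u.ae_eq_fsum_coef hn hσ, w.ae_eq_fsum_coef hn hσ] with t h1 h2 h3
      rw [← h2, ← h3, h1]
    have h1 := (Measure.eqOn_open_of_ae_eq hae isOpen_Ioo hc.continuousOn
      continuousOn_const).closure hc continuous_const
    rw [closure_Ioo hpi.ne] at h1
    intro θ hθ h0
    have := h1 hθ
    simp [h0] at this
  have hc : (ε * 2 * Complex.I) ^ 2 = -4 := by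
    rcases hε with h | h <;> rw [h, mul_pow, Complex.I_sq] <;> norm_num
  have hexp : Complex.exp (ε * 2 * Complex.I * (2 * Real.pi : ℝ)) = 1 := by
    rw [Complex.exp_eq_one_iff]
    rcases hε with h | h
    · exact ⟨2, by rw [h]; push_cast; ring⟩
    · exact ⟨-2, by rw [h]; push_cast; ring⟩
  have key := _root_.integral_leading hd1 hd2 (continuous_fsum sv'') hne (fsum_two_pi _)
    (fsum_two_pi _) hc hexp
  rw [intervalIntegral.integral_of_le hpi.le, ← restrict_Ioo_eq_restrict_Ioc] at key
  refine Eq.trans (integral_congr_ae ?_) key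
  filter_upwards [u.ae_eq_fsum_coef hn hσ, v'.ae_eq_fsum_coef hn hσ, v''.ae_eq_fsum_coef hn hσ]
    with t h1 h2 h3
  rw [h1, h2, h3]

end XSpace

/-- The subspace is the kernel of the Fourier coefficients of indices `±2`, a bounded map with
finite-dimensional range. Composition with the projection restricts the codomain of an analytic map
without disturbing analyticity. -/
lemma JTilde_closedComplemented (γ : ℝ) (n : ℕ) (σ : ℝ) :
    ∃ p : JSpace 0 γ n σ →L[ℂ] JTilde γ n σ, ∀ u : JTilde γ n σ, p u = u := by
  have hpi : (1 / (2 * (Real.pi : ℂ))) ≠ 0 := by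
    have : (Real.pi : ℂ) ≠ 0 := by exact_mod_cast Real.pi_ne_zero
    simp [this]
  let leadL : JSpace 0 γ n σ →L[ℂ] XSpace n σ :=
    LinearMap.mkContinuous JSpace.lead 1 fun a => by rw [one_mul]; exact a.norm_lead_le
  let f : JSpace 0 γ n σ →L[ℂ] ℂ × ℂ :=
    ((XSpace.coefL (-2)).comp leadL).prod ((XSpace.coefL 2).comp leadL)
  have hf : (f : JSpace 0 γ n σ →ₗ[ℂ] ℂ × ℂ).ker = JTilde γ n σ := by
    ext u
    have h1 : ∀ k : ℤ, (JSpace.lead u).coef k = 0 ↔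
        ∫ θ, (JSpace.lead u).toFun θ * Complex.exp (((-k : ℤ) : ℂ) * Complex.I * θ) ∂muT = 0 := by
      intro k
      unfold XSpace.coef fcoef
      rw [mul_eq_zero, or_iff_right hpi]
      have : ∀ θ : ℝ, Complex.exp (-(Complex.I * k * θ)) * (JSpace.lead u).toFun θ =
          (JSpace.lead u).toFun θ * Complex.exp (((-k : ℤ) : ℂ) * Complex.I * θ) := fun θ => by
        rw [mul_comm]
        congr 2
        push_cast
        ring
      simp only [this]
    have h2 : u ∈ (f : JSpace 0 γ n σ →ₗ[ℂ] ℂ × ℂ).ker ↔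
        (JSpace.lead u).coef (-2) = 0 ∧ (JSpace.lead u).coef 2 = 0 := by
      rw [LinearMap.mem_ker]
      exact Prod.ext_iff
    rw [h2, h1, h1]
    constructor
    · rintro ⟨h3, h4⟩ ε (rfl | rfl)
      · simpa using h3
      · simpa using h4
    · intro h
      exact ⟨by simpa using h 1 (Or.inl rfl), by simpa using h (-1) (Or.inr rfl)⟩
  have h := ContinuousLinearMap.ker_closedComplemented_of_finiteDimensional_range f
  rw [hf] at h
  exact h

end

noncomputable section

open scoped ENNReal

/-! ### Functional calculus on `J` -/

namespace JSpace

variable {lam γ : ℝ} {n m : ℕ} {σ : ℝ}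

/-- `f` represents the leading coefficient of `a` and `g` represents `a`. -/
def Rep (a : JSpace 0 γ n σ) (f : ℝ → ℂ) (g : ℝ × ℝ → ℂ) : Prop :=
  (lead a).toFun =ᵐ[muT] f ∧ a.toFun =ᵐ[muPi] g

lemma Rep.refl (a : JSpace 0 γ n σ) : Rep a (lead a).toFun a.toFun :=
  ⟨Filter.EventuallyEq.rfl, Filter.EventuallyEq.rfl⟩

lemma Rep.one : Rep (psiPow 0 γ n σ) (fun _ => 1) fun _ => 1 :=
  ⟨lead_psiPow_ae, toFun_psiPow_zero⟩

lemma Rep.add {a b : JSpace 0 γ n σ} {f f' : ℝ → ℂ} {g g' : ℝ × ℝ → ℂ} (h : Rep a f g)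
    (h' : Rep b f' g') : Rep (a + b) (fun t => f t + f' t) fun x => g x + g' x := by
  constructor
  · filter_upwards [lead_add_ae a b, h.1, h'.1] with t h1 h2 h3
    rw [h1, h2, h3]
  · filter_upwards [toFun_add a b, h.2, h'.2] with t h1 h2 h3
    rw [h1, h2, h3]

lemma Rep.smul {a : JSpace 0 γ n σ} {f : ℝ → ℂ} {g : ℝ × ℝ → ℂ} (c : ℂ) (h : Rep a f g) :
    Rep (c • a) (fun t => c * f t) fun x => c * g x := by
  constructor
  · filter_upwards [lead_smul_ae c a, h.1] with t h1 h2
    rw [h1, h2]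
  · filter_upwards [toFun_smul c a, h.2] with t h1 h2
    rw [h1, h2]

lemma IsMul.rep {a b c : JSpace 0 γ n σ} (h : IsMul a b c) {f f' : ℝ → ℂ} {g g' : ℝ × ℝ → ℂ}
    (ha : Rep a f g) (hb : Rep b f' g') : Rep c (fun t => f t * f' t) fun x => g x * g' x := by
  constructor
  · filter_upwards [h.1, ha.1, hb.1] with t h1 h2 h3
    rw [h1, h2, h3]
  · filter_upwards [h.2, ha.2, hb.2] with t h1 h2 h3
    rw [h1, h2, h3]

section Mul

variable {M : JSpace 0 γ n σ →L[ℂ] JSpace 0 γ n σ →L[ℂ] JSpace 0 γ n σ}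

/-- The inverse with respect to the multiplication `M`. -/
def invM (M : JSpace 0 γ n σ →L[ℂ] JSpace 0 γ n σ →L[ℂ] JSpace 0 γ n σ) (u : JSpace 0 γ n σ) :
    JSpace 0 γ n σ := Ring.inverse (M u) (psiPow 0 γ n σ)

/-- Invertibility of `u` is expressed through the operator `M u`, an open condition in the Banach
algebra of operators; the inverse operator applied to the unit is the reciprocal. No ring structure
on `J` has to be set up. -/
lemma isMul_invM (hM : ∀ a b, IsMul a b (M a b)) {u : JSpace 0 γ n σ} (hu : IsUnit (M u)) :
    IsMul u (invM M u) (psiPow 0 γ n σ) := by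
  have h1 : M u (invM M u) = psiPow 0 γ n σ := by
    have := congrArg (fun L : JSpace 0 γ n σ →L[ℂ] JSpace 0 γ n σ => L (psiPow 0 γ n σ))
      (Ring.mul_inverse_cancel _ hu)
    exact this
  have h2 := hM u (invM M u)
  rwa [h1] at h2

lemma rep_invM (hM : ∀ a b, IsMul a b (M a b)) {u : JSpace 0 γ n σ} (hu : IsUnit (M u)) :
    Rep (invM M u) (fun t => ((lead u).toFun t)⁻¹) fun x => (u.toFun x)⁻¹ := by
  have h := isMul_invM hM hu
  constructor
  · filter_upwards [h.1, lead_psiPow_ae (lam := 0) (γ := γ) (n := n) (σ := σ)] with t h1 h2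
    rw [h2] at h1
    exact eq_inv_of_mul_eq_one_right h1.symm
  · filter_upwards [h.2, toFun_psiPow_zero (γ := γ) (n := n) (σ := σ)] with t h1 h2
    rw [h2] at h1
    exact eq_inv_of_mul_eq_one_right h1.symm

lemma ae_ne_zero (hM : ∀ a b, IsMul a b (M a b)) {u : JSpace 0 γ n σ} (hu : IsUnit (M u)) :
    ∀ᵐ x ∂muPi, u.toFun x ≠ 0 := by
  filter_upwards [(isMul_invM hM hu).2, toFun_psiPow_zero (γ := γ) (n := n) (σ := σ)]
    with x h1 h2 h3
  rw [h2, h3, zero_mul] at h1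
  exact one_ne_zero h1

lemma map_one_eq_one (hM : ∀ a b, IsMul a b (M a b)) : M (psiPow 0 γ n σ) = 1 :=
  ContinuousLinearMap.ext fun b => isMul_unique (hM _ b) (isMul_one b)

lemma analyticAt_mul {E : Type*} [NormedAddCommGroup E] [NormedSpace ℂ E]
    {f g : E → JSpace 0 γ n σ} {a : E} (hf : AnalyticAt ℂ f a) (hg : AnalyticAt ℂ g a) :
    AnalyticAt ℂ (fun a => M (f a) (g a)) a :=
  (M.analyticAt_bilinear (f a, g a)).comp₂ hf hg

/-- Inversion is analytic at units of a complete operator algebra; it is composed with the linear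
map `M` and with evaluation at the unit. -/
lemma analyticAt_invM [CompleteSpace (JSpace 0 γ n σ)] {E : Type*} [NormedAddCommGroup E]
    [NormedSpace ℂ E] {f : E → JSpace 0 γ n σ} {a : E} (hf : AnalyticAt ℂ f a)
    (hu : IsUnit (M (f a))) : AnalyticAt ℂ (fun a => invM M (f a)) a := by
  obtain ⟨z, hz⟩ := hu
  have h1 : AnalyticAt ℂ (fun a => M (f a)) a := (M.analyticAt (f a)).comp hf
  have h2 : AnalyticAt ℂ Ring.inverse (M (f a)) := by rw [← hz]; exact analyticAt_inverse z
  have h3 : AnalyticAt ℂ (fun a => Ring.inverse (M (f a))) a :=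
    AnalyticAt.comp (g := Ring.inverse) (f := fun a => M (f a)) h2 h1
  exact AnalyticAt.comp (f := fun a => Ring.inverse (M (f a)))
    ((ContinuousLinearMap.apply ℂ (JSpace 0 γ n σ) (psiPow 0 γ n σ)).analyticAt _) h3

/-- The expression `Ξ` in terms of the multiplication `M`. -/
def xiM (M : JSpace 0 γ n σ →L[ℂ] JSpace 0 γ n σ →L[ℂ] JSpace 0 γ n σ)
    (a aψ aθ aψψ aψθ aθθ : JSpace 0 γ n σ) : JSpace 0 γ n σ :=
  (-1 : ℂ) • M (M (invM M aψ) (M (invM M aψ) (invM M aψ)))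
      (M (psiPow 0 γ n σ + M (M aθ aθ) (M (invM M a) (invM M a))) aψψ) +
    (2 : ℂ) • M (M aθ (M (M (invM M a) (invM M a)) (M (invM M aψ) (invM M aψ)))) aψθ +
    (-1 : ℂ) • M (M (M (invM M a) (invM M a)) (invM M aψ)) aθθ +
    M (invM M a) (invM M aψ)

lemma rep_xiM (hM : ∀ a b, IsMul a b (M a b)) {a aψ : JSpace 0 γ n σ} (ha : IsUnit (M a))
    (haψ : IsUnit (M aψ)) (aθ aψψ aψθ aθθ : JSpace 0 γ n σ) :
    Rep (xiM M a aψ aθ aψψ aψθ aθθ)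
      (fun t => xiExpr ((lead a).toFun t) ((lead aψ).toFun t) ((lead aθ).toFun t)
        ((lead aψψ).toFun t) ((lead aψθ).toFun t) ((lead aθθ).toFun t))
      (fun x => xiExpr (a.toFun x) (aψ.toFun x) (aθ.toFun x) (aψψ.toFun x) (aψθ.toFun x)
        (aθθ.toFun x)) := by
  have mul : ∀ {a b : JSpace 0 γ n σ} {f f' : ℝ → ℂ} {g g' : ℝ × ℝ → ℂ}, Rep a f g →
    Rep b f' g' → Rep (M a b) (fun t => f t * f' t) fun x => g x * g' x :=
    fun h h' => (hM _ _).rep h h'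
  have i := rep_invM hM ha
  have j := rep_invM hM haψ
  have h := ((((mul (mul j (mul j j)) (mul (Rep.one.add (mul (mul (.refl aθ) (.refl aθ))
    (mul i i))) (.refl aψψ))).smul (-1)).add
    ((mul (mul (.refl aθ) (mul (mul i i) (mul j j))) (.refl aψθ)).smul 2)).add
    ((mul (mul (mul i i) j) (.refl aθθ)).smul (-1))).add (mul i j)
  have e : ∀ a aψ aθ aψψ aψθ aθθ : ℂ, -1 * (aψ⁻¹ * (aψ⁻¹ * aψ⁻¹) * ((1 + aθ * aθ * (a⁻¹ * a⁻¹)) * aψψ)) +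
      2 * (aθ * (a⁻¹ * a⁻¹ * (aψ⁻¹ * aψ⁻¹)) * aψθ) + -1 * (a⁻¹ * a⁻¹ * aψ⁻¹ * aθθ) + a⁻¹ * aψ⁻¹ =
      xiExpr a aψ aθ aψψ aψθ aθθ := by
    intros
    simp only [xiExpr, div_eq_mul_inv, mul_inv, ← inv_pow]
    ring
  refine ⟨h.1.trans ?_, h.2.trans ?_⟩
  · exact Filter.Eventually.of_forall fun t => e _ _ _ _ _ _
  · exact Filter.Eventually.of_forall fun t => e _ _ _ _ _ _

lemma analyticAt_xiM [CompleteSpace (JSpace 0 γ n σ)] {E : Type*} [NormedAddCommGroup E]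
    [NormedSpace ℂ E] {f fψ fθ fψψ fψθ fθθ : E → JSpace 0 γ n σ} {x : E}
    (hf : AnalyticAt ℂ f x) (hψ : AnalyticAt ℂ fψ x) (hθ : AnalyticAt ℂ fθ x)
    (hψψ : AnalyticAt ℂ fψψ x) (hψθ : AnalyticAt ℂ fψθ x) (hθθ : AnalyticAt ℂ fθθ x)
    (hu : IsUnit (M (f x))) (huψ : IsUnit (M (fψ x))) :
    AnalyticAt ℂ (fun y => xiM M (f y) (fψ y) (fθ y) (fψψ y) (fψθ y) (fθθ y)) x := by
  have i := analyticAt_invM hf hu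
  have j := analyticAt_invM hψ huψ
  have ii := analyticAt_mul (M := M) i i
  have jj := analyticAt_mul (M := M) j j
  have jjj := analyticAt_mul (M := M) j jj
  have t1 := analyticAt_mul (M := M) jjj (analyticAt_mul (M := M)
    (AnalyticAt.fun_add (analyticAt_const (v := psiPow 0 γ n σ))
      (analyticAt_mul (M := M) (analyticAt_mul (M := M) hθ hθ) ii)) hψψ)
  have t2 := analyticAt_mul (M := M) (analyticAt_mul (M := M) hθ (analyticAt_mul (M := M) ii jj)) hψθ
  have t3 := analyticAt_mul (M := M) (analyticAt_mul (M := M) ii j) hθθ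
  have t4 := analyticAt_mul (M := M) i j
  exact ((t1.fun_const_smul.fun_add t2.fun_const_smul).fun_add t3.fun_const_smul).fun_add t4

end Mul

lemma IsDeriv.ae_eq {a : JSpace lam γ m σ} {b : JSpace 0 γ n σ} (h : IsDeriv 0 0 a b) :
    a.toFun =ᵐ[muPi] wmul lam b.toFun := by
  have e1 : (lead a).toFun =ᵐ[muT] (lead b).toFun :=
    ae_eq_of_fcoef (XSpace.memLp _) (XSpace.memLp _) fun k => by
      have := h.1 k
      simp only [powCoef, Finset.range_zero, Finset.prod_empty, pow_zero, one_mul] at this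
      exact this.symm
  have e2 : (KSig.base (rem b)).1 (DIdx.zero n) = (KSig.base (rem a)).1 (DIdx.zero m) :=
    ext_cf fun k => by
      rw [← kc_zero, ← kc_zero, h.2, pow_zero, one_smul]
  filter_upwards [ae_muPi_snd e1, ae_mem_muPi] with x h1 h2
  rw [toFun_apply, wmul, toFun_zero_apply, h1, mul_add, mul_comm]
  congr 1
  simp only [KSig.fn, kFun, wmul, e2]
  rw [← mul_assoc, ← Complex.ofReal_mul, ← Real.rpow_add h2.1.1, zero_add]

lemma coef_one_eq (n m : ℕ) (σ : ℝ) : (XSpace.one n σ).coef = (XSpace.one m σ).coef := by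
  funext k
  exact fcoef_congr (XSpace.toFun_one.trans XSpace.toFun_one.symm) k

/-- At the model solution the rescaled radial derivatives are constants, so multiplication by them
is a scalar operator. -/
lemma isDeriv_psiPow (p : ℕ) :
    IsDeriv p 0 (psiPow lam γ m σ) (powCoef lam p • psiPow 0 γ n σ) := by
  constructor
  · intro k
    rw [map_smul, XSpace.coef_smul, pow_zero, mul_one]
    change _ * (XSpace.one n σ).coef k = _ * (XSpace.one m σ).coef k
    rw [coef_one_eq n m]
  · intro k
    have h : ∀ {n' : ℕ} {γ' : ℝ} (p : ℕ), kc (KSig.base (0 : KSig n' γ' σ)).1 p k = 0 := by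
      intro n' γ' p
      have := KSig.kc_smul (0 : ℂ) (0 : KSig n' γ' σ) p k
      rwa [zero_smul, zero_smul] at this
    rw [map_smul rem, KSig.kc_smul]
    change _ • kc (KSig.base (0 : KSig n (0 + γ) σ)).1 0 k =
      _ • kc (KSig.base (0 : KSig m (lam + γ) σ)).1 p k
    rw [h, h, smul_zero, smul_zero]

lemma IsDeriv.unique {p q : ℕ} {a : JSpace lam γ m σ} {b b' : JSpace 0 γ n σ}
    (h : IsDeriv p q a b) (h' : IsDeriv p q a b') : b = b' := by
  refine Prod.ext (XSpace.ext_coef (v := lead b) (w := lead b') ?_)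
    (KSig.ext_kc (P := rem b) (Q := rem b') ?_)
  · funext k; rw [h.1, h'.1]
  · intro k; rw [h.2, h'.2]

end JSpace

/-- Every term of `Ξ` has total degree zero under this scaling. For `r = ψ^{1/2}` it is the
cancellation of all powers of `ψ`. -/
lemma xiExpr_scale {r : ℂ} (hr : r ≠ 0) {a aψ : ℂ} (ha : a ≠ 0) (haψ : aψ ≠ 0)
    (aθ aψψ aψθ aθθ : ℂ) : xiExpr (r * a) (r⁻¹ * aψ) (r * aθ) (r⁻¹ ^ 3 * aψψ) (r⁻¹ * aψθ) (r * aθθ) =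
      xiExpr a aψ aθ aψψ aψθ aθθ := by
  unfold xiExpr
  field_simp

/-- The arguments are the rescaled derivatives of `v(θ) ψ^{1/2}`. With `g = v⁻²` the right side is
`g'' + 4 g`, the form whose modes `±2` vanish. -/
lemma xiExpr_lead {v : ℂ} (hv : v ≠ 0) (v' v'' : ℂ) :
    xiExpr v (1 / 2 * v) v' (-(1 / 4) * v) (1 / 2 * v') v'' =
      4 * v⁻¹ ^ 2 + 6 * v' ^ 2 * v⁻¹ ^ 4 - 2 * v'' * v⁻¹ ^ 3 := by
  unfold xiExpr
  field_simp
  ring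

lemma powCoef_half : powCoef (1 / 2) 0 = 1 ∧ powCoef (1 / 2) 1 = 1 / 2 ∧
    powCoef (1 / 2) 2 = -(1 / 4) := by
  refine ⟨by simp [powCoef], ?_, ?_⟩ <;>
  · simp only [powCoef, Finset.prod_range_succ, Finset.prod_range_zero]
    push_cast
    norm_num

lemma rpow_half_sub {s : ℝ} (hs : 0 < s) : ∀ p : ℕ,
    s ^ (1 / 2 - (p : ℝ)) = s ^ (1 / 2 : ℝ) * (s ^ (1 / 2 : ℝ))⁻¹ ^ (2 * p) := by
  intro p
  rw [Real.rpow_sub hs, Real.rpow_natCast, div_eq_mul_inv, inv_pow, pow_mul, ← Real.rpow_natCast _ 2,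
    ← Real.rpow_mul hs.le]
  norm_num

end

/-! ### The vorticity operator near `ψ^{1/2}` and the main theorem. -/

noncomputable section

namespace JSpace

variable {γ : ℝ} {n m : ℕ} {σ : ℝ}

/-- Taking the leading coefficient commutes with products and inverses, so only the leading
coefficients of the rescaled derivatives enter. The radial ones are the multiples `1/2` and `-1/4`
given by `powCoef_half`, and `xiExpr_lead` applies. -/
lemma xiM_mem_JTilde (hn : 1 ≤ n) (hσ : 0 ≤ σ)
    {M : JSpace 0 γ n σ →L[ℂ] JSpace 0 γ n σ →L[ℂ] JSpace 0 γ n σ}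
    (hM : ∀ a b, IsMul a b (M a b)) {a : JSpace (1 / 2) γ m σ} {b : ℕ → ℕ → JSpace 0 γ n σ}
    (hb : ∀ p q, p + q ≤ 2 → IsDeriv p q a (b p q)) (h0 : IsUnit (M (b 0 0)))
    (h1 : IsUnit (M (b 1 0))) :
    xiM M (b 0 0) (b 1 0) (b 0 1) (b 2 0) (b 1 1) (b 0 2) ∈ JTilde γ n σ := by
  intro ε hε
  obtain ⟨c0, c1, c2⟩ := powCoef_half
  have e00 := (hb 0 0 (by norm_num)).1
  have e10 := (hb 1 0 (by norm_num)).1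
  have e01 := (hb 0 1 (by norm_num)).1
  have e20 := (hb 2 0 (by norm_num)).1
  have e11 := (hb 1 1 (by norm_num)).1
  have e02 := (hb 0 2 (by norm_num)).1
  simp only [c0, c1, c2, pow_zero, pow_one, mul_one, one_mul] at e00 e10 e01 e20 e11 e02
  have ext : ∀ {u w : XSpace n σ} (c : ℂ), (∀ k, u.coef k = c * w.coef k) →
      u.toFun =ᵐ[muT] fun t => c * w.toFun t := fun {u w} c h => by
    have : u = c • w := XSpace.ext_coef (funext fun k => by rw [h, XSpace.coef_smul])
    rw [this]
    exact XSpace.toFun_smul c w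
  have f10 := ext (u := lead (b 1 0)) (w := lead (b 0 0)) (1 / 2) fun k => by rw [e10, e00]
  have f20 := ext (u := lead (b 2 0)) (w := lead (b 0 0)) (-(1 / 4)) fun k => by rw [e20, e00]
  have f11 := ext (u := lead (b 1 1)) (w := lead (b 0 1)) (1 / 2) fun k => by
    rw [e11, e01, mul_assoc]
  have hw : ∀ᵐ t ∂muT, (lead (b 0 0)).toFun t * (lead (invM M (b 0 0))).toFun t = 1 := by
    filter_upwards [(isMul_invM hM h0).1, lead_psiPow_ae (lam := 0) (γ := γ) (n := n) (σ := σ)]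
      with t g1 g2
    rw [← g1, g2]
  refine Eq.trans (integral_congr_ae ?_)
    (XSpace.integral_leading hn hσ (v := lead a) e00 e01 e02 hw hε)
  filter_upwards [(rep_xiM hM h0 h1 (b 0 1) (b 2 0) (b 1 1) (b 0 2)).1, f10, f20, f11, hw]
    with t g1 g2 g3 g4 g5
  have hne : (lead (b 0 0)).toFun t ≠ 0 := left_ne_zero_of_mul (by rw [g5]; exact one_ne_zero)
  rw [g1, g2, g3, g4, xiExpr_lead hne]

lemma isVorticity_xiM (hm : 2 ≤ m)
    {M : JSpace 0 γ n σ →L[ℂ] JSpace 0 γ n σ →L[ℂ] JSpace 0 γ n σ}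
    (hM : ∀ a b, IsMul a b (M a b)) {a : JSpace (1 / 2) γ m σ} {b : ℕ → ℕ → JSpace 0 γ n σ}
    (hb : ∀ p q, p + q ≤ 2 → IsDeriv p q a (b p q)) (h0 : IsUnit (M (b 0 0)))
    (h1 : IsUnit (M (b 1 0))) :
    IsVorticity a.toFun (xiM M (b 0 0) (b 1 0) (b 0 1) (b 2 0) (b 1 1) (b 0 2)).toFun := by
  have hw : ∀ p q, p + q ≤ 2 →
      IsWeakDeriv p q a.toFun (wmul (1 / 2 - p) (b p q).toFun) := fun p q h =>
    (hb p q h).isWeakDeriv (h.trans hm)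
  refine ⟨_, _, _, _, _, hw 1 0 (by norm_num), hw 0 1 (by norm_num), hw 2 0 (by norm_num),
    hw 1 1 (by norm_num), hw 0 2 (by norm_num), ?_⟩
  filter_upwards [(hb 0 0 (by norm_num)).ae_eq, ae_ne_zero hM h0, ae_ne_zero hM h1, ae_mem_muPi,
    (rep_xiM hM h0 h1 (b 0 1) (b 2 0) (b 1 1) (b 0 2)).2] with x ha g0 g1 hx hxi
  have hr : ((x.1 ^ (1 / 2 : ℝ) : ℝ) : ℂ) ≠ 0 := by
    exact_mod_cast (Real.rpow_pos_of_pos hx.1.1 _).ne'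
  -- Scaling by `r = ψ^{1/2}` passes from the rescaled derivatives to the true ones.
  rw [hxi, ← xiExpr_scale hr g0 g1]
  simp only [wmul, rpow_half_sub hx.1.1] at ha ⊢
  push_cast
  rw [ha]
  have i1 : ((x.1 ^ (1 / 2 : ℝ) : ℝ) : ℂ) * ((x.1 ^ (1 / 2 : ℝ) : ℝ) : ℂ)⁻¹ ^ (2 * 1) =
      ((x.1 ^ (1 / 2 : ℝ) : ℝ) : ℂ)⁻¹ := by
    rw [show 2 * 1 = 2 from rfl]; field_simp
  have i2 : ((x.1 ^ (1 / 2 : ℝ) : ℝ) : ℂ) * ((x.1 ^ (1 / 2 : ℝ) : ℝ) : ℂ)⁻¹ ^ (2 * 2) =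
      ((x.1 ^ (1 / 2 : ℝ) : ℝ) : ℂ)⁻¹ ^ 3 := by
    rw [show 2 * 2 = 4 from rfl]; field_simp
  have i0 : ((x.1 ^ (1 / 2 : ℝ) : ℝ) : ℂ) * ((x.1 ^ (1 / 2 : ℝ) : ℝ) : ℂ)⁻¹ ^ (2 * 0) =
      ((x.1 ^ (1 / 2 : ℝ) : ℝ) : ℂ) := by simp
  rw [i0, i1, i2]
  exact ⟨mul_ne_zero hr g0, mul_ne_zero (inv_ne_zero hr) g1, rfl⟩

end JSpace

end

theorem mainTheorem6 (m : ℕ) (γ σ : ℝ) (hm : 3 < m) (hγ : 1 / 2 < γ) (hσ : 0 < σ) :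
    ∃ b : ℕ → ℕ → JSpace (1 / 2) γ m σ → JSpace 0 γ (m - 2) σ,
      (∀ p q : ℕ, p + q ≤ 2 → ∀ a : JSpace (1 / 2) γ m σ,
        IsWeakDeriv p q a.toFun (wmul (1 / 2 - p) (b p q a).toFun)) ∧
      ∃ U : Set (JSpace (1 / 2) γ m σ), IsOpen U ∧ psiPow (1 / 2) γ m σ ∈ U ∧
        ∃ Xi : JSpace (1 / 2) γ m σ → JTilde γ (m - 2) σ,
          AnalyticOnNhd ℂ Xi U ∧
          ∀ a ∈ U, IsVorticity a.toFun (Xi a : JSpace 0 γ (m - 2) σ).toFun ∧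
            ∀ᵐ x ∂muPi, (Xi a : JSpace 0 γ (m - 2) σ).toFun x =
              xiExpr ((b 0 0 a).toFun x) ((b 1 0 a).toFun x) ((b 0 1 a).toFun x)
                ((b 2 0 a).toFun x) ((b 1 1 a).toFun x) ((b 0 2 a).toFun x) := by
  -- This is where `m > 3` enters: the algebra property needs order two after two derivatives are
  -- lost.
  have hn : 2 ≤ m - 2 := by omega
  have hn1 : 1 ≤ m - 2 := by omega
  have hex : ∀ p q : ℕ, ∃ B : JSpace (1 / 2) γ m σ →L[ℂ] JSpace 0 γ (m - 2) σ,
      p + q ≤ 2 → ∀ a, JSpace.IsDeriv p q a (B a) := by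
    intro p q
    by_cases h : p + q ≤ 2
    · obtain ⟨B, hB⟩ := JSpace.exists_deriv (lam := 1 / 2) (γ := γ) hn1
        (by omega : m - 2 + 2 ≤ m) hσ.le h
      exact ⟨B, fun _ => hB⟩
    -- A default value for index pairs of order above two, which never occur in `Ξ`.
    · exact ⟨0, fun h' => absurd h' h⟩
  choose b hb using hex
  obtain ⟨M, hM⟩ := JSpace.exists_mul (n := m - 2) (γ := γ) hn hγ.le hσ.le
  obtain ⟨P, hP⟩ := JTilde_closedComplemented γ (m - 2) σ
  have : CompleteSpace (JSpace 0 γ (m - 2) σ) := JSpace.completeSpace hn1 hσ.le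
  have hba : ∀ a, ∀ p q : ℕ, p + q ≤ 2 → JSpace.IsDeriv p q a (b p q a) :=
    fun a p q h => hb p q h a
  -- At `ψ^{1/2}` the operators `M (b 0 0 _)` and `M (b 1 0 _)` are the scalars `1` and `1/2`, so
  -- the base point satisfies both invertibility conditions.
  have hone : ∀ p : ℕ, p ≤ 2 → powCoef (1 / 2) p ≠ 0 →
      IsUnit (M (b p 0 (psiPow (1 / 2) γ m σ))) := by
    intro p hp hne
    rw [(hb p 0 (by omega) _).unique (JSpace.isDeriv_psiPow p), map_smul, JSpace.map_one_eq_one hM]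
    exact (isUnit_one (M := JSpace 0 γ (m - 2) σ →L[ℂ] JSpace 0 γ (m - 2) σ)).smul
      (Units.mk0 _ hne)
  refine ⟨fun p q a => b p q a, fun p q h a => (hb p q h a).isWeakDeriv (by omega),
    {a | IsUnit (M (b 0 0 a))} ∩ {a | IsUnit (M (b 1 0 a))}, ?_, ⟨?_, ?_⟩,
    fun a => P (JSpace.xiM M (b 0 0 a) (b 1 0 a) (b 0 1 a) (b 2 0 a) (b 1 1 a) (b 0 2 a)), ?_, ?_⟩
  · exact (Units.isOpen.preimage (M.continuous.comp (b 0 0).continuous)).inter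
      (Units.isOpen.preimage (M.continuous.comp (b 1 0).continuous))
  · exact hone 0 (by norm_num) (by rw [powCoef_half.1]; exact one_ne_zero)
  · exact hone 1 (by norm_num) (by rw [powCoef_half.2.1]; norm_num)
  · intro a ha
    have an : ∀ p q, AnalyticAt ℂ (fun a => b p q a) a := fun p q => (b p q).analyticAt a
    exact (P.analyticAt _).comp (JSpace.analyticAt_xiM (an 0 0) (an 1 0) (an 0 1) (an 2 0)
      (an 1 1) (an 0 2) ha.1 ha.2)
  · intro a ha
    -- On `U` the value already lies in the subspace, so the projection `P` leaves it unchanged.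
    have e := hP ⟨_, JSpace.xiM_mem_JTilde hn1 hσ.le hM (b := fun p q => b p q a) (hba a)
      ha.1 ha.2⟩
    dsimp only at e ⊢
    rw [e]
    exact ⟨JSpace.isVorticity_xiM (by omega) hM (b := fun p q => b p q a) (hba a) ha.1 ha.2,
      (JSpace.rep_xiM hM ha.1 ha.2 _ _ _ _).2⟩
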